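/- Let $N\ge 1$, let $G\subset\mathbb R^N$ be open and let $V_N:G\to\mathbb R$ be a smooth ($C^\infty$) Morse function (its Hessian determinant is nonzero at every stationary point) with exactly one stationary point $q^{\mathrm s}\in G$; let $k$ be the index of $q^{\mathrm s}$ (the number of negative eigenvalues of the Hessian $\mathcal H_V(q^{\mathrm s})$) and suppose $V_N(q^{\mathrm s})=0$. For a function $w$ on $G$ write $$\Omega^{w}_N(v)=\int_G w(q)\,\delta\bigl(V_N(q)-Nv\bigr)\,\mathrm dq:=\lim_{\eta\to0+}\int_G w(q)\,\tfrac1\eta\,\psi\Bigl(\tfrac{V_N(q)-Nv}{\eta}\Bigr)\,\mathrm dq ,$$ where it is required that, for every continuous compactly supported $\psi:\mathbb R\to\mathbb R$ with $\int\psi=1$, the integrals converge absolutely for small $\eta>0$ and the limit exists, with the same value for all such $\psi$. The configurational density of states is $\Omega_N=\Omega_N^{1}$. Let $\Theta$ be the Heaviside step function and $$h_{N,k}(v)=\frac{(2\pi)^{N/2}N^{(N-2)/2}}{\Gamma(N/2)}\cdot\begin{cases}(-1)^{k/2}\,v^{(N-2)/2}\,\Theta(v)&k\text{ even},\\(-1)^{(k+1)/2}\,v^{(N-2)/2}\,\pi^{-1}\ln|v|&N\text{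 even, }k\text{ odd},\\(-1)^{(N-k)/2}\,(-v)^{(N-2)/2}\,\Theta(-v)&N,k\text{ odd}.\end{cases}$$ (1) Suppose that $\{q\in G:|V_N(q)|\le b\}$ is compact for some $b>0$ (the levels of $V_N$ near $0$ reach neither the boundary of $G$ nor infinity). Then $\Omega_N(v)$ exists for all $v\ne0$ close to $0$, and there is a polynomial $P$ of degree less than $N/2$ such that, for every $\epsilon>0$, $$\Omega_N(v)=P(v)+\frac{h_{N,k}(v)}{\sqrt{|\det\mathcal H_V(q^{\mathrm s})|}}+o\bigl(|v|^{N/2-\epsilon}\bigr)\qquad(v\to0,\ v\neq0).$$ (2) Without any assumption on the behaviour of $V_N$ near the boundary of $G$ or at infinity, the contribution of the stationary point has the same form: for every smooth function $\varphi$ with compact support in $G$ that equals $1$ in a neighbourhood of $q^{\mathrm s}$, $\Omega^{\varphi}_N(v)$ exists for all $v\neq0$ close to $0$, and the expansion in (1) holds for $\Omega_N^{\varphi}$ in place of $\Omega_N$, with a polynomial $P$ of degree less than $N/2$ that may depend on $\varphi$. -/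

import Mathlib

open Filter Topology MeasureTheory Asymptotics
open scoped ContDiff

noncomputable section

/-- The Hessian matrix of `V` at `q`, in the standard coordinates of `ℝ^N`. -/
def hessian {N : ℕ} (V : EuclideanSpace ℝ (Fin N) → ℝ) (q : EuclideanSpace ℝ (Fin N)) :
    Matrix (Fin N) (Fin N) ℝ :=
  Matrix.of fun i j =>
    fderiv ℝ (fderiv ℝ V) q (EuclideanSpace.single i 1) (EuclideanSpace.single j 1)

/-- `V` is a (smooth) Morse function on `G`: its Hessian determinant does not vanish at any
stationary point in `G`. -/
def IsMorseOn {N : ℕ} (V : EuclideanSpace ℝ (Fin N) → ℝ) (G : Set (EuclideanSpace ℝ (Fin N))) :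
    Prop :=
  ContDiffOn ℝ ∞ V G ∧ ∀ q ∈ G, fderiv ℝ V q = 0 → (hessian V q).det ≠ 0

/-- The index of a stationary point: the largest dimension of a subspace on which the Hessian
quadratic form is negative definite. -/
def morseIndex {N : ℕ} (V : EuclideanSpace ℝ (Fin N) → ℝ) (q : EuclideanSpace ℝ (Fin N)) : ℕ :=
  sigNeg (hessian V q).toQuadraticForm'

/-- A profile `ψ` whose rescalings `η⁻¹ ψ(· / η)` tend to the Dirac delta as `η → 0+`. -/
structure IsDeltaProfile (ψ : ℝ → ℝ) : Prop where
  continuous : Continuous ψ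
  hasCompactSupport : HasCompactSupport ψ
  integral_eq_one : ∫ x, ψ x = 1

/-- `I = ∫_G w(q) δ(V(q) - E) dq`: for every delta profile `ψ`, the integrals
`∫_G w(q) η⁻¹ ψ((V(q) - E) / η) dq` exist for small `η > 0` and converge to `I` as `η → 0+`. -/
def IsDeltaIntegral {N : ℕ} (G : Set (EuclideanSpace ℝ (Fin N)))
    (w V : EuclideanSpace ℝ (Fin N) → ℝ) (E I : ℝ) : Prop :=
  ∀ ψ : ℝ → ℝ, IsDeltaProfile ψ →
    (∀ᶠ η in 𝓝[>] (0 : ℝ), IntegrableOn (fun q => w q * (η⁻¹ * ψ ((V q - E) / η))) G) ∧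
    Tendsto (fun η : ℝ => ∫ q in G, w q * (η⁻¹ * ψ ((V q - E) / η))) (𝓝[>] 0) (𝓝 I)

/-- The Heaviside step function (its value at `0` plays no role below). -/
def heavisideStep (x : ℝ) : ℝ := if 0 < x then 1 else 0

/-- The nonanalytic term `h_{N,k}(v)`, with the normalization that belongs to the Lebesgue measure
`dq` and to the energy `E = N v`. The quotients in exponents of `-1`, and the exponent
`(N - 2) / 2` in the second case, are exact divisions of natural numbers (for `k ≤ N`). -/
def hTerm (N k : ℕ) (v : ℝ) : ℝ :=
  (2 * Real.pi) ^ ((N : ℝ) / 2) * (N : ℝ) ^ (((N : ℝ) - 2) / 2) / Real.Gamma ((N : ℝ) / 2) *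
    if Even k then
      (-1) ^ (k / 2) * v ^ (((N : ℝ) - 2) / 2) * heavisideStep v
    else if Even N then
      (-1) ^ ((k + 1) / 2) * v ^ ((N - 2) / 2 : ℕ) * Real.pi⁻¹ * Real.log |v|
    else
      (-1) ^ ((N - k) / 2) * (-v) ^ (((N : ℝ) - 2) / 2) * heavisideStep (-v)

/-- `Ω(v) = P(v) + h_{N,k}(v) / √|d| + o(|v|^{N/2 - ε})` as `v → 0`, `v ≠ 0`, for every `ε > 0`,
with a polynomial `P` of degree less than `N / 2` that does not depend on `ε`. -/
def HasSingularExpansion (N k : ℕ) (d : ℝ) (Ω : ℝ → ℝ) : Prop :=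
  ∃ P : Polynomial ℝ, 2 * P.natDegree < N ∧ ∀ ε : ℝ, 0 < ε →
    (fun v => Ω v - (P.eval v + hTerm N k v / √|d|)) =o[𝓝[≠] 0]
      fun v => |v| ^ ((N : ℝ) / 2 - ε)

end

/-!
The density of states of weight `w` is the density of the push-forward under `V` of the signed
measure `w(q) dq` (`HasDens`); a delta integral is the value of this density at a point of
continuity (`HasDens.isDeltaIntegral`). The theorem therefore concerns the singularity of such
densities at `0`, up to polynomials and to errors `O(|x| ^ t)` for all `t < N / 2` (`PolyMod`).

The local analysis rests on integration by parts along a vector field `Y`: the density of the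
weight `Y · ∇V` is a primitive of the density of `div Y`. Each integration improves the order of
the remainder by one, and iterating gives an expansion to any order (`exists_hasDens_of_step`).
Where `∇V ≠ 0`, every weight has the form `Y · ∇V`, so its density is polynomial up to any order
(`exists_hasDens_of_fderiv_ne_zero`). For a diagonal form `½ ∑ σᵢ xᵢ²` with `σᵢ = ±1`, Hadamard's
lemma writes every weight vanishing at the origin in this way; hence the density of a weight `w`
is `w 0 • ρ₀`, up to a polynomial and terms of the order of a primitive of `ρ₀`, where `ρ₀` is the
density of one reference weight (`exists_hasDens_diagForm`).

The reference densities are computed by induction on the dimension (`hasModelWeight`). In the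
plane, `½ (a² + b²)` has as density `2π` times the Heaviside function, so adding two squares of
equal sign convolves a density with a step: it integrates the singular term, up to a sign and a
smooth function. This matches the recursion of the terms `h_{N,k}` in `N`. The induction starts
from `±½ x²` on the line, from `±½ (a² + b²)`, and from the saddle `½ (x² - y²) = ½ a b`, whose
density is logarithmic.

The Morse lemma (`exists_morse_chart`) and Sylvester's law of inertia
(`exists_linearEquiv_diagonalizing`) reduce `V` near its stationary point to a diagonal form. The
chart is tangent to the identity, and the linear change of coordinates has determinant
`±√|det H|`, which is the denominator of the singular term. A cutoff separates the neighbourhood of the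
stationary point from the rest of the support of the weight, which contributes only a polynomial
to the expansion.

If the levels close to `0` form a compact set, the weight `1` may be replaced by a cutoff equal to
`1` near this set, because the delta integral at a small energy sees only those levels.
-/

noncomputable section

/-! ### Functions that are polynomial up to a power of the variable -/

/-- `r` agrees near `0` (but off `0`) with a polynomial, up to an error that is `O(|x|^t)` for
every exponent `t < s`. -/
def PolyMod (s : ℝ) (r : ℝ → ℝ) : Prop :=
  ∃ P : Polynomial ℝ, ∀ t : ℝ, t < s →
    (fun x => r x - P.eval x) =O[𝓝[≠] 0] fun x => |x| ^ t

lemma rpow_abs_isBigO {t t' : ℝ} (h : t ≤ t') :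
    (fun x : ℝ => |x| ^ t') =O[𝓝[≠] 0] fun x : ℝ => |x| ^ t := by
  refine IsBigO.of_bound 1 ?_
  have h1 : ∀ᶠ x : ℝ in 𝓝[≠] 0, |x| < 1 := by
    apply eventually_nhdsWithin_of_eventually_nhds
    have := Metric.ball_mem_nhds (0 : ℝ) one_pos
    filter_upwards [this] with x hx
    simpa using hx
  filter_upwards [h1, self_mem_nhdsWithin] with x hx hx0
  have hpos : 0 < |x| := abs_pos.2 hx0
  rw [one_mul, Real.norm_of_nonneg (by positivity), Real.norm_of_nonneg (by positivity)]
  exact Real.rpow_le_rpow_of_exponent_ge hpos hx.le h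

lemma PolyMod.mono {s s' : ℝ} {r : ℝ → ℝ} (h : PolyMod s r) (hs : s' ≤ s) : PolyMod s' r := by
  obtain ⟨P, hP⟩ := h
  exact ⟨P, fun t ht => hP t (ht.trans_le hs)⟩

lemma PolyMod.congr {s : ℝ} {r r' : ℝ → ℝ} (h : PolyMod s r) (he : r =ᶠ[𝓝[≠] 0] r') :
    PolyMod s r' := by
  obtain ⟨P, hP⟩ := h
  refine ⟨P, fun t ht => (hP t ht).congr' ?_ EventuallyEq.rfl⟩
  filter_upwards [he] with x hx
  rw [hx]

lemma PolyMod.add {s : ℝ} {r r' : ℝ → ℝ} (h : PolyMod s r) (h' : PolyMod s r') :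
    PolyMod s (fun x => r x + r' x) := by
  obtain ⟨P, hP⟩ := h
  obtain ⟨P', hP'⟩ := h'
  refine ⟨P + P', fun t ht => ((hP t ht).add (hP' t ht)).congr_left fun x => ?_⟩
  simp only [Polynomial.eval_add]
  ring

lemma PolyMod.const_mul {s : ℝ} {r : ℝ → ℝ} (h : PolyMod s r) (c : ℝ) :
    PolyMod s (fun x => c * r x) := by
  obtain ⟨P, hP⟩ := h
  refine ⟨Polynomial.C c * P, fun t ht => ((hP t ht).const_mul_left c).congr_left fun x => ?_⟩
  simp only [Polynomial.eval_mul, Polynomial.eval_C]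
  ring

lemma PolyMod.sub {s : ℝ} {r r' : ℝ → ℝ} (h : PolyMod s r) (h' : PolyMod s r') :
    PolyMod s (fun x => r x - r' x) :=
  (h.add (h'.const_mul (-1))).congr (Eventually.of_forall fun x => by ring)

lemma polyMod_polynomial (s : ℝ) (P : Polynomial ℝ) : PolyMod s fun x => P.eval x :=
  ⟨P, fun t _ => by simpa using isBigO_zero _ _⟩

lemma polyMod_const (s c : ℝ) : PolyMod s fun _ => c :=
  (polyMod_polynomial s (Polynomial.C c)).congr (Eventually.of_forall fun x => by simp)

lemma polyMod_pow (s : ℝ) (n : ℕ) : PolyMod s fun x => x ^ n :=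
  (polyMod_polynomial s (Polynomial.X ^ n)).congr (Eventually.of_forall fun x => by simp)

lemma PolyMod.of_isBigO {s : ℝ} {r : ℝ → ℝ}
    (h : ∀ t < s, r =O[𝓝[≠] 0] fun x => |x| ^ t) : PolyMod s r :=
  ⟨0, fun t ht => by simpa using h t ht⟩

lemma PolyMod.of_bounded {r : ℝ → ℝ} {C : ℝ} (h : ∀ᶠ x in 𝓝[≠] 0, |r x| ≤ C) : PolyMod 0 r := by
  refine PolyMod.of_isBigO fun t ht => ?_
  have h1 : r =O[𝓝[≠] 0] fun x : ℝ => |x| ^ (0 : ℝ) :=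
    IsBigO.of_bound C (by filter_upwards [h] with x hx; simpa using hx)
  exact h1.trans (rpow_abs_isBigO ht.le)

lemma pow_isBigO_rpow (n : ℕ) (t : ℝ) (h : t ≤ n) :
    (fun x : ℝ => x ^ n) =O[𝓝[≠] 0] fun x => |x| ^ t := by
  have h1 : (fun x : ℝ => x ^ n) =O[𝓝[≠] 0] fun x : ℝ => |x| ^ (n : ℝ) :=
    IsBigO.of_bound 1 (Eventually.of_forall fun x => by simp)
  exact h1.trans (rpow_abs_isBigO h)

/-- The polynomial of `PolyMod s r` can be cut off at any degree `≥ s`. -/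
lemma PolyMod.exists_natDegree_lt {n : ℕ} (hn : 0 < n) {r : ℝ → ℝ} (h : PolyMod (n / 2) r) :
    ∃ P : Polynomial ℝ, 2 * P.natDegree < n ∧ ∀ t : ℝ, t < n / 2 →
      (fun x => r x - P.eval x) =O[𝓝[≠] 0] fun x => |x| ^ t := by
  obtain ⟨P, hP⟩ := h
  have key : ∀ Q : Polynomial ℝ, ∃ P : Polynomial ℝ, 2 * P.natDegree < n ∧ ∀ t : ℝ, t < n / 2 →
      (fun x => Q.eval x - P.eval x) =O[𝓝[≠] 0] fun x => |x| ^ t := by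
    intro Q
    induction Q using Polynomial.induction_on' with
    | add p q hp hq =>
      obtain ⟨P1, h1, h1'⟩ := hp
      obtain ⟨P2, h2, h2'⟩ := hq
      refine ⟨P1 + P2, ?_, fun t ht => ((h1' t ht).add (h2' t ht)).congr_left fun x => ?_⟩
      · have := Polynomial.natDegree_add_le P1 P2
        rcases le_total P1.natDegree P2.natDegree with h | h <;> simp [h] at this <;> omega
      · simp only [Polynomial.eval_add]
        ring
    | monomial m a =>
      by_cases hm : 2 * m < n
      · refine ⟨Polynomial.monomial m a, ?_, fun t ht => ?_⟩
        · have := Polynomial.natDegree_monomial_le a (m := m)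
          omega
        · simpa using isBigO_zero _ _
      · refine ⟨0, by simpa using hn, fun t ht => ?_⟩
        have : (n : ℝ) ≤ 2 * m := by exact_mod_cast not_lt.1 hm
        simpa using (pow_isBigO_rpow m t (by linarith)).const_mul_left a
  obtain ⟨P', h1, h2⟩ := key P
  refine ⟨P', h1, fun t ht => ((hP t ht).add (h2 t ht)).congr_left fun x => ?_⟩
  ring

lemma integral_abs_rpow_le {t : ℝ} (ht : -1 < t) (x : ℝ) :
    |∫ y in (0 : ℝ)..x, |y| ^ t| = |x| ^ (t + 1) / (t + 1) := by
  have hp : ∀ x : ℝ, 0 ≤ x → ∫ y in (0 : ℝ)..x, |y| ^ t = x ^ (t + 1) / (t + 1) := by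
    intro x hx
    have : ∫ y in (0 : ℝ)..x, |y| ^ t = ∫ y in (0 : ℝ)..x, y ^ t := by
      apply intervalIntegral.integral_congr
      intro y hy
      rw [Set.uIcc_of_le hx] at hy
      simp [abs_of_nonneg hy.1]
    rw [this, integral_rpow (Or.inl ht), Real.zero_rpow (by linarith)]
    simp
  have ht' : 0 < t + 1 := by linarith
  rcases le_total 0 x with hx | hx
  · rw [hp x hx, abs_of_nonneg hx, abs_of_nonneg (by positivity)]
  · have h1 : ∫ y in (0 : ℝ)..x, |y| ^ t = -∫ y in (0 : ℝ)..(-x), |y| ^ t := by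
      have := intervalIntegral.integral_comp_neg (a := 0) (b := x) (fun y : ℝ => |y| ^ t)
      simp only [abs_neg, neg_zero] at this
      rw [this, intervalIntegral.integral_symm]
    rw [h1, hp _ (by linarith), abs_neg, abs_of_nonpos hx, abs_of_nonneg]
    have : 0 ≤ -x := by linarith
    positivity

/-- Integration from `0` raises the order of a remainder by one, with its polynomial replaced by
a primitive. -/
lemma PolyMod.integral {s : ℝ} (hs : -1 < s) {r : ℝ → ℝ}
    (hr : ∀ a b, IntervalIntegrable r volume a b) (h : PolyMod s r) :
    PolyMod (s + 1) fun x => ∫ y in (0 : ℝ)..x, r y := by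
  obtain ⟨P, hP⟩ := h
  have hpoly : PolyMod (s + 1) fun x => ∫ y in (0 : ℝ)..x, P.eval y := by
    clear hP
    induction P using Polynomial.induction_on' with
    | add p q hp hq =>
      refine (hp.add hq).congr (Eventually.of_forall fun x => ?_)
      simp only [Polynomial.eval_add]
      rw [intervalIntegral.integral_add] <;>
      exact (Polynomial.continuous _).intervalIntegrable _ _
    | monomial m a =>
      refine ((polyMod_pow (s + 1) (m + 1)).const_mul (a / (m + 1))).congr
        (Eventually.of_forall fun x => ?_)
      simp only [Polynomial.eval_monomial, intervalIntegral.integral_const_mul, integral_pow]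
      simp
      ring
  have hdiff : PolyMod (s + 1) fun x => ∫ y in (0 : ℝ)..x, (r y - P.eval y) := by
    refine PolyMod.of_isBigO fun t ht => ?_
    set t' := max (t - 1) ((s - 1) / 2) with ht'
    have h1 : t' < s := max_lt (by linarith) (by linarith)
    have h2 : -1 < t' := lt_max_of_lt_right (by linarith)
    have h3 : t ≤ t' + 1 := by linarith [le_max_left (t - 1) ((s - 1) / 2)]
    refine IsBigO.trans ?_ (rpow_abs_isBigO h3)
    obtain ⟨C, hC0, hC⟩ := (hP t' h1).exists_pos
    rw [IsBigOWith, eventually_nhdsWithin_iff, Metric.eventually_nhds_iff] at hC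
    obtain ⟨δ, hδ, hC⟩ := hC
    refine IsBigO.of_bound (C / (t' + 1)) ?_
    rw [eventually_nhdsWithin_iff, Metric.eventually_nhds_iff]
    refine ⟨δ, hδ, fun x hx _ => ?_⟩
    have hint : ∀ a b, IntervalIntegrable (fun y : ℝ => C * |y| ^ t') volume a b := by
      intro a b
      refine IntervalIntegrable.const_mul ?_ C
      have hpos : ∀ b : ℝ, 0 ≤ b → IntervalIntegrable (fun y : ℝ => |y| ^ t') volume 0 b := by
        intro b hb
        refine (intervalIntegral.intervalIntegrable_rpow' h2 (a := 0) (b := b)).congr ?_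
        intro y hy
        rw [Set.uIoc_of_le hb] at hy
        simp [abs_of_pos hy.1]
      have hall : ∀ b : ℝ, IntervalIntegrable (fun y : ℝ => |y| ^ t') volume 0 b := by
        intro b
        rcases le_total 0 b with hb | hb
        · exact hpos b hb
        · have := (IntervalIntegrable.iff_comp_neg (f := fun y : ℝ => |y| ^ t')
            (a := 0) (b := -b)).1 (hpos (-b) (by linarith))
          simpa using this
      exact (hall a).symm.trans (hall b)
    have hbd : ‖∫ y in (0 : ℝ)..x, (r y - P.eval y)‖ ≤ |∫ y in (0 : ℝ)..x, C * |y| ^ t'| := by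
      refine intervalIntegral.norm_integral_le_abs_of_norm_le ?_ (hint 0 x)
      have h0 : ∀ᵐ y : ℝ ∂(volume.restrict (Set.uIoc 0 x)), y ≠ 0 :=
        ae_restrict_of_ae (Measure.ae_ne volume 0)
      filter_upwards [h0, ae_restrict_mem measurableSet_uIoc] with y hy0 hy
      have := hC (y := y) ?_ hy0
      · rwa [Real.norm_of_nonneg (r := |y| ^ t') (by positivity)] at this
      · rw [Real.dist_eq, sub_zero] at hx ⊢
        refine lt_of_le_of_lt ?_ hx
        have := Set.abs_sub_left_of_mem_uIcc (Set.uIoc_subset_uIcc hy)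
        simpa using this
    refine hbd.trans ?_
    rw [intervalIntegral.integral_const_mul, abs_mul, integral_abs_rpow_le h2, abs_of_pos hC0,
      Real.norm_of_nonneg (by positivity)]
    apply le_of_eq
    ring
  refine (hpoly.add hdiff).congr (Eventually.of_forall fun x => ?_)
  simp only
  rw [intervalIntegral.integral_sub (hr _ _) ((Polynomial.continuous _).intervalIntegrable _ _)]
  ring

lemma setIntegral_Iic_eq {r : ℝ → ℝ} (hr : Integrable r) (x : ℝ) :
    ∫ y in Set.Iic x, r y = (∫ y in Set.Iic 0, r y) + ∫ y in (0 : ℝ)..x, r y := by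
  rw [← intervalIntegral.integral_Iic_sub_Iic hr.integrableOn hr.integrableOn]
  ring

lemma continuous_setIntegral_Iic {r : ℝ → ℝ} (hr : Integrable r) :
    Continuous fun x => ∫ y in Set.Iic x, r y := by
  rw [funext (setIntegral_Iic_eq hr)]
  exact continuous_const.add (intervalIntegral.continuous_primitive
    (fun a b => hr.intervalIntegrable) 0)

lemma PolyMod.integral_Iic {s : ℝ} (hs : -1 < s) {r : ℝ → ℝ} (hr : Integrable r)
    (h : PolyMod s r) : PolyMod (s + 1) fun x => ∫ y in Set.Iic x, r y := by
  rw [funext (setIntegral_Iic_eq hr)]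
  exact (polyMod_const _ _).add (h.integral hs fun a b => hr.intervalIntegrable)

lemma polyMod_of_contDiff {f : ℝ → ℝ} (hf : ContDiff ℝ ∞ f) (s : ℝ) : PolyMod s f := by
  have key : ∀ n : ℕ, ∀ f : ℝ → ℝ, ContDiff ℝ ∞ f → PolyMod n f := by
    intro n
    induction n with
    | zero =>
      intro f hf
      have h1 : ∀ᶠ x in 𝓝 (0 : ℝ), |f x| < |f 0| + 1 :=
        (hf.continuous.abs.tendsto 0).eventually_lt_const (lt_add_one _)
      simpa using PolyMod.of_bounded (C := |f 0| + 1)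
        (eventually_nhdsWithin_of_eventually_nhds (h1.mono fun x hx => hx.le))
    | succ n ih =>
      intro f hf
      have hd : ContDiff ℝ ∞ (deriv f) := by
        have : ContDiff ℝ ((⊤ : ℕ∞) + 1 : WithTop ℕ∞) f := hf
        exact (contDiff_succ_iff_deriv.1 this).2.2
      have h1 := (ih (deriv f) hd).integral (by have := n.cast_nonneg (α := ℝ); linarith)
        fun a b => hd.continuous.intervalIntegrable a b
      have h2 := (polyMod_const (n + 1) (f 0)).add h1
      push_cast
      refine h2.congr (Eventually.of_forall fun x => ?_)
      simp only
      rw [intervalIntegral.integral_deriv_eq_sub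
        (fun y _ => (hf.differentiable (by simp)).differentiableAt)
        (hd.continuous.intervalIntegrable _ _)]
      ring
  obtain ⟨n, hn⟩ := exists_nat_ge s
  exact (key n f hf).mono hn

/-! ### Weak densities -/

/-- `ρ` is a density, with compact support, of the push-forward under `V` of the signed measure
`w(q) dq`; it is tested against continuous functions. -/
structure HasDens {E : Type*} [MeasureSpace E] (w V : E → ℝ) (ρ : ℝ → ℝ) : Prop where
  integrable : Integrable ρ
  bounded_support : ∃ R : ℝ, ∀ x, R < |x| → ρ x = 0
  integral_eq : ∀ g : ℝ → ℝ, Continuous g → ∫ q, w q * g (V q) = ∫ x, ρ x * g x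

/-- Continuity at all points `x ≠ 0` close to `0`. -/
def ContNear (ρ : ℝ → ℝ) : Prop := ∀ᶠ x in 𝓝[≠] (0 : ℝ), ContinuousAt ρ x

lemma ContNear.congr {ρ ρ' : ℝ → ℝ} (h : ContNear ρ) (he : ρ =ᶠ[𝓝[≠] 0] ρ') : ContNear ρ' := by
  have he' := (eventually_eventually_nhdsWithin (s := {0}ᶜ) (a := (0 : ℝ))).2 he
  filter_upwards [h, he', self_mem_nhdsWithin] with x hx hx' hx0
  rw [(isOpen_compl_singleton).nhdsWithin_eq hx0] at hx'
  exact hx.congr hx'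

lemma ContNear.add {ρ ρ' : ℝ → ℝ} (h : ContNear ρ) (h' : ContNear ρ') :
    ContNear fun x => ρ x + ρ' x := by
  filter_upwards [h, h'] with x hx hx'
  exact hx.add hx'

lemma ContNear.const_mul {ρ : ℝ → ℝ} (h : ContNear ρ) (c : ℝ) : ContNear fun x => c * ρ x := by
  filter_upwards [h] with x hx
  exact continuousAt_const.mul hx

lemma Continuous.contNear {ρ : ℝ → ℝ} (h : Continuous ρ) : ContNear ρ :=
  Eventually.of_forall fun _ => h.continuousAt

lemma integrable_mul_of_bounded_support {ρ g : ℝ → ℝ} (hρ : Integrable ρ)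
    (hs : ∃ R : ℝ, ∀ x, R < |x| → ρ x = 0) (hg : Continuous g) :
    Integrable fun x => ρ x * g x := by
  obtain ⟨R, hR⟩ := hs
  have h1 : IntegrableOn (fun x => ρ x * g x) (Set.Icc (-R) R) :=
    hρ.integrableOn.mul_continuousOn hg.continuousOn isCompact_Icc
  refine (integrableOn_iff_integrable_of_support_subset fun x hx => ?_).1 h1
  rw [Set.mem_Icc, ← abs_le]
  by_contra hlt
  exact hx (by simp [hR x (not_le.1 hlt)])

lemma HasDens.add {E : Type*} [TopologicalSpace E] [MeasureSpace E] {w w' V : E → ℝ} {ρ ρ' : ℝ → ℝ}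
    (h : HasDens w V ρ) (h' : HasDens w' V ρ')
    (hi : ∀ g : ℝ → ℝ, Continuous g → Integrable fun q => w q * g (V q))
    (hi' : ∀ g : ℝ → ℝ, Continuous g → Integrable fun q => w' q * g (V q)) :
    HasDens (fun q => w q + w' q) V fun x => ρ x + ρ' x where
  integrable := h.integrable.add h'.integrable
  bounded_support := by
    obtain ⟨R, hR⟩ := h.bounded_support
    obtain ⟨R', hR'⟩ := h'.bounded_support
    refine ⟨max R R', fun x hx => ?_⟩
    rw [hR x ((le_max_left _ _).trans_lt hx), hR' x ((le_max_right _ _).trans_lt hx), add_zero]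
  integral_eq g hg := by
    simp only [add_mul]
    rw [integral_add (hi g hg) (hi' g hg),
      integral_add (integrable_mul_of_bounded_support h.integrable h.bounded_support hg)
        (integrable_mul_of_bounded_support h'.integrable h'.bounded_support hg),
      h.integral_eq g hg, h'.integral_eq g hg]

/-- Integrating delta profiles against a weak density yields its value at each point of
continuity. -/
lemma HasDens.isDeltaIntegral {N : ℕ} {G : Set (EuclideanSpace ℝ (Fin N))}
    {w V : EuclideanSpace ℝ (Fin N) → ℝ} (hw : Continuous w) (hwc : HasCompactSupport w)
    (hwG : tsupport w ⊆ G) (hV : Continuous V) {ρ : ℝ → ℝ} (h : HasDens w V ρ) {e : ℝ}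
    (he : ContinuousAt ρ e) : IsDeltaIntegral G w V e (ρ e) := by
  intro ψ hψ
  have hcont : ∀ η : ℝ, Continuous fun q => w q * (η⁻¹ * ψ ((V q - e) / η)) := fun η =>
    hw.mul (continuous_const.mul (hψ.continuous.comp (by fun_prop)))
  have hint : ∀ η : ℝ, Integrable fun q => w q * (η⁻¹ * ψ ((V q - e) / η)) := fun η =>
    (hcont η).integrable_of_hasCompactSupport hwc.mul_right
  refine ⟨Eventually.of_forall fun η => (hint η).integrableOn, ?_⟩
  have heq : ∀ᶠ η in 𝓝[>] (0 : ℝ), ∫ y, ρ (e + η * y) * ψ y =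
      ∫ q in G, w q * (η⁻¹ * ψ ((V q - e) / η)) := by
    filter_upwards [self_mem_nhdsWithin] with η (hη : 0 < η)
    rw [setIntegral_eq_integral_of_forall_compl_eq_zero]
    · rw [h.integral_eq (fun x => η⁻¹ * ψ ((x - e) / η))
        (continuous_const.mul (hψ.continuous.comp (by fun_prop)))]
      have h1 := integral_add_left_eq_self (μ := volume)
        (fun x => ρ x * (η⁻¹ * ψ ((x - e) / η))) e
      have h2 := Measure.integral_comp_mul_left
        (fun x => ρ (e + x) * (η⁻¹ * ψ ((e + x - e) / η))) η
      rw [← h1]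
      rw [abs_of_pos (inv_pos.2 hη), smul_eq_mul, inv_mul_eq_div, eq_div_iff hη.ne',
        mul_comm, ← integral_const_mul] at h2
      rw [← h2]
      congr 1
      ext y
      rw [add_sub_cancel_left, mul_div_cancel_left₀ _ hη.ne']
      field_simp
    · intro q hq
      rw [image_eq_zero_of_notMem_tsupport fun hq' => hq (hwG hq'), zero_mul]
  refine Tendsto.congr' heq ?_
  have hlim : ρ e = ∫ y, ρ e * ψ y := by
    rw [integral_const_mul, hψ.integral_eq_one, mul_one]
  rw [hlim]
  obtain ⟨δ, hδ, hball⟩ := Metric.continuousAt_iff.1 he 1 one_pos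
  obtain ⟨R, hR⟩ := hψ.hasCompactSupport.isCompact.isBounded.exists_norm_le
  have hψi : Integrable ψ := hψ.continuous.integrable_of_hasCompactSupport hψ.hasCompactSupport
  refine tendsto_integral_filter_of_dominated_convergence
    (fun y => (|ρ e| + 1) * |ψ y|) ?_ ?_ (hψi.abs.const_mul _) ?_
  · filter_upwards [self_mem_nhdsWithin] with η (hη : 0 < η)
    exact (((h.integrable.comp_add_left e).comp_mul_left' hη.ne').aestronglyMeasurable).mul
      hψi.aestronglyMeasurable
  · have hsmall : ∀ᶠ η in 𝓝[>] (0 : ℝ), η * (|R| + 1) < δ := by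
      apply eventually_nhdsWithin_of_eventually_nhds
      have : Tendsto (fun η : ℝ => η * (|R| + 1)) (𝓝 0) (𝓝 (0 * (|R| + 1))) :=
        (continuous_id.mul continuous_const).tendsto 0
      rw [zero_mul] at this
      exact this.eventually_lt_const hδ
    filter_upwards [hsmall, self_mem_nhdsWithin] with η hη (hη0 : 0 < η)
    refine Eventually.of_forall fun y => ?_
    by_cases hy : y ∈ tsupport ψ
    · have hy' : |y| ≤ R := hR y hy
      have hd : dist (e + η * y) e < δ := by
        rw [Real.dist_eq, add_sub_cancel_left, abs_mul, abs_of_pos hη0]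
        refine lt_of_le_of_lt ?_ hη
        gcongr
        linarith [le_abs_self R]
      have := hball hd
      rw [Real.dist_eq] at this
      rw [norm_mul, Real.norm_eq_abs, Real.norm_eq_abs]
      gcongr
      have := abs_sub_abs_le_abs_sub (ρ (e + η * y)) (ρ e)
      linarith
    · simp [image_eq_zero_of_notMem_tsupport hy]
  · refine Eventually.of_forall fun y => Tendsto.mul_const _ ?_
    apply tendsto_nhdsWithin_of_tendsto_nhds
    have h1 : Tendsto (fun η : ℝ => e + η * y) (𝓝 0) (𝓝 (e + 0 * y)) :=
      (by fun_prop : Continuous fun η : ℝ => e + η * y).tendsto 0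
    rw [zero_mul, add_zero] at h1
    exact he.tendsto.comp h1

/-- Layer-cake form of the push-forward: primitives `∫_{V}^R g` are integrated by integrating `g`
against the distribution function of the push-forward. -/
lemma integral_mul_primitive {X : Type*} [MeasurableSpace X] {ν : Measure X} [SFinite ν]
    {m V : X → ℝ} (hm : Integrable m ν) (hV : Measurable V) {R : ℝ}
    (hR : ∀ x, m x ≠ 0 → |V x| ≤ R) :
    Integrable ((Set.Ioc (-R) R).indicator fun t => ∫ x in {x | V x < t}, m x ∂ν) ∧
    ∀ g : ℝ → ℝ, Continuous g → ∫ x, m x * (∫ t in V x..R, g t) ∂ν =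
      ∫ t, (Set.Ioc (-R) R).indicator (fun t => ∫ x in {x | V x < t}, m x ∂ν) t * g t := by
  have hS : MeasurableSet {p : X × ℝ | V p.1 < p.2} :=
    measurableSet_lt (hV.comp measurable_fst) measurable_snd
  have hF : ∀ g : ℝ → ℝ, Continuous g → Integrable ({p : X × ℝ | V p.1 < p.2}.indicator
      fun p => m p.1 * (Set.Ioc (-R) R).indicator g p.2) (ν.prod volume) := by
    intro g hg
    refine Integrable.indicator (hm.mul_prod ?_) hS
    exact (integrable_indicator_iff measurableSet_Ioc).2
      (hg.continuousOn.integrableOn_Icc.mono_set Set.Ioc_subset_Icc_self)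
  have hx : ∀ g : ℝ → ℝ, ∀ t, ∫ x, {p : X × ℝ | V p.1 < p.2}.indicator
      (fun p => m p.1 * (Set.Ioc (-R) R).indicator g p.2) (x, t) ∂ν =
      (Set.Ioc (-R) R).indicator (fun t => ∫ x in {x | V x < t}, m x ∂ν) t * g t := by
    intro g t
    have : ∀ x, {p : X × ℝ | V p.1 < p.2}.indicator
      (fun p => m p.1 * (Set.Ioc (-R) R).indicator g p.2) (x, t) =
      {x | V x < t}.indicator m x * (Set.Ioc (-R) R).indicator g t := by
      intro x
      by_cases h : V x < t <;> simp [h]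
    simp_rw [this]
    rw [integral_mul_const, integral_indicator (measurableSet_lt hV measurable_const)]
    by_cases h : t ∈ Set.Ioc (-R) R <;> simp only [h, Set.indicator_of_mem,
      Set.indicator_of_notMem, not_false_eq_true, mul_zero, zero_mul]
  constructor
  · refine ((hF (fun _ => 1) continuous_const).integral_prod_right).congr
      (Eventually.of_forall fun t => ?_)
    simp only [hx, mul_one]
  · intro g hg
    have h1 : ∀ x, m x * (∫ t in V x..R, g t) = ∫ t, {p : X × ℝ | V p.1 < p.2}.indicator
        (fun p => m p.1 * (Set.Ioc (-R) R).indicator g p.2) (x, t) := by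
      intro x
      by_cases hmx : m x = 0
      · have : ∀ t, {p : X × ℝ | V p.1 < p.2}.indicator
          (fun p => m p.1 * (Set.Ioc (-R) R).indicator g p.2) (x, t) = 0 := by
          intro t
          by_cases h : V x < t <;> simp [h, hmx]
        simp [this, hmx]
      have hVx := abs_le.1 (hR x hmx)
      have : ∀ t, {p : X × ℝ | V p.1 < p.2}.indicator
          (fun p => m p.1 * (Set.Ioc (-R) R).indicator g p.2) (x, t) =
          m x * (Set.Ioc (V x) R).indicator g t := by
        intro t
        by_cases h : V x < t
        · by_cases h' : t ≤ R
          · have : -R < t := by linarith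
            simp [h, h', this]
          · simp [h, h']
        · simp [h]
      simp_rw [this]
      rw [integral_const_mul, integral_indicator measurableSet_Ioc,
        intervalIntegral.integral_of_le hVx.2]
    simp_rw [h1]
    rw [integral_integral_swap (f := fun x t => {p : X × ℝ | V p.1 < p.2}.indicator
        (fun p => m p.1 * (Set.Ioc (-R) R).indicator g p.2) (x, t)) (hF g hg)]
    simp_rw [hx]

lemma hasDerivAt_integral_left {g : ℝ → ℝ} (hg : Continuous g) (R t : ℝ) :
    HasDerivAt (fun t => ∫ s in t..R, g s) (-g t) t := by
  have h := (intervalIntegral.integral_hasDerivAt_right (hg.intervalIntegrable R t)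
    (hg.stronglyMeasurableAtFilter _ _) hg.continuousAt).neg
  refine h.congr_of_eventuallyEq (Eventually.of_forall fun x => ?_)
  simp only [Pi.neg_apply]
  rw [intervalIntegral.integral_symm]

/-- Bootstrapping of singular expansions. Suppose that for each weight `w` of a family the density
of `V_*(w dq)` is `c w • ρ₀` plus a primitive of the density of another weight `u` of the family.
As every integration gains one order, iterating shows that each density is `c w • ρ₀`, up to a
polynomial and an error of the order of a primitive of `ρ₀`. -/
theorem exists_hasDens_of_step {E : Type*} [MeasureSpace E] [SFinite (volume : Measure E)]
    {V : E → ℝ} (hV : Measurable V) (W : Set (E → ℝ))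
    (hW : ∀ w ∈ W, Integrable w ∧ ∃ R : ℝ, ∀ q, w q ≠ 0 → |V q| ≤ R) (c : (E → ℝ) → ℝ)
    {ρ₀ : ℝ → ℝ} (h₀ : Integrable ρ₀) (h₀s : ∃ R : ℝ, ∀ x, R < |x| → ρ₀ x = 0)
    (h₀c : ContNear ρ₀) {S : ℝ} (hS0 : 0 ≤ S)
    (hS : PolyMod S fun x => ∫ y in Set.Iic x, ρ₀ y)
    (hstep : ∀ w ∈ W, ∃ u ∈ W, ∀ g h : ℝ → ℝ, Continuous g → (∀ t, HasDerivAt h (-g t) t) →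
      ∫ q, w q * g (V q) = c w * (∫ x, ρ₀ x * g x) + ∫ q, u q * h (V q)) :
    ∀ w ∈ W, ∃ ρ, HasDens w V ρ ∧ ContNear ρ ∧ PolyMod S fun x => ρ x - c w * ρ₀ x := by
  -- the density built from a distribution function `f` on `(-R, R]`
  have build : ∀ w : E → ℝ, ∀ R : ℝ, ∀ f : ℝ → ℝ, Integrable ((Set.Ioc (-R) R).indicator f) →
      (∀ g : ℝ → ℝ, Continuous g → ∫ q, w q * g (V q) = c w * (∫ x, ρ₀ x * g x) +
        ∫ t, (Set.Ioc (-R) R).indicator f t * g t) →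
      HasDens w V fun x => c w * ρ₀ x + (Set.Ioc (-R) R).indicator f x := by
    intro w R f hf hg
    have hs : ∃ R' : ℝ, ∀ x, R' < |x| → (Set.Ioc (-R) R).indicator f x = 0 := by
      refine ⟨R, fun x hx => Set.indicator_of_notMem (fun hx' => ?_) _⟩
      exact absurd hx (not_lt.2 (abs_le.2 ⟨hx'.1.le, hx'.2⟩))
    refine ⟨(h₀.const_mul _).add hf, ?_, fun g hgc => ?_⟩
    · obtain ⟨R1, h1⟩ := h₀s
      obtain ⟨R2, h2⟩ := hs
      refine ⟨max R1 R2, fun x hx => ?_⟩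
      rw [h1 x ((le_max_left _ _).trans_lt hx), h2 x ((le_max_right _ _).trans_lt hx)]
      simp
    · rw [hg g hgc]
      simp only [add_mul, mul_assoc]
      rw [integral_add ((integrable_mul_of_bounded_support h₀ h₀s hgc).const_mul _)
        (integrable_mul_of_bounded_support hf hs hgc), integral_const_mul]
  have hnear : ∀ R : ℝ, 1 ≤ R → ∀ f : ℝ → ℝ, (Set.Ioc (-R) R).indicator f =ᶠ[𝓝[≠] 0] f := by
    intro R hR f
    apply eventually_nhdsWithin_of_eventually_nhds
    filter_upwards [Ioo_mem_nhds (a := -1) (b := 1) (by norm_num : (-1 : ℝ) < 0) one_pos] with x hx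
    have hx' : x ∈ Set.Ioc (-R) R := ⟨by linarith [hx.1], by linarith [hx.2]⟩
    exact Set.indicator_of_mem hx' _
  have main : ∀ n : ℕ, ∀ w ∈ W, ∃ ρ, HasDens w V ρ ∧ (0 < n → ContNear ρ) ∧
      PolyMod (min n S) fun x => ρ x - c w * ρ₀ x := by
    intro n
    induction n with
    | zero =>
      intro w hw
      obtain ⟨u, hu, hstep⟩ := hstep w hw
      obtain ⟨hui, R, hR⟩ := hW u hu
      obtain ⟨hi, hfub⟩ := integral_mul_primitive hui hV (R := max R 1)
        fun q hq => (hR q hq).trans (le_max_left _ _)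
      refine ⟨_, build w (max R 1) _ hi fun g hg => ?_, by simp, ?_⟩
      · rw [hstep g _ hg (hasDerivAt_integral_left hg (max R 1)), hfub g hg]
      · simp only [add_sub_cancel_left, Nat.cast_zero, min_eq_left hS0]
        refine PolyMod.of_bounded (C := ∫ q, |u q|) (Eventually.of_forall fun x => ?_)
        by_cases hx : x ∈ Set.Ioc (-(max R 1)) (max R 1)
        · rw [Set.indicator_of_mem hx]
          refine (abs_integral_le_integral_abs).trans ?_
          exact setIntegral_le_integral hui.abs (Eventually.of_forall fun q => abs_nonneg _)
        · rw [Set.indicator_of_notMem hx, abs_zero]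
          exact integral_nonneg fun q => abs_nonneg _
    | succ n ih =>
      intro w hw
      obtain ⟨u, hu, hstep⟩ := hstep w hw
      obtain ⟨ρ, hρ, -, hpoly⟩ := ih u hu
      obtain ⟨R, hR⟩ := hρ.bounded_support
      have hmax : ∀ x, ρ x ≠ 0 → |x| ≤ max R 1 := fun x hx =>
        (not_lt.1 fun hlt => hx (hR x hlt)).trans (le_max_left _ _)
      obtain ⟨hi, hfub⟩ := integral_mul_primitive (V := fun x => x) hρ.integrable
        measurable_id hmax
      have hIio : (fun t : ℝ => ∫ x in {x | x < t}, ρ x) = fun t => ∫ x in Set.Iic t, ρ x := by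
        ext t
        exact (integral_Iic_eq_integral_Iio).symm
      rw [hIio] at hi hfub
      refine ⟨_, build w _ _ hi fun g hg => ?_, fun _ => ?_, ?_⟩
      · rw [hstep g _ hg (hasDerivAt_integral_left hg (max R 1)),
          hρ.integral_eq (fun t => ∫ s in t..max R 1, g s)
            (continuous_iff_continuousAt.2 fun t => (hasDerivAt_integral_left hg _ t).continuousAt),
          hfub g hg]
      · refine (h₀c.const_mul _).add ?_
        exact (continuous_setIntegral_Iic hρ.integrable).contNear.congr
          (hnear _ (le_max_right _ _) _).symm
      · simp only [add_sub_cancel_left]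
        refine PolyMod.congr ?_ (hnear _ (le_max_right _ _) _).symm
        have hlt : -1 < min (n : ℝ) S :=
          (by norm_num : (-1 : ℝ) < 0).trans_le (le_min n.cast_nonneg hS0)
        have h1 := hpoly.integral_Iic hlt
          (hρ.integrable.sub (h₀.const_mul (c u)))
        have h2 : PolyMod (min ((n + 1 : ℕ) : ℝ) S) fun x => c u * ∫ y in Set.Iic x, ρ₀ y :=
          (hS.const_mul _).mono (min_le_right _ _)
        refine ((h1.mono ?_).add h2).congr (Eventually.of_forall fun x => ?_)
        · rw [← min_add_add_right]
          push_cast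
          exact min_le_min le_rfl (by linarith)
        · simp only [Pi.sub_apply]
          rw [integral_sub hρ.integrable.integrableOn (h₀.const_mul _).integrableOn,
            integral_const_mul]
          ring
  intro w hw
  obtain ⟨n, hn⟩ := exists_nat_ge S
  obtain ⟨ρ, h1, h2, h3⟩ := main (n + 1) w hw
  refine ⟨ρ, h1, h2 n.succ_pos, h3.mono (le_min ?_ le_rfl)⟩
  push_cast
  linarith

/-! ### Smooth integrals depending on a parameter -/

lemma contDiff_parametric_integral {P F : Type*} [NormedAddCommGroup P] [NormedSpace ℝ P]
    [NormedAddCommGroup F] [NormedSpace ℝ F] {f : ℝ → ℝ} (hf : Integrable f)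
    (hs : ∃ R : ℝ, ∀ x, R < |x| → f x = 0) {G : P → ℝ → F}
    (hG : ContDiff ℝ ∞ (Function.uncurry G)) : ContDiff ℝ ∞ fun p => ∫ t, f t • G p t := by
  obtain ⟨R, hR⟩ := hs
  -- the integral is the value at `0` of the convolution of `f` with a truncation of `G p (-·)`
  let θ : ContDiffBump (0 : ℝ) := ⟨|R| + 1, |R| + 2, by positivity, by linarith⟩
  have hθ : ∀ t, |t| ≤ R → θ t = 1 := fun t ht => θ.one_of_mem_closedBall (by
    rw [mem_closedBall_zero_iff, Real.norm_eq_abs]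
    exact ht.trans ((le_abs_self R).trans (by simp [θ])))
  have key := contDiffOn_convolution_right_with_param (𝕜 := ℝ) (μ := volume) (f := f) (n := ⊤)
    (ContinuousLinearMap.lsmul ℝ ℝ : ℝ →L[ℝ] F →L[ℝ] F)
    (g := fun p y => θ (-y) • G p (-y)) (s := Set.univ) (k := Metric.closedBall 0 (|R| + 2))
    isOpen_univ (isCompact_closedBall _ _) ?_ hf.locallyIntegrable ?_
  · rw [Set.univ_prod_univ, contDiffOn_univ] at key
    have h2 : ContDiff ℝ ∞ fun p : P => (p, (0 : ℝ)) := contDiff_id.prodMk contDiff_const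
    have h3 := key.comp h2
    refine (congrArg (ContDiff ℝ ∞) (funext fun p => ?_)).mpr h3
    simp only [Function.comp_apply, convolution, zero_sub, neg_neg,
      ContinuousLinearMap.lsmul_apply]
    refine integral_congr_ae (Eventually.of_forall fun t => ?_)
    beta_reduce
    by_cases ht : |t| ≤ R
    · rw [hθ t ht, one_smul]
    · rw [hR t (not_le.1 ht), zero_smul, zero_smul]
  · intro p y _ hy
    rw [mem_closedBall_zero_iff, not_le] at hy
    rw [θ.zero_of_le_dist, zero_smul]
    rw [dist_zero_right, norm_neg]
    exact hy.le
  · rw [Set.univ_prod_univ, contDiffOn_univ]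
    have h1 : ContDiff ℝ ∞ fun q : P × ℝ => θ (-q.2) := θ.contDiff.comp contDiff_snd.neg
    exact h1.smul (hG.comp (contDiff_fst.prodMk contDiff_snd.neg))

lemma contDiff_integral_zero_one {P F : Type*} [NormedAddCommGroup P] [NormedSpace ℝ P]
    [NormedAddCommGroup F] [NormedSpace ℝ F] {G : P → ℝ → F}
    (hG : ContDiff ℝ ∞ (Function.uncurry G)) :
    ContDiff ℝ ∞ fun p => ∫ t in (0 : ℝ)..1, G p t := by
  have h := contDiff_parametric_integral
    (f := (Set.Ioc (0 : ℝ) 1).indicator fun _ => 1) ?_ ⟨1, fun x hx => ?_⟩ hG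
  · refine (congrArg (ContDiff ℝ ∞) (funext fun p => ?_)).mpr h
    rw [intervalIntegral.integral_of_le zero_le_one, ← integral_indicator measurableSet_Ioc]
    congr 1
    ext t
    by_cases ht : t ∈ Set.Ioc (0 : ℝ) 1 <;> simp [ht]
  · exact (integrable_indicator_iff measurableSet_Ioc).2 (by simp)
  · refine Set.indicator_of_notMem (fun hx' => ?_) _
    rw [abs_of_pos hx'.1] at hx
    exact absurd hx'.2 (not_le.2 hx)

/-- A truncation: a smooth compactly supported function equal to `1` on a given compact set. -/
lemma exists_smooth_cutoff {E : Type*} [NormedAddCommGroup E] [NormedSpace ℝ E]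
    [FiniteDimensional ℝ E] {K U : Set E} (hK : IsCompact K) (hU : IsOpen U) (hKU : K ⊆ U) :
    ∃ θ : E → ℝ, ContDiff ℝ ∞ θ ∧ HasCompactSupport θ ∧ tsupport θ ⊆ U ∧
      ∀ x ∈ K, ∀ᶠ y in 𝓝 x, θ y = 1 := by
  obtain ⟨L, hL, hKL, hLU⟩ := exists_compact_between hK hU hKU
  obtain ⟨L', hL', hLL', hLU'⟩ := exists_compact_between hL hU hLU
  obtain ⟨θ, hθ1, -, hθ⟩ := exists_contMDiff_support_eq_eq_one_iff (n := ⊤) (M := E)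
    (modelWithCornersSelf ℝ E) isOpen_interior hL.isClosed hLL'
  have hts : tsupport θ ⊆ L' := by
    rw [tsupport, hθ.1]
    exact closure_minimal interior_subset hL'.isClosed
  refine ⟨θ, hθ1.contDiff, HasCompactSupport.intro' hL' hL'.isClosed fun x hx =>
    image_eq_zero_of_notMem_tsupport fun h => hx (hts h), hts.trans hLU', fun x hx => ?_⟩
  filter_upwards [isOpen_interior.mem_nhds (hKL hx)] with y hy
  exact (hθ.2 y).1 (interior_subset hy)

/-! ### Integration by parts along level sets -/

section

variable {N : ℕ}

local notation "ℰ" => EuclideanSpace ℝ (Fin N)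

lemma contDiff_fderiv_apply {E F : Type*} [NormedAddCommGroup E] [NormedSpace ℝ E]
    [NormedAddCommGroup F] [NormedSpace ℝ F] {f : E → F} (hf : ContDiff ℝ ∞ f) (v : E) :
    ContDiff ℝ ∞ fun x => fderiv ℝ f x v :=
  (hf.fderiv_right (by simp)).clm_apply contDiff_const

lemma hasCompactSupport_fderiv_apply {E : Type*} [NormedAddCommGroup E] [NormedSpace ℝ E]
    {f : E → ℝ} (hf : HasCompactSupport f) (v : E) :
    HasCompactSupport fun x => fderiv ℝ f x v :=
  (hf.fderiv (𝕜 := ℝ)).comp_left (g := fun L : E →L[ℝ] ℝ => L v) (by simp)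

lemma fderiv_comp_of_hasDerivAt {E : Type*} [NormedAddCommGroup E] [NormedSpace ℝ E]
    {V : E → ℝ} {h : ℝ → ℝ} {q : E} {d : ℝ} (hV : DifferentiableAt ℝ V q)
    (hh : HasDerivAt h d (V q)) (v : E) :
    fderiv ℝ (fun q => h (V q)) q v = d * fderiv ℝ V q v := by
  have := (hh.comp_hasFDerivAt q hV.hasFDerivAt).fderiv
  rw [show (fun q => h (V q)) = h ∘ V from rfl, this]
  simp

/-- Integration by parts: the weight `∑ Yᵢ ∂ᵢV` integrated against `g(V)` is the divergence of `Y`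
integrated against a primitive of `-g`. -/
lemma integral_sum_mul_fderiv {V : ℰ → ℝ} (hV : ContDiff ℝ ∞ V) {Y : Fin N → ℰ → ℝ}
    (hY : ∀ i, ContDiff ℝ ∞ (Y i)) (hYc : ∀ i, HasCompactSupport (Y i)) {g h : ℝ → ℝ}
    (hg : Continuous g) (hh : ∀ t, HasDerivAt h (-g t) t) :
    ∫ q, (∑ i, Y i q * fderiv ℝ V q (EuclideanSpace.single i 1)) * g (V q) =
      ∫ q, (∑ i, fderiv ℝ (Y i) q (EuclideanSpace.single i 1)) * h (V q) := by
  have hhc : Continuous h := continuous_iff_continuousAt.2 fun t => (hh t).continuousAt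
  have hVd : Differentiable ℝ V := hV.differentiable (by simp)
  have hgV : Continuous fun q => g (V q) := hg.comp hV.continuous
  have hhV : Continuous fun q => h (V q) := hhc.comp hV.continuous
  have h1 : ∀ i, Integrable fun q =>
      Y i q * fderiv ℝ V q (EuclideanSpace.single i 1) * g (V q) := fun i =>
    (((hY i).continuous.mul (contDiff_fderiv_apply hV _).continuous).mul
      hgV).integrable_of_hasCompactSupport ((hYc i).mul_right.mul_right)
  have h2 : ∀ i, Integrable fun q => fderiv ℝ (Y i) q (EuclideanSpace.single i 1) * h (V q) :=
    fun i => ((contDiff_fderiv_apply (hY i) _).continuous.mul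
      hhV).integrable_of_hasCompactSupport (hasCompactSupport_fderiv_apply (hYc i) _).mul_right
  simp_rw [Finset.sum_mul]
  rw [integral_finsetSum _ fun i _ => h1 i, integral_finsetSum _ fun i _ => h2 i]
  refine Finset.sum_congr rfl fun i _ => ?_
  have hd : ∀ q, fderiv ℝ (fun q => h (V q)) q (EuclideanSpace.single i 1) =
      -g (V q) * fderiv ℝ V q (EuclideanSpace.single i 1) := fun q =>
    fderiv_comp_of_hasDerivAt hVd.differentiableAt (hh _) _
  have key := integral_mul_fderiv_eq_neg_fderiv_mul_of_integrable (μ := volume) (f := Y i)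
    (g := fun q => h (V q)) (v := EuclideanSpace.single i 1) (h2 i) ?_ ?_
    (fun q _ => ((hY i).differentiable (by simp)).differentiableAt)
    (fun q _ => ((hh (V q)).comp_hasFDerivAt q hVd.differentiableAt.hasFDerivAt).differentiableAt)
  · simp_rw [hd] at key
    rw [← neg_eq_iff_eq_neg, ← integral_neg] at key
    rw [← key]
    congr 1
    ext q
    ring
  · simp_rw [hd]
    refine (h1 i).neg.congr (Eventually.of_forall fun q => ?_)
    simp only [Pi.neg_apply]
    ring
  · exact ((hY i).continuous.mul hhV).integrable_of_hasCompactSupport (hYc i).mul_right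

lemma eq_zero_of_apply_single {L : ℰ →L[ℝ] ℝ} (h : ∀ i, L (EuclideanSpace.single i 1) = 0) :
    L = 0 := by
  apply ContinuousLinearMap.coe_injective
  apply (EuclideanSpace.basisFun (Fin N) ℝ).toBasis.ext
  intro i
  simpa using h i

/-- A weight supported away from the stationary points is of the form `Y · ∇V`, so that its density
is polynomial near `0` up to any order. -/
theorem exists_hasDens_of_fderiv_ne_zero {V : ℰ → ℝ} (hV : ContDiff ℝ ∞ V) {w : ℰ → ℝ}
    (hw : ContDiff ℝ ∞ w) (hwc : HasCompactSupport w) (hreg : ∀ q ∈ tsupport w, fderiv ℝ V q ≠ 0)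
    {S : ℝ} (hS : 0 ≤ S) : ∃ ρ, HasDens w V ρ ∧ ContNear ρ ∧ PolyMod S ρ := by
  have key := exists_hasDens_of_step (V := V) hV.continuous.measurable
    {w | ContDiff ℝ ∞ w ∧ HasCompactSupport w ∧ ∀ q ∈ tsupport w, fderiv ℝ V q ≠ 0}
    ?_ (fun _ => 0) (ρ₀ := fun _ => 0) (integrable_zero _ _ _) ⟨0, fun _ _ => rfl⟩
    continuous_const.contNear hS (by simpa using polyMod_const S 0) ?_ w ⟨hw, hwc, hreg⟩
  · simpa using key
  · rintro w ⟨hw, hwc, -⟩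
    refine ⟨hw.continuous.integrable_of_hasCompactSupport hwc, ?_⟩
    obtain ⟨R, hR⟩ := (hwc.isCompact.image hV.continuous).isBounded.exists_norm_le
    exact ⟨R, fun q hq => hR _ ⟨q, subset_tsupport _ hq, rfl⟩⟩
  · rintro w ⟨hw, hwc, hreg⟩
    set D : ℰ → ℝ := fun q => ∑ j, (fderiv ℝ V q (EuclideanSpace.single j 1)) ^ 2 with hD
    have hDs : ContDiff ℝ ∞ D :=
      ContDiff.sum fun j _ => (contDiff_fderiv_apply hV _).pow 2
    have hD0 : ∀ q ∈ tsupport w, D q ≠ 0 := by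
      intro q hq h0
      refine hreg q hq (eq_zero_of_apply_single fun i => ?_)
      have := (Finset.sum_eq_zero_iff_of_nonneg fun j _ => sq_nonneg _).1 h0 i (Finset.mem_univ i)
      simpa using this
    -- the vector field `w ∇V / |∇V|²`
    set Y : Fin N → ℰ → ℝ := fun i q => w q * fderiv ℝ V q (EuclideanSpace.single i 1) / D q
      with hY
    have hY0 : ∀ i, ∀ q ∉ tsupport w, Y i =ᶠ[𝓝 q] 0 := by
      intro i q hq
      filter_upwards [notMem_tsupport_iff_eventuallyEq.1 hq] with q' hq'
      simp [hY, hq']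
    have hYs : ∀ i, ContDiff ℝ ∞ (Y i) := by
      intro i
      rw [contDiff_iff_contDiffAt]
      intro q
      by_cases hq : q ∈ tsupport w
      · exact (hw.mul (contDiff_fderiv_apply hV _)).contDiffAt.div hDs.contDiffAt (hD0 q hq)
      · exact contDiffAt_const.congr_of_eventuallyEq (hY0 i q hq)
    have hYt : ∀ i, tsupport (Y i) ⊆ tsupport w := fun i q hq => by
      by_contra h
      exact (notMem_tsupport_iff_eventuallyEq.2 (hY0 i q h)) hq
    have hYc : ∀ i, HasCompactSupport (Y i) := fun i =>
      hwc.of_isClosed_subset (isClosed_tsupport _) (hYt i)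
    refine ⟨fun q => ∑ i, fderiv ℝ (Y i) q (EuclideanSpace.single i 1),
      ⟨ContDiff.sum fun i _ => contDiff_fderiv_apply (hYs i) _, ?_, ?_⟩, fun g h hg hh => ?_⟩
    · refine HasCompactSupport.intro' hwc.isCompact (isClosed_tsupport _) fun q hq => ?_
      refine Finset.sum_eq_zero fun i _ => ?_
      rw [(hY0 i q hq).fderiv_eq]
      simp
    · intro q hq
      refine hreg q (closure_minimal (fun q hq => ?_) (isClosed_tsupport w) hq)
      by_contra h
      refine hq (Finset.sum_eq_zero fun i _ => ?_)
      rw [(hY0 i q h).fderiv_eq]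
      simp
    · rw [← integral_sum_mul_fderiv hV hYs hYc hg hh]
      simp only [zero_mul, zero_add]
      congr 1
      ext q
      congr 1
      by_cases hq : q ∈ tsupport w
      · simp only [hY]
        rw [eq_comm]
        calc _ = ∑ i, w q / D q * fderiv ℝ V q (EuclideanSpace.single i 1) ^ 2 :=
              Finset.sum_congr rfl fun i _ => by ring
          _ = w q := by rw [← Finset.mul_sum, div_mul_cancel₀ _ (hD0 q hq)]
      · have : w q = 0 := image_eq_zero_of_notMem_tsupport hq
        simp [hY, this]

/-! ### The quadratic model -/

/-- The diagonal quadratic form `½ ∑ σᵢ xᵢ²`. -/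
def diagForm (σ : Fin N → ℝ) (x : ℰ) : ℝ := (∑ i, σ i * x i ^ 2) / 2

lemma contDiff_diagForm (σ : Fin N → ℝ) {n : WithTop ℕ∞} : ContDiff ℝ n (diagForm σ) := by
  unfold diagForm
  fun_prop

lemma fderiv_diagForm (σ : Fin N → ℝ) (x : ℰ) (i : Fin N) :
    fderiv ℝ (diagForm σ) x (EuclideanSpace.single i 1) = σ i * x i := by
  have h1 : ∀ j, HasFDerivAt (fun x : ℰ => x j) (EuclideanSpace.proj j : ℰ →L[ℝ] ℝ) x :=
    fun j => (EuclideanSpace.proj j : ℰ →L[ℝ] ℝ).hasFDerivAt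
  have h2 : HasFDerivAt (diagForm σ) _ x :=
    (HasFDerivAt.fun_sum (u := Finset.univ)
      fun j _ => ((h1 j).pow 2).const_mul (σ j)).mul_const (1 / 2) |>.congr_of_eventuallyEq
      (Eventually.of_forall fun y => by simp [diagForm, div_eq_mul_inv])
  rw [h2.fderiv]
  simp
  ring

/-- **Hadamard's lemma**: a smooth function vanishing at `0` is a combination of the coordinates
with smooth coefficients. -/
lemma exists_eq_sum_coord_mul {w : ℰ → ℝ} (hw : ContDiff ℝ ∞ w) (h0 : w 0 = 0) :
    ∃ b : Fin N → ℰ → ℝ, (∀ i, ContDiff ℝ ∞ (b i)) ∧ ∀ x, w x = ∑ i, x i * b i x := by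
  refine ⟨fun i x => ∫ t in (0 : ℝ)..1, fderiv ℝ w (t • x) (EuclideanSpace.single i 1),
    fun i => contDiff_integral_zero_one ?_, fun x => ?_⟩
  · exact (contDiff_fderiv_apply hw _).comp (contDiff_snd.smul contDiff_fst)
  · have hd : ∀ t : ℝ, HasDerivAt (fun t : ℝ => w (t • x)) (fderiv ℝ w (t • x) x) t := by
      intro t
      have h1 : HasDerivAt (fun t : ℝ => t • x) x t := by
        simpa using (hasDerivAt_id t).smul_const x
      exact ((hw.differentiable (by simp)).differentiableAt.hasFDerivAt).comp_hasDerivAt t h1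
    have hc : ∀ v : ℰ, Continuous fun t : ℝ => fderiv ℝ w (t • x) v := fun v =>
      (contDiff_fderiv_apply hw v).continuous.comp (by fun_prop)
    have h2 := intervalIntegral.integral_eq_sub_of_hasDerivAt (a := 0) (b := 1)
      (fun t _ => hd t) ((hc x).intervalIntegrable _ _)
    simp only [one_smul, zero_smul, h0, sub_zero] at h2
    rw [← h2]
    simp_rw [← intervalIntegral.integral_const_mul]
    rw [← intervalIntegral.integral_finsetSum fun i _ =>
      ((hc _).const_mul _).intervalIntegrable _ _]
    congr 1
    ext t
    have hx : ∑ i, x i • (EuclideanSpace.single i (1 : ℝ) : ℰ) = x := by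
      ext j
      simp [Finset.sum_apply, Pi.single_apply]
    have h3 := congrArg (fderiv ℝ w (t • x)) hx
    simpa using h3.symm

/-- If one weight equal to `1` at the origin has the density `ρ₀` under a nondegenerate diagonal
form, then every weight `w` has the density `w 0 • ρ₀`, up to a polynomial and an error of the order
of a primitive of `ρ₀`. -/
theorem exists_hasDens_diagForm {σ : Fin N → ℝ} (hσ : ∀ i, σ i = 1 ∨ σ i = -1) {χ : ℰ → ℝ}
    (hχ : ContDiff ℝ ∞ χ) (hχc : HasCompactSupport χ) (hχ0 : χ 0 = 1) {ρ₀ : ℝ → ℝ}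
    (h₀ : HasDens χ (diagForm σ) ρ₀) (h₀c : ContNear ρ₀) {S : ℝ} (hS0 : 0 ≤ S)
    (hS : PolyMod S fun x => ∫ y in Set.Iic x, ρ₀ y) {w : ℰ → ℝ} (hw : ContDiff ℝ ∞ w)
    (hwc : HasCompactSupport w) :
    ∃ ρ, HasDens w (diagForm σ) ρ ∧ ContNear ρ ∧ PolyMod S fun x => ρ x - w 0 * ρ₀ x := by
  have hQ := contDiff_diagForm σ (n := ∞)
  refine exists_hasDens_of_step (V := diagForm σ) hQ.continuous.measurable
    {w | ContDiff ℝ ∞ w ∧ HasCompactSupport w} ?_ (fun w => w 0) h₀.integrable h₀.bounded_support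
    h₀c hS0 hS ?_ w ⟨hw, hwc⟩
  · rintro w ⟨hw, hwc⟩
    refine ⟨hw.continuous.integrable_of_hasCompactSupport hwc, ?_⟩
    obtain ⟨R, hR⟩ := (hwc.isCompact.image hQ.continuous).isBounded.exists_norm_le
    exact ⟨R, fun q hq => hR _ ⟨q, subset_tsupport _ hq, rfl⟩⟩
  · rintro w ⟨hw, hwc⟩
    set w₀ : ℰ → ℝ := fun x => w x - w 0 * χ x with hw₀
    have hw₀s : ContDiff ℝ ∞ w₀ := hw.sub (contDiff_const.mul hχ)
    have hw₀c : HasCompactSupport w₀ := hwc.sub hχc.mul_left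
    obtain ⟨b, hb, hwb⟩ := exists_eq_sum_coord_mul hw₀s (by simp [hw₀, hχ0])
    obtain ⟨θ, hθ, hθc, -, hθ1⟩ := exists_smooth_cutoff hw₀c.isCompact isOpen_univ
      (Set.subset_univ _)
    have hY : ∀ i, ContDiff ℝ ∞ fun x => σ i * (θ x * b i x) := fun i =>
      contDiff_const.mul (hθ.mul (hb i))
    have hYc : ∀ i, HasCompactSupport fun x => σ i * (θ x * b i x) := fun i =>
      hθc.mul_right.mul_left
    have heq : ∀ x, ∑ i, σ i * (θ x * b i x) *
        fderiv ℝ (diagForm σ) x (EuclideanSpace.single i 1) = w₀ x := by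
      intro x
      have h1 : ∀ i, σ i * (θ x * b i x) *
          fderiv ℝ (diagForm σ) x (EuclideanSpace.single i 1) = θ x * (x i * b i x) := by
        intro i
        rw [fderiv_diagForm]
        rcases hσ i with h | h <;> rw [h] <;> ring
      simp_rw [h1]
      rw [← Finset.mul_sum, ← hwb]
      by_cases hx : x ∈ tsupport w₀
      · rw [(hθ1 x hx).self_of_nhds, one_mul]
      · rw [image_eq_zero_of_notMem_tsupport hx, mul_zero]
    refine ⟨fun q => ∑ i, fderiv ℝ (fun x => σ i * (θ x * b i x)) q (EuclideanSpace.single i 1),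
      ⟨ContDiff.sum fun i _ => contDiff_fderiv_apply (hY i) _, ?_⟩, fun g h hg hh => ?_⟩
    · refine HasCompactSupport.intro' hθc.isCompact (isClosed_tsupport _) fun q hq => ?_
      refine Finset.sum_eq_zero fun i _ => ?_
      have h0 : (fun x => σ i * (θ x * b i x)) =ᶠ[𝓝 q] fun _ => 0 := by
        filter_upwards [notMem_tsupport_iff_eventuallyEq.1 hq] with x hx
        simp [hx]
      rw [h0.fderiv_eq]
      simp
    · rw [← integral_sum_mul_fderiv hQ hY hYc hg hh, ← h₀.integral_eq g hg, ← integral_const_mul,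
        ← integral_add]
      · congr 1
        ext q
        rw [heq]
        simp only [hw₀]
        ring
      · exact (continuous_const.mul (hχ.continuous.mul
          (hg.comp hQ.continuous))).integrable_of_hasCompactSupport hχc.mul_right.mul_left
      · simp_rw [heq]
        exact (hw₀s.continuous.mul
          (hg.comp hQ.continuous)).integrable_of_hasCompactSupport hw₀c.mul_right

end

/-! ### The model singularities and their primitives -/

/-- The singular term of a nondegenerate quadratic form of index `k` in `N` variables, as a function
of the energy `E = N v`; up to a polynomial, it is `hTerm` in the variable `E`. Here `Real.log x`
stands for `ln |x|`. -/
def modelTerm (N k : ℕ) (x : ℝ) : ℝ :=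
  (2 * Real.pi) ^ ((N : ℝ) / 2) / Real.Gamma ((N : ℝ) / 2) *
    if Even k then
      (-1) ^ (k / 2) * (x ^ (((N : ℝ) - 2) / 2) * heavisideStep x)
    else if Even N then
      (-1) ^ ((k + 1) / 2) * Real.pi⁻¹ * (x ^ ((N - 2) / 2 : ℕ) * Real.log x)
    else
      (-1) ^ ((N - k) / 2) * ((-x) ^ (((N : ℝ) - 2) / 2) * heavisideStep (-x))

lemma rpow_mul_heavisideStep (p : ℝ) :
    (fun x : ℝ => x ^ p * heavisideStep x) = (Set.Ioi 0).indicator fun x => x ^ p := by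
  ext x
  by_cases hx : 0 < x <;> simp [heavisideStep, hx]

lemma intervalIntegrable_rpow_mul_heavisideStep {p : ℝ} (hp : -1 < p) (a b : ℝ) :
    IntervalIntegrable (fun x : ℝ => x ^ p * heavisideStep x) volume a b := by
  rw [rpow_mul_heavisideStep, intervalIntegrable_iff]
  exact (intervalIntegrable_iff.1 (intervalIntegral.intervalIntegrable_rpow' hp)).indicator
    measurableSet_Ioi

lemma intervalIntegrable_neg_rpow_mul_heavisideStep {p : ℝ} (hp : -1 < p) (a b : ℝ) :
    IntervalIntegrable (fun x : ℝ => (-x) ^ p * heavisideStep (-x)) volume a b := by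
  have := (IntervalIntegrable.iff_comp_neg
    (f := fun x : ℝ => x ^ p * heavisideStep x) (a := -a) (b := -b)).1
    (intervalIntegrable_rpow_mul_heavisideStep hp _ _)
  simpa using this

lemma intervalIntegrable_pow_mul_log (n : ℕ) (a b : ℝ) :
    IntervalIntegrable (fun x : ℝ => x ^ n * Real.log x) volume a b :=
  intervalIntegral.intervalIntegrable_log'.continuousOn_mul (by fun_prop)

lemma integral_rpow_mul_heavisideStep {p : ℝ} (hp : -1 < p) (x : ℝ) :
    ∫ y in (0 : ℝ)..x, y ^ p * heavisideStep y = x ^ (p + 1) * heavisideStep x / (p + 1) := by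
  rcases lt_or_ge 0 x with hx | hx
  · have : ∫ y in (0 : ℝ)..x, y ^ p * heavisideStep y = ∫ y in (0 : ℝ)..x, y ^ p := by
      apply intervalIntegral.integral_congr_ae
      refine Eventually.of_forall fun y hy => ?_
      rw [Set.uIoc_of_le hx.le] at hy
      simp [heavisideStep, hy.1]
    rw [this, integral_rpow (Or.inl hp), Real.zero_rpow (by linarith)]
    simp [heavisideStep, hx]
  · have : ∫ y in (0 : ℝ)..x, y ^ p * heavisideStep y = ∫ y in (0 : ℝ)..x, (0 : ℝ) := by
      apply intervalIntegral.integral_congr_ae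
      refine Eventually.of_forall fun y hy => ?_
      rw [Set.uIoc_of_ge hx] at hy
      simp [heavisideStep, not_lt.2 hy.2]
    rw [this]
    simp [heavisideStep, not_lt.2 hx]

lemma integral_neg_rpow_mul_heavisideStep {p : ℝ} (hp : -1 < p) (x : ℝ) :
    ∫ y in (0 : ℝ)..x, (-y) ^ p * heavisideStep (-y) =
      -((-x) ^ (p + 1) * heavisideStep (-x) / (p + 1)) := by
  rw [intervalIntegral.integral_comp_neg (fun y : ℝ => y ^ p * heavisideStep y), neg_zero,
    intervalIntegral.integral_symm, integral_rpow_mul_heavisideStep hp]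

lemma integral_pow_mul_log (n : ℕ) (x : ℝ) :
    ∫ y in (0 : ℝ)..x, y ^ n * Real.log y =
      x ^ (n + 1) * Real.log x / (n + 1) - x ^ (n + 1) / (n + 1) ^ 2 := by
  have hn : (n + 1 : ℝ) ≠ 0 := by positivity
  rw [integral_eq_of_hasDerivAt_off_countable
    (fun x : ℝ => x ^ (n + 1) * Real.log x / (n + 1) - x ^ (n + 1) / (n + 1) ^ 2) _
    (Set.countable_singleton (0 : ℝ)) ?_ ?_ (intervalIntegrable_pow_mul_log n _ _)]
  · simp
  · apply Continuous.continuousOn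
    have h1 : Continuous fun x : ℝ => x ^ n * (x * Real.log x) :=
      (continuous_pow n).mul Real.continuous_mul_log
    have h2 : (fun x : ℝ => x ^ (n + 1) * Real.log x / (n + 1) - x ^ (n + 1) / (n + 1) ^ 2) =
        fun x : ℝ => x ^ n * (x * Real.log x) / (n + 1) - x ^ (n + 1) / (n + 1) ^ 2 := by
      ext x
      ring
    rw [h2]
    fun_prop
  · intro y hy
    have hy0 : y ≠ 0 := hy.2
    have h1 := (((hasDerivAt_pow (n + 1) y).mul (Real.hasDerivAt_log hy0)).div_const
      (n + 1 : ℝ)).sub ((hasDerivAt_pow (n + 1) y).div_const ((n + 1 : ℝ) ^ 2))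
    refine h1.congr_deriv ?_
    simp only [Nat.add_sub_cancel]
    push_cast
    field_simp
    ring

lemma heavisideStep_mul_isBigO {p t : ℝ} (ht : t < p) :
    (fun x : ℝ => x ^ p * heavisideStep x) =O[𝓝[≠] 0] fun x => |x| ^ t := by
  refine IsBigO.trans (IsBigO.of_bound 1 (Eventually.of_forall fun x => ?_))
    (rpow_abs_isBigO ht.le)
  by_cases hx : 0 < x
  · simp [heavisideStep, hx, abs_of_pos hx]
  · simp only [heavisideStep, hx, if_false, mul_zero, norm_zero]
    positivity

lemma tendsto_neg_punctured : Tendsto (fun x : ℝ => -x) (𝓝[≠] 0) (𝓝[≠] 0) := by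
  refine tendsto_nhdsWithin_iff.2 ⟨?_, ?_⟩
  · have := (continuous_neg (G := ℝ)).tendsto 0
    rw [neg_zero] at this
    exact tendsto_nhdsWithin_of_tendsto_nhds this
  · filter_upwards [self_mem_nhdsWithin] with x hx
    simpa using hx

lemma neg_heavisideStep_mul_isBigO {p t : ℝ} (ht : t < p) :
    (fun x : ℝ => (-x) ^ p * heavisideStep (-x)) =O[𝓝[≠] 0] fun x => |x| ^ t := by
  have := (heavisideStep_mul_isBigO ht).comp_tendsto tendsto_neg_punctured
  simpa [Function.comp_def] using this

lemma pow_mul_log_isBigO {n : ℕ} {t : ℝ} (ht : t < n) :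
    (fun x : ℝ => x ^ n * Real.log x) =O[𝓝[≠] 0] fun x => |x| ^ t := by
  have hpos : 0 < (n : ℝ) - t := by linarith
  refine IsBigO.of_bound (1 / ((n : ℝ) - t)) ?_
  have h1 : ∀ᶠ x : ℝ in 𝓝[≠] 0, |x| < 1 := by
    apply eventually_nhdsWithin_of_eventually_nhds
    filter_upwards [Metric.ball_mem_nhds (0 : ℝ) one_pos] with x hx
    simpa using hx
  filter_upwards [h1, self_mem_nhdsWithin] with x hx hx0
  have hx' : 0 < |x| := abs_pos.2 hx0
  have h2 := Real.abs_log_mul_self_rpow_lt |x| _ hx' hx.le hpos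
  rw [norm_mul, norm_pow, Real.norm_eq_abs, Real.norm_eq_abs, Real.norm_of_nonneg (by positivity),
    ← Real.rpow_natCast, ← Real.log_abs x]
  rw [abs_mul, abs_of_nonneg (Real.rpow_nonneg hx'.le _)] at h2
  calc |x| ^ (n : ℝ) * |Real.log (|x|)| =
        |Real.log (|x|)| * |x| ^ ((n : ℝ) - t) * |x| ^ t := by
        rw [mul_assoc, ← Real.rpow_add hx']
        ring_nf
    _ ≤ _ := by gcongr

lemma intervalIntegrable_modelTerm {N : ℕ} (hN : 0 < N) (k : ℕ) (a b : ℝ) :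
    IntervalIntegrable (modelTerm N k) volume a b := by
  have hp : (-1 : ℝ) < ((N : ℝ) - 2) / 2 := by
    have : (1 : ℝ) ≤ N := by exact_mod_cast hN
    linarith
  unfold modelTerm
  apply IntervalIntegrable.const_mul
  split_ifs
  · exact (intervalIntegrable_rpow_mul_heavisideStep hp a b).const_mul _
  · exact (intervalIntegrable_pow_mul_log _ a b).const_mul _
  · exact (intervalIntegrable_neg_rpow_mul_heavisideStep hp a b).const_mul _

lemma polyMod_modelTerm {N : ℕ} (hN : 0 < N) (k : ℕ) :
    PolyMod ((N : ℝ) / 2 - 1) (modelTerm N k) := by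
  refine PolyMod.of_isBigO fun t ht => ?_
  have ht' : t < ((N : ℝ) - 2) / 2 := by linarith
  unfold modelTerm
  apply IsBigO.const_mul_left
  split_ifs with h1 h2
  · exact (heavisideStep_mul_isBigO ht').const_mul_left _
  · refine (pow_mul_log_isBigO ?_).const_mul_left _
    obtain ⟨m, rfl⟩ := h2
    obtain ⟨m, rfl⟩ : ∃ m', m = m' + 1 := ⟨m - 1, by omega⟩
    have : (m + 1 + (m + 1) - 2) / 2 = m := by omega
    rw [this]
    push_cast at ht'
    linarith
  · exact (neg_heavisideStep_mul_isBigO ht').const_mul_left _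

lemma modelTerm_coeff_add_two {N : ℕ} (hN : 0 < N) :
    (2 * Real.pi) ^ (((N + 2 : ℕ) : ℝ) / 2) / Real.Gamma (((N + 2 : ℕ) : ℝ) / 2) =
      2 * Real.pi * ((2 * Real.pi) ^ ((N : ℝ) / 2) / Real.Gamma ((N : ℝ) / 2)) / ((N : ℝ) / 2) := by
  have hN' : (0 : ℝ) < N := by exact_mod_cast hN
  have h1 : ((N + 2 : ℕ) : ℝ) / 2 = (N : ℝ) / 2 + 1 := by
    push_cast
    ring
  rw [h1, Real.Gamma_add_one (by positivity), Real.rpow_add_one (by positivity)]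
  have := (Real.Gamma_pos_of_pos (show 0 < (N : ℝ) / 2 by positivity)).ne'
  field_simp

/-- Two additional squares of the same sign amount to an integration of the model singularity. -/
lemma polyMod_modelTerm_add_two {N : ℕ} (hN : 0 < N) {k : ℕ} (hk : k ≤ N) (s : ℝ) :
    PolyMod s (fun x => modelTerm (N + 2) k x -
      2 * Real.pi * ∫ y in (0 : ℝ)..x, modelTerm N k y) ∧
    PolyMod s (fun x => modelTerm (N + 2) (k + 2) x +
      2 * Real.pi * ∫ y in (0 : ℝ)..x, modelTerm N k y) := by
  have hN' : (1 : ℝ) ≤ N := by exact_mod_cast hN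
  have hp : (-1 : ℝ) < ((N : ℝ) - 2) / 2 := by linarith
  have e1 : ((N : ℝ) - 2) / 2 + 1 = (N : ℝ) / 2 := by ring
  have e2 : (((N + 2 : ℕ) : ℝ) - 2) / 2 = (N : ℝ) / 2 := by
    push_cast
    ring
  have hk2 : Even (k + 2) ↔ Even k := by simp [Nat.even_add]
  have hN2 : Even (N + 2) ↔ Even N := by simp [Nat.even_add]
  have hN0 : (N : ℝ) ≠ 0 := by linarith
  by_cases h1 : Even k
  · have hs : (k + 2) / 2 = k / 2 + 1 := by omega
    have hz : ∀ x, modelTerm (N + 2) k x = 2 * Real.pi * ∫ y in (0 : ℝ)..x, modelTerm N k y := by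
      intro x
      simp only [modelTerm, modelTerm_coeff_add_two hN, e2, h1, if_true,
        intervalIntegral.integral_const_mul, integral_rpow_mul_heavisideStep hp, e1]
      ring
    have hz' : ∀ x, modelTerm (N + 2) (k + 2) x = -modelTerm (N + 2) k x := by
      intro x
      simp only [modelTerm, hk2, h1, if_true, hs, pow_succ]
      ring
    refine ⟨(polyMod_const s 0).congr (Eventually.of_forall fun x => ?_),
      (polyMod_const s 0).congr (Eventually.of_forall fun x => ?_)⟩
    · beta_reduce
      rw [hz, sub_self]
    · beta_reduce
      rw [hz', hz, neg_add_cancel]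
  by_cases h2 : Even N
  · have hs : (k + 2 + 1) / 2 = (k + 1) / 2 + 1 := by omega
    obtain ⟨m, rfl⟩ : ∃ m, N = 2 * (m + 1) := by
      obtain ⟨m, hm⟩ := h2
      exact ⟨m - 1, by omega⟩
    have d1 : (2 * (m + 1) - 2) / 2 = m := by omega
    have d2 : (2 * (m + 1) + 2 - 2) / 2 = m + 1 := by omega
    set c : ℝ := (2 * Real.pi) ^ (((2 * (m + 1) : ℕ) : ℝ) / 2) /
      Real.Gamma (((2 * (m + 1) : ℕ) : ℝ) / 2) with hc
    set S : ℝ := 2 * Real.pi * c * ((-1) ^ ((k + 1) / 2) * Real.pi⁻¹) / (m + 1) ^ 2 with hS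
    have hm : (m + 1 : ℝ) ≠ 0 := by positivity
    have hz : ∀ x, modelTerm (2 * (m + 1) + 2) k x -
        2 * Real.pi * ∫ y in (0 : ℝ)..x, modelTerm (2 * (m + 1)) k y = S * x ^ (m + 1) := by
      intro x
      simp only [modelTerm, modelTerm_coeff_add_two hN, h1, h2, hN2, if_true, if_false,
        intervalIntegral.integral_const_mul, integral_pow_mul_log, d1, d2, ← hc, hS]
      push_cast
      field_simp
      ring
    have hz' : ∀ x, modelTerm (2 * (m + 1) + 2) (k + 2) x =
        -modelTerm (2 * (m + 1) + 2) k x := by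
      intro x
      simp only [modelTerm, hk2, hN2, h1, h2, if_true, if_false, hs, pow_succ]
      ring
    have hX := (polyMod_pow s (m + 1)).const_mul S
    refine ⟨hX.congr (Eventually.of_forall fun x => (hz x).symm),
      (hX.const_mul (-1)).congr (Eventually.of_forall fun x => ?_)⟩
    simp only
    rw [hz', ← hz]
    ring
  · have hs : (N + 2 - k) / 2 = (N - k) / 2 + 1 := by omega
    have hs' : (N + 2 - (k + 2)) / 2 = (N - k) / 2 := by omega
    have hz : ∀ x, modelTerm (N + 2) k x = 2 * Real.pi * ∫ y in (0 : ℝ)..x, modelTerm N k y := by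
      intro x
      simp only [modelTerm, modelTerm_coeff_add_two hN, e2, h1, h2, hN2, if_false,
        intervalIntegral.integral_const_mul, integral_neg_rpow_mul_heavisideStep hp, e1, hs,
        pow_succ]
      ring
    have hz' : ∀ x, modelTerm (N + 2) (k + 2) x = -modelTerm (N + 2) k x := by
      intro x
      simp only [modelTerm, hk2, hN2, h1, h2, if_false, hs, hs', pow_succ]
      ring
    refine ⟨(polyMod_const s 0).congr (Eventually.of_forall fun x => ?_),
      (polyMod_const s 0).congr (Eventually.of_forall fun x => ?_)⟩
    · beta_reduce
      rw [hz, sub_self]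
    · beta_reduce
      rw [hz', hz, neg_add_cancel]

/-! ### Reduction of multiple integrals to the line -/

lemma Integrable.mul_comp_of_bounded {X : Type*} [MeasurableSpace X] {ν : Measure X}
    {F V : X → ℝ} (hF : Integrable F ν) (hV : Measurable V) {R : ℝ}
    (hR : ∀ x, F x ≠ 0 → |V x| ≤ R) {g : ℝ → ℝ} (hg : Continuous g) :
    Integrable (fun x => F x * g (V x)) ν := by
  obtain ⟨M, hM⟩ := (isCompact_Icc (a := -R) (b := R)).exists_bound_of_continuousOn hg.continuousOn
  refine (hF.norm.const_mul M).mono'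
    (hF.aestronglyMeasurable.mul (hg.measurable.comp hV).aestronglyMeasurable)
    (Eventually.of_forall fun x => ?_)
  by_cases hx : F x = 0
  · simp [hx]
  · rw [norm_mul, mul_comm]
    exact mul_le_mul_of_nonneg_right (hM _ (abs_le.1 (hR x hx))) (norm_nonneg _)

lemma bounded_support_mul_sub {ρ K : ℝ → ℝ} {R R' : ℝ} (hρ : ∀ x, R < |x| → ρ x = 0)
    (hK : ∀ x, R' < |x| → K x = 0) {t x : ℝ} (h : ρ x * K (t - x) ≠ 0) : |t| ≤ R + R' := by
  have h1 : |x| ≤ R := not_lt.1 fun hlt => h (by rw [hρ x hlt, zero_mul])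
  have h2 : |t - x| ≤ R' := not_lt.1 fun hlt => h (by rw [hK _ hlt, mul_zero])
  have := abs_add_le (t - x) x
  rw [sub_add_cancel] at this
  linarith

/-- The density of a sum of two independent variables is the convolution of the densities. -/
lemma integral_mul_integral_add {ρ K : ℝ → ℝ} (hρ : Integrable ρ) (hK : Integrable K)
    (hρs : ∃ R : ℝ, ∀ x, R < |x| → ρ x = 0) (hKs : ∃ R : ℝ, ∀ x, R < |x| → K x = 0) :
    Integrable (fun t => ∫ x, ρ x * K (t - x)) ∧
    (∃ R : ℝ, ∀ t, R < |t| → ∫ x, ρ x * K (t - x) = 0) ∧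
    ∀ g : ℝ → ℝ, Continuous g → ∫ s, K s * (∫ x, ρ x * g (x + s)) =
      ∫ t, (∫ x, ρ x * K (t - x)) * g t := by
  obtain ⟨R, hR⟩ := hρs
  obtain ⟨R', hR'⟩ := hKs
  have hconv : Integrable (fun p : ℝ × ℝ => ρ p.2 * K (p.1 - p.2)) (volume.prod volume) :=
    hρ.convolution_integrand (ContinuousLinearMap.mul ℝ ℝ) hK
  refine ⟨hconv.integral_prod_left, ⟨R + R', fun t ht => ?_⟩, fun g hg => ?_⟩
  · refine integral_eq_zero_of_ae (Eventually.of_forall fun x => ?_)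
    by_contra h
    exact absurd ht (not_lt.2 (bounded_support_mul_sub hR hR' h))
  have h1 : Integrable (fun p : ℝ × ℝ => ρ p.2 * K (p.1 - p.2) * g p.1) (volume.prod volume) :=
    Integrable.mul_comp_of_bounded hconv measurable_fst
      (fun p hp => bounded_support_mul_sub hR hR' hp) hg
  have h2 : Integrable (fun p : ℝ × ℝ => K p.1 * ρ p.2 * g (p.2 + p.1)) (volume.prod volume) := by
    refine Integrable.mul_comp_of_bounded (hK.mul_prod hρ)
      (V := fun p : ℝ × ℝ => p.2 + p.1) (by fun_prop) (R := R + R') (fun p hp => ?_) hg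
    refine bounded_support_mul_sub (ρ := ρ) (K := K) hR hR' (x := p.2) ?_
    rw [add_sub_cancel_left]
    rwa [mul_comm]
  calc ∫ s, K s * (∫ x, ρ x * g (x + s)) = ∫ s, ∫ x, K s * ρ x * g (x + s) := by
        simp_rw [mul_assoc, integral_const_mul]
    _ = ∫ x, ∫ s, K s * ρ x * g (x + s) :=
        integral_integral_swap (f := fun s x => K s * ρ x * g (x + s)) h2
    _ = ∫ x, ∫ t, ρ x * K (t - x) * g t := by
        congr 1
        ext x
        rw [← integral_add_right_eq_self (fun t => ρ x * K (t - x) * g t) x]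
        congr 1
        ext s
        rw [add_sub_cancel_right, add_comm s x]
        ring
    _ = ∫ t, ∫ x, ρ x * K (t - x) * g t :=
        (integral_integral_swap (f := fun t x => ρ x * K (t - x) * g t) h1).symm
    _ = _ := by simp_rw [integral_mul_const]

lemma integral_Ioi_mul_comp_sq_div_two (Φ : ℝ → ℝ) :
    ∫ r in Set.Ioi (0 : ℝ), r * Φ (r ^ 2 / 2) = ∫ s in Set.Ioi (0 : ℝ), Φ s := by
  have h1 := integral_comp_rpow_Ioi (fun y => Φ (y / 2) / 2) (p := 2) two_ne_zero
  have h2 := integral_comp_mul_left_Ioi Φ 0 (b := 1 / 2) (by norm_num)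
  have h3 : ∫ y in Set.Ioi (0 : ℝ), Φ (y / 2) / 2 = ∫ s in Set.Ioi (0 : ℝ), Φ s := by
    rw [integral_div]
    simp only [mul_zero, smul_eq_mul] at h2
    have h4 : ∀ y : ℝ, Φ (y / 2) = Φ (1 / 2 * y) := fun y => by ring_nf
    simp_rw [h4]
    rw [h2]
    ring
  rw [← h3, ← h1]
  refine setIntegral_congr_fun measurableSet_Ioi fun r _ => ?_
  simp only [smul_eq_mul]
  norm_num
  ring

/-- Integration over the plane of a function of `(a² + b²) / 2`. -/
lemma integral_radial_plane (Φ : ℝ → ℝ) :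
    ∫ p : ℝ × ℝ, Φ ((p.1 ^ 2 + p.2 ^ 2) / 2) = 2 * Real.pi * ∫ s in Set.Ioi (0 : ℝ), Φ s := by
  rw [← integral_comp_polarCoord_symm, ← integral_Ioi_mul_comp_sq_div_two]
  have h1 : ∀ p : ℝ × ℝ, p.1 • Φ (((polarCoord.symm p).1 ^ 2 + (polarCoord.symm p).2 ^ 2) / 2) =
      p.1 * Φ (p.1 ^ 2 / 2) * 1 := by
    intro p
    have : (p.1 * Real.cos p.2) ^ 2 + (p.1 * Real.sin p.2) ^ 2 = p.1 ^ 2 := by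
      rw [mul_pow, mul_pow, ← mul_add, Real.cos_sq_add_sin_sq, mul_one]
    simp [polarCoord_symm_apply, this]
  simp_rw [h1]
  rw [polarCoord_target, Measure.volume_eq_prod,
    setIntegral_prod_mul (fun r => r * Φ (r ^ 2 / 2)) (fun _ => 1)]
  simp only [integral_const, MeasurableSet.univ, measureReal_restrict_apply, Set.univ_inter,
    Real.volume_real_Ioo_of_le (by linarith [Real.pi_pos] : -Real.pi ≤ Real.pi), smul_eq_mul,
    mul_one]
  ring

lemma piFinSuccAbove_symm_eq_vecCons {n : ℕ} (p : ℝ × (Fin n → ℝ)) :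
    (MeasurableEquiv.piFinSuccAbove (fun _ : Fin (n + 1) => ℝ) 0).symm p =
      Matrix.vecCons p.1 p.2 := by
  ext i
  refine Fin.cases ?_ (fun j => ?_) i <;> simp [MeasurableEquiv.piFinSuccAbove, Matrix.vecCons]

lemma integral_fin_two (F : (Fin 2 → ℝ) → ℝ) :
    ∫ x, F x = ∫ p : ℝ × ℝ, F ![p.1, p.2] := by
  have h := (volume_preserving_finTwoArrow ℝ).symm
  rw [← h.integral_comp (MeasurableEquiv.measurableEmbedding _)]
  rfl

lemma integral_fin_add_two {n : ℕ} {F : (Fin (n + 2) → ℝ) → ℝ} (hF : Integrable F) :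
    ∫ x, F x =
      ∫ p : ℝ × ℝ, ∫ y : Fin n → ℝ, F (Matrix.vecCons p.1 (Matrix.vecCons p.2 y)) := by
  have h1 := (volume_preserving_piFinSuccAbove (fun _ : Fin (n + 2) => ℝ) 0).symm
  have h2 := (volume_preserving_piFinSuccAbove (fun _ : Fin (n + 1) => ℝ) 0).symm
  have h3 := (MeasurePreserving.id (volume : Measure ℝ)).prod h2
  have h4 := (volume_preserving_prodAssoc (α₁ := ℝ) (β₁ := ℝ) (γ₁ := Fin n → ℝ))
  have h5 := (h1.comp h3).comp h4
  have he :=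
    ((MeasurableEquiv.piFinSuccAbove (fun _ : Fin (n + 2) => ℝ) 0).symm.measurableEmbedding.comp
      (((MeasurableEquiv.refl ℝ).prodCongr
        (MeasurableEquiv.piFinSuccAbove (fun _ : Fin (n + 1) => ℝ)
          0).symm).measurableEmbedding)).comp MeasurableEquiv.prodAssoc.measurableEmbedding
  have hfun : ((MeasurableEquiv.piFinSuccAbove (fun _ : Fin (n + 2) => ℝ) 0).symm ∘
      Prod.map id (MeasurableEquiv.piFinSuccAbove (fun _ : Fin (n + 1) => ℝ) 0).symm) ∘
      (MeasurableEquiv.prodAssoc : (ℝ × ℝ) × (Fin n → ℝ) ≃ᵐ ℝ × ℝ × (Fin n → ℝ)) =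
      fun p : (ℝ × ℝ) × (Fin n → ℝ) => Matrix.vecCons p.1.1 (Matrix.vecCons p.1.2 p.2) := by
    ext1 p
    simp only [Function.comp_apply, piFinSuccAbove_symm_eq_vecCons]
    rw [Prod.map_snd, piFinSuccAbove_symm_eq_vecCons]
    rfl
  rw [hfun] at h5
  replace he : MeasurableEmbedding fun p : (ℝ × ℝ) × (Fin n → ℝ) =>
      (Matrix.vecCons p.1.1 (Matrix.vecCons p.1.2 p.2) : Fin (n + 2) → ℝ) := hfun ▸ he
  rw [← h5.integral_comp he]
  have hF' := (h5.integrable_comp_emb he).2 hF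
  exact integral_prod _ hF'

/-! ### Cutoffs on the energy axis -/

/-- An even cutoff on the line, equal to `1` on `[-1, 1]` and to `0` off `(-2, 2)`. -/
def lineCutoff : ContDiffBump (0 : ℝ) := ⟨1, 2, one_pos, one_lt_two⟩

lemma contDiff_lineCutoff : ContDiff ℝ ∞ lineCutoff := lineCutoff.contDiff

lemma lineCutoff_one {s : ℝ} (hs : |s| ≤ 1) : lineCutoff s = 1 :=
  lineCutoff.one_of_mem_closedBall (by simpa [lineCutoff] using hs)

lemma lineCutoff_zero {s : ℝ} (hs : 2 ≤ |s|) : lineCutoff s = 0 :=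
  lineCutoff.zero_of_le_dist (by simpa [lineCutoff] using hs)

lemma lineCutoff_neg (s : ℝ) : lineCutoff (-s) = lineCutoff s := by
  have := lineCutoff.sub s
  simpa using this

lemma lineCutoff_abs (s : ℝ) : lineCutoff |s| = lineCutoff s := by
  rcases abs_choice s with h | h <;> rw [h]
  exact lineCutoff_neg s

lemma lineCutoff_nonneg (s : ℝ) : 0 ≤ lineCutoff s := lineCutoff.nonneg

lemma lineCutoff_le_one (s : ℝ) : lineCutoff s ≤ 1 := lineCutoff.le_one

lemma integrable_lineCutoff : Integrable lineCutoff :=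
  contDiff_lineCutoff.continuous.integrable_of_hasCompactSupport lineCutoff.hasCompactSupport

/-- The density of `(a² + b²) / 2` on the plane with weight `lineCutoff`, up to the factor
`2 π`. -/
def halfCutoff (s : ℝ) : ℝ := if 0 < s then lineCutoff s else 0

lemma halfCutoff_eq : halfCutoff = (Set.Ioi 0).indicator lineCutoff := by
  ext s
  by_cases hs : 0 < s <;> simp [halfCutoff, hs]

lemma integrable_halfCutoff : Integrable halfCutoff := by
  rw [halfCutoff_eq]
  exact integrable_lineCutoff.indicator measurableSet_Ioi

lemma halfCutoff_zero {s : ℝ} (hs : 2 < |s|) : halfCutoff s = 0 := by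
  simp [halfCutoff, lineCutoff_zero hs.le]

lemma integral_Ioi_lineCutoff_mul (f : ℝ → ℝ) :
    ∫ s in Set.Ioi (0 : ℝ), lineCutoff s * f s = ∫ s, halfCutoff s * f s := by
  rw [← integral_indicator measurableSet_Ioi]
  congr 1
  ext s
  by_cases hs : 0 < s <;> simp [halfCutoff, hs]

/-- The smooth difference between `halfCutoff` and the Heaviside function. -/
def halfCutoffTail (s : ℝ) : ℝ := if 0 < s then lineCutoff s - 1 else 0

lemma contDiff_halfCutoffTail : ContDiff ℝ ∞ halfCutoffTail := by
  rw [contDiff_iff_contDiffAt]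
  intro s
  rcases lt_or_ge s 1 with hs | hs
  · refine (contDiffAt_const (c := (0 : ℝ))).congr_of_eventuallyEq ?_
    filter_upwards [isOpen_Iio.mem_nhds hs] with t (ht : t < 1)
    by_cases h0 : 0 < t
    · simp [halfCutoffTail, lineCutoff_one (abs_le.2 ⟨by linarith, ht.le⟩)]
    · simp [halfCutoffTail, h0]
  · refine (contDiff_lineCutoff.sub contDiff_const).contDiffAt.congr_of_eventuallyEq
      (f := fun s => lineCutoff s - 1) ?_
    filter_upwards [isOpen_Ioi.mem_nhds (zero_lt_one.trans_le hs)] with t (ht : 0 < t)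
    simp [halfCutoffTail, ht]

/-! ### A reference weight for each signature -/

/-- For some diagonal form in `N` variables with `k` negative coefficients, some weight equal to `1`
at the origin has a density with singular term `modelTerm N k`. -/
def HasModelWeight (N k : ℕ) : Prop :=
  ∃ σ : Fin N → ℝ, (∀ i, σ i = 1 ∨ σ i = -1) ∧ (∑ i, if σ i < 0 then 1 else 0) = k ∧
    ∃ w : (Fin N → ℝ) → ℝ, ContDiff ℝ ∞ w ∧ HasCompactSupport w ∧ w 0 = 1 ∧
      ∃ ρ, HasDens w (fun x => (∑ i, σ i * x i ^ 2) / 2) ρ ∧ ContNear ρ ∧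
        PolyMod ((N : ℝ) / 2) fun x => ρ x - modelTerm N k x

lemma eventually_abs_lt {δ : ℝ} (hδ : 0 < δ) : ∀ᶠ x : ℝ in 𝓝[≠] 0, |x| < δ := by
  apply eventually_nhdsWithin_of_eventually_nhds
  filter_upwards [Metric.ball_mem_nhds (0 : ℝ) hδ] with x hx
  simpa using hx

/-- The plane weight with sign `τ`: the density of `τ (a² + b²) / 2`, up to the factor `2 π`, is
`halfCutoff (τ ·)`. -/
lemma integral_halfCutoff_mul {τ : ℝ} (hτ : τ = 1 ∨ τ = -1) (f : ℝ → ℝ) :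
    ∫ s, halfCutoff s * f (τ * s) = ∫ s, halfCutoff (τ * s) * f s := by
  rcases hτ with rfl | rfl
  · simp
  · rw [← integral_neg_eq_self]
    simp

lemma integrable_halfCutoff_mul {τ : ℝ} (hτ : τ = 1 ∨ τ = -1) :
    Integrable fun s => halfCutoff (τ * s) :=
  integrable_halfCutoff.comp_mul_left' (by rcases hτ with rfl | rfl <;> norm_num)

lemma halfCutoff_mul_zero {τ : ℝ} (hτ : τ = 1 ∨ τ = -1) {s : ℝ} (hs : 2 < |s|) :
    halfCutoff (τ * s) = 0 :=
  halfCutoff_zero (by rcases hτ with rfl | rfl <;> simpa using hs)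

/-- Convolution with the plane density is integration, up to a smooth function. -/
lemma integral_mul_halfCutoff {τ : ℝ} (hτ : τ = 1 ∨ τ = -1) {ρ : ℝ → ℝ} (hρ : Integrable ρ)
    (hρs : ∃ R : ℝ, ∀ x, R < |x| → ρ x = 0) :
    ∃ f : ℝ → ℝ, ContDiff ℝ ∞ f ∧ ∀ t, ∫ x, ρ x * halfCutoff (τ * (t - x)) =
      τ * (∫ x in Set.Iic t, ρ x) + f t := by
  have hτc : ContDiff ℝ ∞ fun q : ℝ × ℝ => halfCutoffTail (τ * (q.1 - q.2)) :=
    contDiff_halfCutoffTail.comp (by fun_prop)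
  have hsm := contDiff_parametric_integral hρ hρs (G := fun t x => halfCutoffTail (τ * (t - x))) hτc
  simp only [smul_eq_mul] at hsm
  have hint : ∀ t, Integrable fun x => ρ x * halfCutoffTail (τ * (t - x)) := fun t =>
    integrable_mul_of_bounded_support hρ hρs
      (contDiff_halfCutoffTail.continuous.comp (by fun_prop))
  rcases hτ with rfl | rfl
  · refine ⟨_, hsm, fun t => ?_⟩
    rw [integral_Iic_eq_integral_Iio, ← integral_indicator measurableSet_Iio, one_mul,
      ← integral_add (hρ.indicator measurableSet_Iio) (hint t)]
    congr 1
    ext x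
    by_cases hx : x < t
    · have : 0 < t - x := by linarith
      simp [halfCutoff, halfCutoffTail, hx]
      ring
    · simp [halfCutoff, halfCutoffTail, hx]
  · refine ⟨fun t => (∫ x, ρ x) + ∫ x, ρ x * halfCutoffTail (-1 * (t - x)),
      contDiff_const.add hsm, fun t => ?_⟩
    have h1 : (∫ x in Set.Iic t, ρ x) + ∫ x in Set.Ioi t, ρ x = ∫ x, ρ x := by
      rw [← Set.compl_Iic]
      exact integral_add_compl measurableSet_Iic hρ
    rw [← h1, ← add_assoc, neg_one_mul, ← add_assoc, neg_add_cancel, zero_add,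
      ← integral_indicator measurableSet_Ioi,
      ← integral_add (hρ.indicator measurableSet_Ioi) (hint t)]
    congr 1
    ext x
    by_cases hx : t < x
    · simp [halfCutoff, halfCutoffTail, hx]
      ring
    · simp [halfCutoff, halfCutoffTail, hx]

lemma contDiff_lineCutoff_plane {n : ℕ} :
    ContDiff ℝ ∞ fun x : Fin (n + 2) → ℝ => lineCutoff ((x 0 ^ 2 + x 1 ^ 2) / 2) :=
  contDiff_lineCutoff.comp (by fun_prop)

lemma abs_le_two_of_lineCutoff_ne_zero {a b : ℝ} (h : lineCutoff ((a ^ 2 + b ^ 2) / 2) ≠ 0) :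
    |a| ≤ 2 ∧ |b| ≤ 2 := by
  have h1 : |(a ^ 2 + b ^ 2) / 2| < 2 := not_le.1 fun hle => h (lineCutoff_zero hle)
  rw [abs_of_nonneg (by positivity)] at h1
  exact ⟨abs_le_of_sq_le_sq (by nlinarith [sq_nonneg b]) (by norm_num),
    abs_le_of_sq_le_sq (by nlinarith [sq_nonneg a]) (by norm_num)⟩

/-- Two additional squares of the same sign `τ` convolve the density with a step function. -/
lemma HasModelWeight.add_two {N k k' : ℕ} (hN : 0 < N) (h : HasModelWeight N k) {τ : ℝ}
    (hτ : τ = 1 ∨ τ = -1) (hk' : (if τ < 0 then 2 else 0) + k = k')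
    (hm : ∀ s, PolyMod s fun x => modelTerm (N + 2) k' x -
      2 * Real.pi * τ * ∫ y in (0 : ℝ)..x, modelTerm N k y) : HasModelWeight (N + 2) k' := by
  obtain ⟨σ, hσ, hσk, w, hw, hwc, hw0, ρ, hρ, hρc, hρm⟩ := h
  obtain ⟨hK, hKs, hKg⟩ := integral_mul_integral_add hρ.integrable (integrable_halfCutoff_mul hτ)
    hρ.bounded_support ⟨2, fun x hx => halfCutoff_mul_zero hτ hx⟩
  obtain ⟨f, hf, hft⟩ := integral_mul_halfCutoff hτ hρ.integrable hρ.bounded_support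
  have hQs : Continuous fun x : Fin (N + 2) → ℝ =>
      (∑ i, (Matrix.vecCons τ (Matrix.vecCons τ σ) : Fin (N + 2) → ℝ) i * x i ^ 2) / 2 := by
    fun_prop
  have hws : ContDiff ℝ ∞ fun x : Fin (N + 2) → ℝ => w (fun i => x i.succ.succ) :=
    hw.comp (by fun_prop)
  have hwc' : HasCompactSupport fun x : Fin (N + 2) → ℝ =>
      w (fun i => x i.succ.succ) * lineCutoff ((x 0 ^ 2 + x 1 ^ 2) / 2) := by
    obtain ⟨R, hR⟩ := hwc.isCompact.isBounded.exists_norm_le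
    refine HasCompactSupport.intro (isCompact_closedBall (0 : Fin (N + 2) → ℝ) (max 2 R))
      fun x hx => ?_
    by_contra hne
    apply hx
    have h1 := hR _ (subset_tsupport w (left_ne_zero_of_mul hne))
    have h2 := abs_le_two_of_lineCutoff_ne_zero (right_ne_zero_of_mul hne)
    rw [mem_closedBall_zero_iff, pi_norm_le_iff_of_nonneg (by positivity)]
    intro i
    refine Fin.cases (h2.1.trans (le_max_left _ _)) (fun i => ?_) i
    refine Fin.cases (h2.2.trans (le_max_left _ _)) (fun i => ?_) i
    exact ((norm_le_pi_norm (fun i : Fin N => x i.succ.succ) i).trans h1).trans (le_max_right _ _)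
  refine ⟨Matrix.vecCons τ (Matrix.vecCons τ σ), ?_, ?_, _, hws.mul contDiff_lineCutoff_plane,
    hwc', ?_, fun t => 2 * Real.pi * ∫ x, ρ x * halfCutoff (τ * (t - x)),
    ⟨hK.const_mul _, ?_, fun g hg => ?_⟩, ?_, ?_⟩
  · intro i
    refine Fin.cases hτ (fun i => ?_) i
    exact Fin.cases hτ (fun i => hσ i) i
  · rw [Fin.sum_univ_succ, Fin.sum_univ_succ]
    simp only [Matrix.cons_val_zero, Matrix.cons_val_succ]
    rw [hσk, ← hk']
    rcases hτ with rfl | rfl <;> norm_num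
    omega
  · have : (fun i : Fin N => (0 : Fin (N + 2) → ℝ) i.succ.succ) = 0 := rfl
    simp only [this, hw0]
    simp [lineCutoff_one]
  · obtain ⟨R, hR⟩ := hKs
    exact ⟨R, fun x hx => by rw [hR x hx, mul_zero]⟩
  · rw [integral_fin_add_two]
    · have h1 : ∀ (p : ℝ × ℝ) (y : Fin N → ℝ),
          w (fun i => (Matrix.vecCons p.1 (Matrix.vecCons p.2 y) : Fin (N + 2) → ℝ) i.succ.succ) *
            lineCutoff (((Matrix.vecCons p.1 (Matrix.vecCons p.2 y) : Fin (N + 2) → ℝ) 0 ^ 2 +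
              (Matrix.vecCons p.1 (Matrix.vecCons p.2 y) : Fin (N + 2) → ℝ) 1 ^ 2) / 2) *
            g ((∑ i, (Matrix.vecCons τ (Matrix.vecCons τ σ) : Fin (N + 2) → ℝ) i *
              (Matrix.vecCons p.1 (Matrix.vecCons p.2 y) : Fin (N + 2) → ℝ) i ^ 2) / 2) =
          lineCutoff ((p.1 ^ 2 + p.2 ^ 2) / 2) *
            (w y * g ((∑ i, σ i * y i ^ 2) / 2 + τ * ((p.1 ^ 2 + p.2 ^ 2) / 2))) := by
        intro p y
        have e : (∑ i, (Matrix.vecCons τ (Matrix.vecCons τ σ) : Fin (N + 2) → ℝ) i *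
              (Matrix.vecCons p.1 (Matrix.vecCons p.2 y) : Fin (N + 2) → ℝ) i ^ 2) / 2 =
            (∑ i, σ i * y i ^ 2) / 2 + τ * ((p.1 ^ 2 + p.2 ^ 2) / 2) := by
          rw [Fin.sum_univ_succ, Fin.sum_univ_succ]
          simp only [Matrix.cons_val_zero, Matrix.cons_val_succ]
          ring
        rw [e]
        simp only [Matrix.cons_val_zero, Matrix.cons_val_one, Matrix.cons_val_succ]
        ring
      simp_rw [h1, integral_const_mul]
      have h2 : ∀ s, ∫ y, w y * g ((∑ i, σ i * y i ^ 2) / 2 + s) = ∫ x, ρ x * g (x + s) :=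
        fun s => hρ.integral_eq (fun x => g (x + s)) (hg.comp (by fun_prop))
      simp_rw [h2]
      rw [integral_radial_plane (fun s => lineCutoff s * ∫ x, ρ x * g (x + τ * s)),
        integral_Ioi_lineCutoff_mul, integral_halfCutoff_mul hτ (fun s => ∫ x, ρ x * g (x + s)),
        hKg g hg]
      simp_rw [mul_assoc, integral_const_mul]
    · exact (((hws.mul contDiff_lineCutoff_plane).continuous).mul
        (hg.comp hQs)).integrable_of_hasCompactSupport hwc'.mul_right
  · simp_rw [hft]
    exact (continuous_const.mul ((continuous_const.mul
      (continuous_setIntegral_Iic hρ.integrable)).add hf.continuous)).contNear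
  · have hN' : (0 : ℝ) < N := by exact_mod_cast hN
    have h1 := hρm.integral (by linarith)
      fun a b => hρ.integrable.intervalIntegrable.sub (intervalIntegrable_modelTerm hN k a b)
    have h2 : (N : ℝ) / 2 + 1 = ((N + 2 : ℕ) : ℝ) / 2 := by
      push_cast
      ring
    rw [h2] at h1
    set S := ((N + 2 : ℕ) : ℝ) / 2
    have h3 := (((polyMod_const S (∫ x in Set.Iic 0, ρ x)).add h1).const_mul
      (2 * Real.pi * τ)).add (((polyMod_of_contDiff hf S).const_mul (2 * Real.pi)).sub (hm S))
    refine h3.congr (Eventually.of_forall fun x => ?_)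
    beta_reduce
    rw [hft, setIntegral_Iic_eq hρ.integrable x, intervalIntegral.integral_sub
      hρ.integrable.intervalIntegrable (intervalIntegrable_modelTerm hN k _ _)]
    ring

lemma hasModelWeight_two {k : ℕ} {τ : ℝ} (hτ : τ = 1 ∨ τ = -1)
    (hk : (if τ < 0 then 2 else 0) = k) : HasModelWeight 2 k := by
  have hQs : Continuous fun x : Fin 2 → ℝ => (∑ i, (fun _ : Fin 2 => τ) i * x i ^ 2) / 2 := by
    fun_prop
  have hwc : HasCompactSupport fun x : Fin 2 → ℝ => lineCutoff ((x 0 ^ 2 + x 1 ^ 2) / 2) := by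
    refine HasCompactSupport.intro (isCompact_closedBall (0 : Fin 2 → ℝ) 2) fun x hx => ?_
    by_contra hne
    apply hx
    have h2 := abs_le_two_of_lineCutoff_ne_zero hne
    rw [mem_closedBall_zero_iff, pi_norm_le_iff_of_nonneg (by norm_num), Fin.forall_fin_two]
    exact h2
  refine ⟨fun _ => τ, fun _ => hτ, ?_, _, contDiff_lineCutoff_plane (n := 0), hwc, ?_,
    fun t => 2 * Real.pi * halfCutoff (τ * t),
    ⟨(integrable_halfCutoff_mul hτ).const_mul _, ⟨2, fun x hx => ?_⟩, fun g hg => ?_⟩, ?_, ?_⟩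
  · rw [Fin.sum_univ_two, ← hk]
    split_ifs <;> rfl
  · simp [lineCutoff_one]
  · rw [halfCutoff_mul_zero hτ hx, mul_zero]
  · rw [integral_fin_two]
    have h1 : ∀ p : ℝ × ℝ, (∑ i, τ * (![p.1, p.2] : Fin 2 → ℝ) i ^ 2) / 2 =
        τ * ((p.1 ^ 2 + p.2 ^ 2) / 2) := by
      intro p
      rw [Fin.sum_univ_two]
      simp only [Matrix.cons_val_zero, Matrix.cons_val_one]
      ring
    simp only [h1, Matrix.cons_val_zero, Matrix.cons_val_one]
    rw [integral_radial_plane (fun s => lineCutoff s * g (τ * s)), integral_Ioi_lineCutoff_mul,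
      integral_halfCutoff_mul hτ g]
    simp_rw [mul_assoc, integral_const_mul]
  all_goals
    have hnear : ∀ᶠ t : ℝ in 𝓝[≠] 0, halfCutoff (τ * t) = if 0 < τ * t then 1 else 0 := by
      filter_upwards [eventually_abs_lt one_pos] with t ht
      have : |τ * t| ≤ 1 := by
        rcases hτ with rfl | rfl <;> simpa using ht.le
      simp [halfCutoff, lineCutoff_one this]
  · have hc : ContNear fun t : ℝ => 2 * Real.pi * if 0 < τ * t then 1 else 0 := by
      refine ContNear.const_mul ?_ _
      filter_upwards [self_mem_nhdsWithin] with t (ht : t ≠ 0)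
      have hτt : τ * t ≠ 0 := mul_ne_zero (by rcases hτ with rfl | rfl <;> norm_num) ht
      have hcont : Continuous fun t => τ * t := by fun_prop
      rcases lt_or_gt_of_ne hτt with h | h
      · refine (continuousAt_const (y := (0 : ℝ))).congr ?_
        filter_upwards [(isOpen_Iio.preimage hcont).mem_nhds h] with s (hs : τ * s < 0)
        simp [hs.le]
      · refine (continuousAt_const (y := (1 : ℝ))).congr ?_
        filter_upwards [(isOpen_Ioi.preimage hcont).mem_nhds h] with s (hs : 0 < τ * s)
        simp [hs]
    exact hc.congr (hnear.mono fun t ht => by beta_reduce; rw [ht])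
  · have hev : Even k := by
      rw [← hk]
      split_ifs <;> decide
    rcases hτ with rfl | rfl
    · norm_num at hk
      subst hk
      refine (polyMod_const _ 0).congr (hnear.mono fun t ht => ?_)
      beta_reduce
      rw [ht]
      simp [modelTerm, heavisideStep]
    · norm_num at hk
      subst hk
      refine (polyMod_const _ (2 * Real.pi)).congr ?_
      filter_upwards [hnear, self_mem_nhdsWithin] with t ht (ht0 : t ≠ 0)
      rw [ht]
      rcases lt_or_gt_of_ne ht0 with h | h
      · simp [modelTerm, heavisideStep, h, h.not_gt]
      · simp [modelTerm, heavisideStep, h, h.not_gt]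

lemma integral_fin_one (F : (Fin 1 → ℝ) → ℝ) : ∫ x, F x = ∫ x : ℝ, F fun _ => x := by
  have h := (volume_preserving_funUnique (Fin 1) ℝ).symm
  convert! (h.integral_comp (MeasurableEquiv.measurableEmbedding _) F).symm

lemma hasModelWeight_one {k : ℕ} {τ : ℝ} (hτ : τ = 1 ∨ τ = -1)
    (hk : (if τ < 0 then 1 else 0) = k) : HasModelWeight 1 k := by
  have hQs : Continuous fun x : Fin 1 → ℝ => (∑ i, (fun _ : Fin 1 => τ) i * x i ^ 2) / 2 := by
    fun_prop
  have hws : ContDiff ℝ ∞ fun x : Fin 1 → ℝ => lineCutoff (x 0 ^ 2 / 2) :=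
    contDiff_lineCutoff.comp (by fun_prop)
  have hwc : HasCompactSupport fun x : Fin 1 → ℝ => lineCutoff (x 0 ^ 2 / 2) := by
    refine HasCompactSupport.intro (isCompact_closedBall (0 : Fin 1 → ℝ) 2) fun x hx => ?_
    by_contra hne
    apply hx
    have h2 := abs_le_two_of_lineCutoff_ne_zero (a := x 0) (b := 0) (by simpa using hne)
    rw [mem_closedBall_zero_iff, pi_norm_le_iff_of_nonneg (by norm_num), Fin.forall_fin_one]
    exact h2.1
  -- the density of `x² / 2` is `2 (2 s)^(-1/2)`
  set m : ℝ → ℝ := fun s => halfCutoff s * (2 * (2 * s) ^ (-(1 / 2) : ℝ)) with hm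
  have hmi : Integrable m := by
    have h1 : IntegrableOn (fun s : ℝ => lineCutoff s * (2 * (2 * s) ^ (-(1 / 2) : ℝ)))
        (Set.Ioc 0 2) := by
      have h2 : IntegrableOn (fun s : ℝ => s ^ (-(1 / 2) : ℝ)) (Set.Ioc 0 2) :=
        (intervalIntegrable_iff_integrableOn_Ioc_of_le (by norm_num)).1
          (intervalIntegral.intervalIntegrable_rpow' (by norm_num))
      have h3 : IntegrableOn (fun s : ℝ => 2 * (2 * s) ^ (-(1 / 2) : ℝ)) (Set.Ioc 0 2) := by
        refine IntegrableOn.congr_fun (h2.const_mul (2 * (2 : ℝ) ^ (-(1 / 2) : ℝ)))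
          (fun s hs => ?_) measurableSet_Ioc
        rw [Real.mul_rpow (by norm_num) hs.1.le]
        ring
      refine Integrable.bdd_mul (c := 1) h3
        contDiff_lineCutoff.continuous.aestronglyMeasurable (Eventually.of_forall fun s => ?_)
      rw [Real.norm_of_nonneg (lineCutoff_nonneg s)]
      exact lineCutoff_le_one s
    refine ((integrable_indicator_iff measurableSet_Ioc).2 h1).congr
      (Eventually.of_forall fun s => ?_)
    by_cases h0 : 0 < s
    · by_cases h2 : s ≤ 2
      · simp [hm, halfCutoff, h0, h2]
      · have : lineCutoff s = 0 := lineCutoff_zero (by rw [abs_of_pos h0]; linarith)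
        simp [hm, halfCutoff, h0, h2, this]
    · simp [hm, halfCutoff, h0]
  have hτ0 : τ ≠ 0 := by rcases hτ with rfl | rfl <;> norm_num
  have hmz : ∀ s : ℝ, 2 < |s| → m s = 0 := fun s hs => by simp [hm, halfCutoff_zero hs]
  have hmτ : ∀ f : ℝ → ℝ, ∫ s, m s * f (τ * s) = ∫ s, m (τ * s) * f s := by
    intro f
    rcases hτ with rfl | rfl
    · simp
    · rw [← integral_neg_eq_self]
      simp
  refine ⟨fun _ => τ, fun _ => hτ, ?_, _, hws, hwc, ?_, fun t => m (τ * t),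
    ⟨hmi.comp_mul_left' hτ0, ⟨2, fun x hx => hmz _ ?_⟩, fun g hg => ?_⟩, ?_, ?_⟩
  · rw [Fin.sum_univ_one, ← hk]
  · simp [lineCutoff_one]
  · rcases hτ with rfl | rfl <;> simpa using hx
  · rw [integral_fin_one]
    have h1 : ∀ x : ℝ, lineCutoff (x ^ 2 / 2) * g ((∑ _i : Fin 1, τ * x ^ 2) / 2) =
        lineCutoff (|x| ^ 2 / 2) * g (τ * (|x| ^ 2 / 2)) := by
      intro x
      rw [Fin.sum_univ_one, sq_abs, mul_div_assoc]
    simp_rw [h1]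
    rw [integral_comp_abs (f := fun x => lineCutoff (x ^ 2 / 2) * g (τ * (x ^ 2 / 2))), ← hmτ]
    have h2 := integral_Ioi_mul_comp_sq_div_two fun s => m s * g (τ * s)
    have h3 : ∫ s in Set.Ioi (0 : ℝ), m s * g (τ * s) = ∫ s, m s * g (τ * s) := by
      refine setIntegral_eq_integral_of_forall_compl_eq_zero fun s hs => ?_
      have : ¬ 0 < s := hs
      simp [hm, halfCutoff, this]
    rw [← h3, ← h2, ← integral_const_mul]
    refine setIntegral_congr_fun measurableSet_Ioi fun r (hr : 0 < r) => ?_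
    have h4 : (2 * (r ^ 2 / 2)) ^ (-(1 / 2) : ℝ) = r⁻¹ := by
      rw [mul_div_cancel₀ _ two_ne_zero, ← Real.rpow_natCast, ← Real.rpow_mul hr.le,
        ← Real.rpow_neg_one]
      norm_num
    have h5 : 0 < r ^ 2 / 2 := by positivity
    simp only [hm, halfCutoff, h5, if_true, h4]
    field_simp
  all_goals
    have hnear : ∀ᶠ t : ℝ in 𝓝[≠] 0, modelTerm 1 k t = m (τ * t) := by
      filter_upwards [eventually_abs_lt one_pos] with t ht
      have h1 : |τ * t| ≤ 1 := by
        rcases hτ with rfl | rfl <;> simpa using ht.le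
      have hk' : modelTerm 1 k t = (2 * Real.pi) ^ ((1 : ℝ) / 2) / Real.Gamma (1 / 2) *
          ((τ * t) ^ (-(1 / 2) : ℝ) * heavisideStep (τ * t)) := by
        rcases hτ with rfl | rfl
        · norm_num at hk
          subst hk
          simp [modelTerm]
          norm_num
        · norm_num at hk
          subst hk
          simp [modelTerm]
          norm_num
      rw [hk']
      by_cases h0 : 0 < τ * t
      · have h2 : (2 * Real.pi) ^ ((1 : ℝ) / 2) / Real.Gamma (1 / 2) =
            2 * (2 : ℝ) ^ (-(1 / 2) : ℝ) := by
          rw [Real.Gamma_one_half_eq, ← Real.sqrt_eq_rpow, Real.rpow_neg (by norm_num),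
            ← Real.sqrt_eq_rpow, Real.sqrt_mul (by norm_num)]
          have := Real.sqrt_ne_zero'.2 Real.pi_pos
          have h2 : √(2 : ℝ) ≠ 0 := by positivity
          field_simp
          norm_num
        simp only [hm, halfCutoff, h0, if_true, lineCutoff_one h1, heavisideStep,
          Real.mul_rpow (by norm_num : (0 : ℝ) ≤ 2) h0.le, h2]
        ring
      · simp [hm, halfCutoff, h0, heavisideStep]
  · have hc : ContNear fun t : ℝ => (if 0 < τ * t then 1 else 0) *
        (2 * (2 * (τ * t)) ^ (-(1 / 2) : ℝ)) := by
      filter_upwards [self_mem_nhdsWithin] with t (ht : t ≠ 0)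
      have hτt : τ * t ≠ 0 := mul_ne_zero hτ0 ht
      have hcont : Continuous fun t => τ * t := by fun_prop
      refine ContinuousAt.mul ?_ (continuousAt_const.mul (ContinuousAt.rpow_const (by fun_prop)
        (Or.inl (mul_ne_zero two_ne_zero hτt))))
      rcases lt_or_gt_of_ne hτt with h | h
      · refine (continuousAt_const (y := (0 : ℝ))).congr ?_
        filter_upwards [(isOpen_Iio.preimage hcont).mem_nhds h] with s (hs : τ * s < 0)
        simp [hs.le]
      · refine (continuousAt_const (y := (1 : ℝ))).congr ?_
        filter_upwards [(isOpen_Ioi.preimage hcont).mem_nhds h] with s (hs : 0 < τ * s)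
        simp [hs]
    refine hc.congr ?_
    filter_upwards [eventually_abs_lt one_pos] with t ht
    have h1 : |τ * t| ≤ 1 := by
      rcases hτ with rfl | rfl <;> simpa using ht.le
    simp [hm, halfCutoff, lineCutoff_one h1]
  · refine (polyMod_const _ 0).congr (hnear.mono fun t ht => ?_)
    beta_reduce
    rw [ht, sub_self]

/-- The integrand of the density of the product `a b / 2` with weight
`½ lineCutoff a * lineCutoff b`. -/
lemma integrable_lineCutoff_mul_div :
    Integrable (fun p : ℝ × ℝ => lineCutoff p.1 * |p.1|⁻¹ * lineCutoff (2 * p.2 / p.1))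
      (volume.prod volume) := by
  have hm : Measurable lineCutoff := contDiff_lineCutoff.continuous.measurable
  have hmeas : AEStronglyMeasurable
      (fun p : ℝ × ℝ => lineCutoff p.1 * |p.1|⁻¹ * lineCutoff (2 * p.2 / p.1))
      (volume.prod volume) := by
    apply Measurable.aestronglyMeasurable
    refine ((hm.comp measurable_fst).mul (measurable_fst.abs.inv)).mul (hm.comp ?_)
    exact (measurable_snd.const_mul 2).div measurable_fst
  have hscale : ∀ a : ℝ, a ≠ 0 → ∀ t : ℝ, 2 * t / a = (2 / a) * t := fun a _ t => by ring
  refine (integrable_prod_iff hmeas).2 ⟨Eventually.of_forall fun a => ?_, ?_⟩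
  · by_cases ha : a = 0
    · simp [ha]
    · simp_rw [hscale a ha]
      exact (integrable_lineCutoff.comp_mul_left' (div_ne_zero two_ne_zero ha)).const_mul _
  · have h1 : ∀ᵐ a : ℝ, lineCutoff a * (1 / 2 * ∫ s, lineCutoff s) =
        ∫ t, ‖lineCutoff a * |a|⁻¹ * lineCutoff (2 * t / a)‖ := by
      filter_upwards [Measure.ae_ne volume 0] with a ha
      simp_rw [hscale a ha, norm_mul]
      rw [integral_const_mul]
      have h2 : ∀ s, ‖lineCutoff s‖ = lineCutoff s := fun s =>
        Real.norm_of_nonneg (lineCutoff_nonneg s)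
      simp_rw [h2]
      rw [Measure.integral_comp_mul_left, smul_eq_mul, norm_inv, Real.norm_eq_abs, abs_abs,
        inv_div, abs_div, abs_two]
      have : |a| ≠ 0 := abs_ne_zero.2 ha
      field_simp
    exact (integrable_lineCutoff.mul_const _).congr h1

lemma integral_lineCutoff_mul_div {c : ℝ} (hc : 0 < c) (hc1 : c < 1) :
    ∫ a in Set.Ioi (0 : ℝ), lineCutoff a * a⁻¹ * lineCutoff (c / a) =
      -Real.log c + 2 * ∫ a in (1 : ℝ)..2, lineCutoff a * a⁻¹ := by
  have hc2 : 0 < c / 2 := by positivity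
  have hc3 : c / 2 < 2 := by linarith
  have hcont := contDiff_lineCutoff.continuous
  have h1 : ∫ a in Set.Ioi (0 : ℝ), lineCutoff a * a⁻¹ * lineCutoff (c / a) =
      ∫ a in (c / 2)..2, (lineCutoff a * a⁻¹ + lineCutoff (c / a) * a⁻¹ - a⁻¹) := by
    rw [intervalIntegral.integral_of_le hc3.le, ← integral_indicator measurableSet_Ioi,
      ← integral_indicator measurableSet_Ioc]
    congr 1
    ext a
    by_cases h0 : 0 < a
    · by_cases h2 : a ∈ Set.Ioc (c / 2) 2
      · rw [Set.indicator_of_mem (show a ∈ Set.Ioi 0 from h0), Set.indicator_of_mem h2]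
        -- at least one of the two cutoffs equals `1`
        rcases le_total a 1 with ha | ha
        · rw [lineCutoff_one (abs_le.2 ⟨by linarith, ha⟩)]
          ring
        · have : c / a ≤ 1 := (div_le_one h0).2 (by linarith)
          rw [lineCutoff_one (s := c / a) (abs_le.2 ⟨by linarith [div_pos hc h0], this⟩)]
          ring
      · rw [Set.indicator_of_mem (show a ∈ Set.Ioi 0 from h0), Set.indicator_of_notMem h2]
        rw [Set.mem_Ioc, not_and_or, not_lt, not_le] at h2
        rcases h2 with h2 | h2
        · have : 2 ≤ c / a := (le_div_iff₀ h0).2 (by linarith)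
          rw [lineCutoff_zero (s := c / a) (this.trans (le_abs_self _)), mul_zero]
        · rw [lineCutoff_zero (s := a) (h2.le.trans (le_abs_self _)), zero_mul, zero_mul]
    · rw [Set.indicator_of_notMem (show a ∉ Set.Ioi 0 from h0), Set.indicator_of_notMem]
      exact fun h => h0 (hc2.trans h.1)
  have hne : ∀ x y : ℝ, 0 < x → 0 < y → ∀ a ∈ Set.uIcc x y, a ≠ 0 := by
    intro x y hx hy a ha h0
    rw [Set.uIcc, Set.mem_Icc] at ha
    have := lt_min hx hy
    linarith [ha.1]
  have hinv : ∀ x y : ℝ, 0 < x → 0 < y → ContinuousOn (fun a : ℝ => a⁻¹) (Set.uIcc x y) :=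
    fun x y hx hy => continuousOn_id.inv₀ (hne x y hx hy)
  have hcut : ∀ x y : ℝ, 0 < x → 0 < y →
      IntervalIntegrable (fun a : ℝ => lineCutoff a * a⁻¹) volume x y :=
    fun x y hx hy => (hcont.continuousOn.mul (hinv x y hx hy)).intervalIntegrable
  have hdiv : ContinuousOn (fun a : ℝ => lineCutoff (c / a)) (Set.uIcc (c / 2) 2) :=
    hcont.comp_continuousOn (continuousOn_const.div continuousOn_id (hne _ _ hc2 two_pos))
  -- the substitution `b = c / a`
  have h2 : ∫ a in (c / 2)..2, lineCutoff (c / a) * a⁻¹ =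
      ∫ a in (c / 2)..2, lineCutoff a * a⁻¹ := by
    have hd : ∀ a ∈ Set.uIcc (c / 2) 2, HasDerivAt (fun a => c / a) (-(c / a ^ 2)) a := by
      intro a ha
      have := (hasDerivAt_inv (hne _ _ hc2 two_pos a ha)).const_mul c
      simp only [← div_eq_mul_inv] at this
      refine this.congr_deriv ?_
      ring
    have h3 := intervalIntegral.integral_comp_mul_deriv'' (f := fun a => c / a)
      (f' := fun a => -(c / a ^ 2)) (g := fun b => lineCutoff b * b⁻¹) (a := c / 2) (b := 2)
      (fun a ha => (hd a ha).continuousAt.continuousWithinAt)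
      (fun a ha => (hd a (Set.mem_Icc_of_Ioo ha)).hasDerivWithinAt) ?_ ?_
    · rw [div_div_cancel₀ hc.ne'] at h3
      rw [intervalIntegral.integral_symm 2 (c / 2) (f := fun a => lineCutoff a * a⁻¹), ← h3,
        ← intervalIntegral.integral_neg]
      refine intervalIntegral.integral_congr fun a ha => ?_
      have := hne _ _ hc2 two_pos a ha
      simp only [Function.comp_apply]
      field_simp
    · refine (continuousOn_const.div (continuousOn_id.pow 2) fun a ha => ?_).neg
      exact pow_ne_zero 2 (hne _ _ hc2 two_pos a ha)
    · refine hcont.continuousOn.mul (continuousOn_id.inv₀ ?_)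
      rintro _ ⟨a, ha, rfl⟩
      exact div_ne_zero hc.ne' (hne _ _ hc2 two_pos a ha)
  have h3 : ∫ a in (c / 2)..2, lineCutoff a * a⁻¹ =
      -Real.log (c / 2) + ∫ a in (1 : ℝ)..2, lineCutoff a * a⁻¹ := by
    rw [← intervalIntegral.integral_add_adjacent_intervals (hcut _ 1 hc2 one_pos)
      (hcut 1 2 one_pos two_pos)]
    congr 1
    have : ∫ a in (c / 2)..1, lineCutoff a * a⁻¹ = ∫ a in (c / 2)..1, a⁻¹ := by
      refine intervalIntegral.integral_congr fun a ha => ?_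
      rw [Set.uIcc_of_le (by linarith), Set.mem_Icc] at ha
      rw [lineCutoff_one (abs_le.2 ⟨by linarith, ha.2⟩), one_mul]
    rw [this, integral_inv_of_pos hc2 one_pos, one_div, Real.log_inv]
  rw [h1, intervalIntegral.integral_sub, intervalIntegral.integral_add, h2, h3,
    integral_inv_of_pos hc2 two_pos, Real.log_div two_ne_zero hc2.ne',
    Real.log_div hc.ne' two_ne_zero]
  · ring
  · exact hcut _ _ hc2 two_pos
  · exact (hdiv.mul (hinv _ _ hc2 two_pos)).intervalIntegrable
  · exact (hcut _ _ hc2 two_pos).add (hdiv.mul (hinv _ _ hc2 two_pos)).intervalIntegrable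
  · exact (hinv _ _ hc2 two_pos).intervalIntegrable

/-- The saddle of two variables, in the coordinates `a = x - y`, `b = x + y`. -/
lemma hasModelWeight_two_one : HasModelWeight 2 1 := by
  have hcont := contDiff_lineCutoff.continuous
  have hws : ContDiff ℝ ∞ fun x : Fin 2 → ℝ => lineCutoff (x 0 - x 1) * lineCutoff (x 0 + x 1) :=
    (contDiff_lineCutoff.comp (by fun_prop)).mul (contDiff_lineCutoff.comp (by fun_prop))
  have hbd : ∀ a b : ℝ, lineCutoff a * lineCutoff b ≠ 0 → |a| < 2 ∧ |b| < 2 := fun a b h =>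
    ⟨not_le.1 fun hle => h (by rw [lineCutoff_zero hle, zero_mul]),
      not_le.1 fun hle => h (by rw [lineCutoff_zero hle, mul_zero])⟩
  have hwc : HasCompactSupport fun x : Fin 2 → ℝ =>
      lineCutoff (x 0 - x 1) * lineCutoff (x 0 + x 1) := by
    refine HasCompactSupport.intro (isCompact_closedBall (0 : Fin 2 → ℝ) 2) fun x hx => ?_
    by_contra hne
    apply hx
    obtain ⟨h1, h2⟩ := hbd _ _ hne
    rw [abs_lt] at h1 h2
    rw [mem_closedBall_zero_iff, pi_norm_le_iff_of_nonneg (by norm_num), Fin.forall_fin_two]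
    exact ⟨abs_le.2 ⟨by linarith, by linarith⟩, abs_le.2 ⟨by linarith, by linarith⟩⟩
  have hint := integrable_lineCutoff_mul_div
  have hsupp : ∀ a t : ℝ, lineCutoff a * |a|⁻¹ * lineCutoff (2 * t / a) ≠ 0 → |t| ≤ 2 := by
    intro a t h
    have ha : a ≠ 0 := by
      rintro rfl
      simp at h
    obtain ⟨h1, h2⟩ := hbd a (2 * t / a) fun h0 => h (by
      rw [mul_right_comm, h0, zero_mul])
    rw [abs_div, div_lt_iff₀ (abs_pos.2 ha), abs_mul, abs_two] at h2
    nlinarith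
  set ρ : ℝ → ℝ := fun t => ∫ a, lineCutoff a * |a|⁻¹ * lineCutoff (2 * t / a) with hρ
  set C : ℝ := 2 * (2 * ∫ a in (1 : ℝ)..2, lineCutoff a * a⁻¹) - 2 * Real.log 2
  have hnear : ∀ᶠ t : ℝ in 𝓝[≠] 0, -2 * Real.log t + C = ρ t := by
    filter_upwards [eventually_abs_lt (δ := 1 / 2) (by norm_num), self_mem_nhdsWithin]
      with t ht (ht0 : t ≠ 0)
    have ht1 : 0 < |t| := abs_pos.2 ht0
    have h1 : ∀ a : ℝ, lineCutoff a * |a|⁻¹ * lineCutoff (2 * t / a) =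
        lineCutoff |a| * |a|⁻¹ * lineCutoff (2 * |t| / |a|) := by
      intro a
      rw [lineCutoff_abs, ← lineCutoff_abs (2 * t / a), abs_div, abs_mul, abs_two]
    simp only [hρ, h1]
    rw [integral_comp_abs (f := fun a => lineCutoff a * a⁻¹ * lineCutoff (2 * |t| / a)),
      integral_lineCutoff_mul_div (by positivity) (by linarith),
      Real.log_mul two_ne_zero ht1.ne', Real.log_abs]
    ring
  refine ⟨![1, -1], ?_, ?_, _, hws, hwc, ?_, ρ, ⟨hint.integral_prod_right, ⟨2, fun t ht => ?_⟩,
    fun g hg => ?_⟩, ?_, ?_⟩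
  · rw [Fin.forall_fin_two]
    simp
  · rw [Fin.sum_univ_two]
    norm_num
  · simp [lineCutoff_one]
  · refine integral_eq_zero_of_ae (Eventually.of_forall fun a => ?_)
    by_contra h
    exact absurd ht (not_lt.2 (hsupp a t h))
  · have hF : Continuous fun p : ℝ × ℝ => lineCutoff (p.1 - p.2) * lineCutoff (p.1 + p.2) *
        g ((p.1 ^ 2 - p.2 ^ 2) / 2) := by fun_prop
    have hFi : Integrable (fun p : ℝ × ℝ => lineCutoff (p.1 - p.2) * lineCutoff (p.1 + p.2) *
        g ((p.1 ^ 2 - p.2 ^ 2) / 2)) (volume.prod volume) := by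
      refine hF.integrable_of_hasCompactSupport
        (HasCompactSupport.intro (isCompact_closedBall (0 : ℝ × ℝ) 2) fun p hp => ?_)
      by_contra hne
      apply hp
      obtain ⟨h1, h2⟩ := hbd _ _ (left_ne_zero_of_mul hne)
      rw [abs_lt] at h1 h2
      rw [mem_closedBall_zero_iff, Prod.norm_def]
      exact max_le (abs_le.2 ⟨by linarith, by linarith⟩) (abs_le.2 ⟨by linarith, by linarith⟩)
    have hG : Continuous fun p : ℝ × ℝ => lineCutoff p.2 * lineCutoff (p.2 + 2 * p.1) *
        g (p.2 * (p.2 + 2 * p.1) / 2) := by fun_prop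
    have hGi : Integrable (fun p : ℝ × ℝ => lineCutoff p.2 * lineCutoff (p.2 + 2 * p.1) *
        g (p.2 * (p.2 + 2 * p.1) / 2)) (volume.prod volume) := by
      refine hG.integrable_of_hasCompactSupport
        (HasCompactSupport.intro (isCompact_closedBall (0 : ℝ × ℝ) 2) fun p hp => ?_)
      by_contra hne
      apply hp
      obtain ⟨h1, h2⟩ := hbd _ _ (left_ne_zero_of_mul hne)
      rw [abs_lt] at h1 h2
      rw [mem_closedBall_zero_iff, Prod.norm_def]
      exact max_le (abs_le.2 ⟨by linarith, by linarith⟩) (abs_le.2 ⟨by linarith, by linarith⟩)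
    have hgi : Integrable (fun p : ℝ × ℝ =>
        lineCutoff p.1 * |p.1|⁻¹ * lineCutoff (2 * p.2 / p.1) * g p.2) (volume.prod volume) :=
      Integrable.mul_comp_of_bounded hint measurable_snd (fun p hp => hsupp p.1 p.2 hp) hg
    -- for fixed `a ≠ 0`, substitute `t = a b / 2` with `b = a + 2 y`
    have hsub : ∀ a : ℝ, a ≠ 0 → ∫ y, lineCutoff a * lineCutoff (a + 2 * y) *
        g (a * (a + 2 * y) / 2) =
        ∫ t, lineCutoff a * |a|⁻¹ * lineCutoff (2 * t / a) * g t := by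
      intro a ha
      have h1 := integral_add_left_eq_self (μ := volume)
        (fun y => lineCutoff a * lineCutoff (2 * y) * g (a * (2 * y) / 2)) (a / 2)
      have h2 := Measure.integral_comp_mul_left
        (fun t => lineCutoff a * lineCutoff (2 * t / a) * g t) a
      calc _ = ∫ y, lineCutoff a * lineCutoff (2 * (a / 2 + y)) *
            g (a * (2 * (a / 2 + y)) / 2) := by
              congr 1
              ext y
              rw [mul_add 2, mul_div_cancel₀ _ two_ne_zero]
        _ = ∫ y, lineCutoff a * lineCutoff (2 * y) * g (a * (2 * y) / 2) := h1
        _ = ∫ y, lineCutoff a * lineCutoff (2 * (a * y) / a) * g (a * y) := by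
              congr 1
              ext y
              congr 2
              · congr 1
                field_simp
              · ring
        _ = _ := by
              rw [h2, smul_eq_mul, ← integral_const_mul, abs_inv]
              congr 1
              ext t
              ring
    rw [integral_fin_two]
    calc _ = ∫ p : ℝ × ℝ, lineCutoff (p.1 - p.2) * lineCutoff (p.1 + p.2) *
          g ((p.1 ^ 2 - p.2 ^ 2) / 2) := by
            congr 1
            ext p
            rw [Fin.sum_univ_two]
            simp only [Matrix.cons_val_zero, Matrix.cons_val_one]
            congr 2
            ring
      _ = ∫ y, ∫ x, lineCutoff (x - y) * lineCutoff (x + y) * g ((x ^ 2 - y ^ 2) / 2) := by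
            rw [Measure.volume_eq_prod, integral_prod_symm _ hFi]
      _ = ∫ y, ∫ a, lineCutoff a * lineCutoff (a + 2 * y) * g (a * (a + 2 * y) / 2) := by
            congr 1
            ext y
            rw [← integral_add_right_eq_self (μ := volume)
              (fun x => lineCutoff (x - y) * lineCutoff (x + y) * g ((x ^ 2 - y ^ 2) / 2)) y]
            congr 1
            ext a
            ring_nf
      _ = ∫ a, ∫ y, lineCutoff a * lineCutoff (a + 2 * y) * g (a * (a + 2 * y) / 2) :=
            integral_integral_swap (f := fun y a => lineCutoff a * lineCutoff (a + 2 * y) *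
              g (a * (a + 2 * y) / 2)) hGi
      _ = ∫ a, ∫ t, lineCutoff a * |a|⁻¹ * lineCutoff (2 * t / a) * g t := by
            apply integral_congr_ae
            filter_upwards [Measure.ae_ne volume 0] with a ha
            exact hsub a ha
      _ = ∫ t, ∫ a, lineCutoff a * |a|⁻¹ * lineCutoff (2 * t / a) * g t :=
            integral_integral_swap
              (f := fun a t => lineCutoff a * |a|⁻¹ * lineCutoff (2 * t / a) * g t) hgi
      _ = _ := by simp_rw [integral_mul_const, hρ]
  · have hc : ContNear fun t => -2 * Real.log t + C := by
      filter_upwards [self_mem_nhdsWithin] with t (ht : t ≠ 0)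
      exact (continuousAt_const.mul (Real.continuousAt_log ht)).add continuousAt_const
    exact hc.congr hnear
  · refine (polyMod_const _ C).congr (hnear.mono fun t ht => ?_)
    beta_reduce
    rw [← ht]
    simp [modelTerm]
    field_simp
    ring

/-- Every signature has a reference weight: the signatures with `N ≤ 2` are explicit, and squares
are added in pairs of equal sign. -/
theorem hasModelWeight {N k : ℕ} (hN : 0 < N) (hk : k ≤ N) : HasModelWeight N k := by
  induction N using Nat.strong_induction_on generalizing k with
  | _ N ih =>
    rcases Nat.lt_or_ge 2 N with h2 | h2
    · obtain ⟨n, rfl⟩ : ∃ n, N = n + 2 := ⟨N - 2, by omega⟩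
      have hn : 0 < n := by omega
      by_cases hkn : k ≤ n
      · refine (ih n (by omega) hn hkn).add_two hn (τ := 1) (Or.inl rfl) (by norm_num) fun s => ?_
        simpa using (polyMod_modelTerm_add_two hn hkn s).1
      · obtain ⟨k, rfl⟩ : ∃ k', k = k' + 2 := ⟨k - 2, by omega⟩
        have hkn' : k ≤ n := by omega
        refine (ih n (by omega) hn hkn').add_two hn (τ := -1) (Or.inr rfl)
          (by norm_num; omega) fun s => ?_
        simpa using (polyMod_modelTerm_add_two hn hkn' s).2
    · interval_cases N
      · interval_cases k
        · exact hasModelWeight_one (Or.inl rfl) (by norm_num)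
        · exact hasModelWeight_one (Or.inr rfl) (by norm_num)
      · interval_cases k
        · exact hasModelWeight_two (Or.inl rfl) (by norm_num)
        · exact hasModelWeight_two_one
        · exact hasModelWeight_two (Or.inr rfl) (by norm_num)

/-! ### The Morse lemma -/

section

variable {E : Type*} [NormedAddCommGroup E] [NormedSpace ℝ E]

lemma contDiff_one_sub_smul {F : Type*} [NormedAddCommGroup F] [NormedSpace ℝ F] {D : E → F}
    (hD : ContDiff ℝ ∞ D) : ContDiff ℝ ∞ fun p : E × ℝ => (1 - p.2) • D (p.2 • p.1) :=
  (contDiff_const.sub contDiff_snd).smul (hD.comp (contDiff_snd.smul contDiff_fst))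

lemma integral_one_sub_smul_const {F : Type*} [NormedAddCommGroup F] [NormedSpace ℝ F]
    [CompleteSpace F] (c : F) : ∫ t in (0 : ℝ)..1, (1 - t) • c = (1 / 2 : ℝ) • c := by
  rw [intervalIntegral.integral_smul_const, intervalIntegral.integral_sub (by simp) (by simp)]
  norm_num

/-- Taylor's formula of second order with remainder `A q q q`, where `A` is a smooth family of
symmetric bilinear forms. -/
lemma exists_eq_bilin_of_fderiv_eq_zero {V : E → ℝ} (hV : ContDiff ℝ ∞ V) (h0 : V 0 = 0)
    (h1 : fderiv ℝ V 0 = 0) :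
    ∃ A : E → E →L[ℝ] E →L[ℝ] ℝ, ContDiff ℝ ∞ A ∧ (∀ q, V q = A q q q) ∧
      (∀ q x y, A q x y = A q y x) ∧ A 0 = (1 / 2 : ℝ) • fderiv ℝ (fderiv ℝ V) 0 := by
  set D := fderiv ℝ (fderiv ℝ V) with hD
  have hd1 : ContDiff ℝ ∞ (fderiv ℝ V) := hV.fderiv_right (by simp)
  have hDs : ContDiff ℝ ∞ D := hd1.fderiv_right (by simp)
  have hsymm : ∀ q x y, D q x y = D q y x := fun q x y =>
    (hV.contDiffAt.isSymmSndFDerivAt (x := q)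
      (by simpa using WithTop.coe_le_coe.2 (le_top : (2 : ℕ∞) ≤ ⊤))).eq x y
  have hcont : ∀ q, Continuous fun t : ℝ => (1 - t) • D (t • q) := fun q =>
    (continuous_const.sub continuous_id).smul (hDs.continuous.comp (by fun_prop))
  have happ : ∀ q x y, (∫ t in (0 : ℝ)..1, (1 - t) • D (t • q)) x y =
      ∫ t in (0 : ℝ)..1, (1 - t) * D (t • q) x y := by
    intro q x y
    rw [ContinuousLinearMap.intervalIntegral_apply ((hcont q).intervalIntegrable _ _),
      ContinuousLinearMap.intervalIntegral_apply
        (((hcont q).clm_apply continuous_const).intervalIntegrable _ _)]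
    rfl
  refine ⟨fun q => ∫ t in (0 : ℝ)..1, (1 - t) • D (t • q), contDiff_integral_zero_one ?_,
    fun q => ?_, fun q x y => ?_, ?_⟩
  · exact contDiff_one_sub_smul hDs
  · have hline : ∀ t : ℝ, HasDerivAt (fun t : ℝ => t • q) q t := fun t => by
      simpa using (hasDerivAt_id t).smul_const q
    have hd : ∀ t : ℝ, HasDerivAt (fun t : ℝ => V (t • q) + (1 - t) * fderiv ℝ V (t • q) q)
        ((1 - t) * D (t • q) q q) t := by
      intro t
      have e1 : HasDerivAt (fun t : ℝ => V (t • q)) (fderiv ℝ V (t • q) q) t :=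
        ((hV.differentiable (by simp)).differentiableAt.hasFDerivAt).comp_hasDerivAt t (hline t)
      have e2 : HasDerivAt (fun t : ℝ => fderiv ℝ V (t • q)) (D (t • q) q) t :=
        ((hd1.differentiable (by simp)).differentiableAt.hasFDerivAt).comp_hasDerivAt t (hline t)
      have e3 : HasDerivAt (fun t : ℝ => fderiv ℝ V (t • q) q) (D (t • q) q q) t := by
        simpa using e2.clm_apply (hasDerivAt_const t q)
      refine (e1.add (((hasDerivAt_const t (1 : ℝ)).sub (hasDerivAt_id t)).mul e3)).congr_deriv ?_
      simp
    have h2 := intervalIntegral.integral_eq_sub_of_hasDerivAt (a := 0) (b := 1)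
      (fun t _ => hd t) (Continuous.intervalIntegrable ?_ _ _)
    · rw [happ, h2]
      simp [h0, h1]
    · exact (continuous_const.sub continuous_id).mul
        (((hDs.continuous.comp (by fun_prop)).clm_apply continuous_const).clm_apply
          continuous_const)
  · rw [happ, happ]
    simp_rw [hsymm _ x y]
  · simp only [smul_zero]
    exact integral_one_sub_smul_const _

/-- The square root near `1` of a Banach algebra, as the local inverse of squaring. -/
lemma exists_local_sqrt (𝔸 : Type*) [NormedRing 𝔸] [NormedAlgebra ℝ 𝔸] [CompleteSpace 𝔸] :
    ∃ e : OpenPartialHomeomorph 𝔸 𝔸, (∀ x, e x = x * x) ∧ 1 ∈ e.source ∧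
      ContDiffAt ℝ ω e.symm 1 := by
  have hs : ContDiffAt ℝ ω (fun x : 𝔸 => x * x) 1 := contDiffAt_id.mul contDiffAt_id
  let L : 𝔸 ≃L[ℝ] 𝔸 := ContinuousLinearEquiv.smulLeft (Units.mk0 (2 : ℝ) two_ne_zero)
  have hd : HasFDerivAt (fun x : 𝔸 => x * x) (L : 𝔸 →L[ℝ] 𝔸) 1 := by
    refine ((hasFDerivAt_id (1 : 𝔸)).mul' (hasFDerivAt_id (1 : 𝔸))).congr_fderiv ?_
    ext x
    simp [L, two_smul]
  have hmem := hs.mem_toOpenPartialHomeomorph_source hd (by simp)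
  refine ⟨hs.toOpenPartialHomeomorph _ hd (by simp), fun x => rfl, hmem, ?_⟩
  set e := hs.toOpenPartialHomeomorph _ hd (by simp) with he
  have he1 : e 1 = 1 := by simp [he]
  have hsymm : e.symm 1 = 1 := by
    have := e.left_inv hmem
    rwa [he1] at this
  refine e.contDiffAt_symm (f₀' := L) ?_ ?_ ?_
  · have := e.map_source hmem
    rwa [he1] at this
  · rw [hsymm]
    exact hd
  · rw [hsymm]
    exact hs

variable [FiniteDimensional ℝ E]

/-- **Morse lemma**: near a nondegenerate stationary point there are smooth coordinates, tangent to
the identity, in which the function is its second-order Taylor polynomial.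

In Taylor's formula `V q = A q q q` write `A q = A 0 ∘ T q`; the coordinates are `√(T q) q`, because
`√(T q)` is self-adjoint for the form `A 0`. -/
theorem exists_morse_chart {V : E → ℝ} (hV : ContDiff ℝ ∞ V) (h0 : V 0 = 0)
    (h1 : fderiv ℝ V 0 = 0) (hnd : ∀ x, fderiv ℝ (fderiv ℝ V) 0 x = 0 → x = 0) :
    ∃ f : OpenPartialHomeomorph E E, 0 ∈ f.source ∧ f 0 = 0 ∧ fderiv ℝ f 0 = .id ℝ E ∧
      (∀ q ∈ f.source, ContDiffAt ℝ ∞ f q) ∧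
      (∀ q ∈ f.source, ∃ L : E ≃L[ℝ] E, HasFDerivAt f (L : E →L[ℝ] E) q) ∧
      ∀ q ∈ f.source, V q = 1 / 2 * fderiv ℝ (fderiv ℝ V) 0 (f q) (f q) := by
  obtain ⟨A, hA, hAV, hAsymm, hA0⟩ := exists_eq_bilin_of_fderiv_eq_zero hV h0 h1
  have hinj : Function.Injective (A 0 : E →ₗ[ℝ] E →L[ℝ] ℝ) := by
    rw [injective_iff_map_eq_zero]
    intro x hx
    apply hnd
    have : (1 / 2 : ℝ) • fderiv ℝ (fderiv ℝ V) 0 x = 0 := by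
      rw [← _root_.smul_apply, ← hA0]
      exact hx
    simpa using this
  have hdim : Module.finrank ℝ E = Module.finrank ℝ (E →L[ℝ] ℝ) := by
    rw [← (LinearMap.toContinuousLinearMap (𝕜 := ℝ) (E := E) (F' := ℝ)).finrank_eq]
    exact (Subspace.dual_finrank_eq (K := ℝ) (V := E)).symm
  let A₀ : E ≃L[ℝ] (E →L[ℝ] ℝ) :=
    (LinearEquiv.ofInjectiveOfFinrankEq _ hinj hdim).toContinuousLinearEquiv
  have hA₀ : ∀ x, A₀ x = A 0 x := fun x => rfl
  have hA₀symm : ∀ x y, A₀ x y = A₀ y x := fun x y => hAsymm 0 x y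
  have hext : ∀ x x', (∀ y, A₀ x y = A₀ x' y) → x = x' := fun x x' h =>
    A₀.injective (ContinuousLinearMap.ext h)
  -- `A q = A₀ ∘ T q`
  set T : E → E →L[ℝ] E := fun q => (A₀.symm : (E →L[ℝ] ℝ) →L[ℝ] E).comp (A q) with hT
  have hTs : ContDiff ℝ ∞ T := contDiff_const.clm_comp hA
  have hT0 : T 0 = 1 := by
    ext x
    simp only [hT, ContinuousLinearMap.comp_apply]
    rw [← hA₀]
    exact A₀.symm_apply_apply x
  have hTA : ∀ q x y, A₀ (T q x) y = A q x y := fun q x y => by simp [hT]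
  -- the adjoint for the form `A₀`
  set adj : (E →L[ℝ] E) → E →L[ℝ] E := fun X =>
    (A₀.symm : (E →L[ℝ] ℝ) →L[ℝ] E).comp ((A₀ : E →L[ℝ] E →L[ℝ] ℝ).comp X).flip with hadj
  have hadjA : ∀ X x y, A₀ (adj X x) y = A₀ (X y) x := fun X x y => by simp [hadj]
  have hadjc : Continuous adj := by
    have h2 : Continuous fun X : E →L[ℝ] E => ((A₀ : E →L[ℝ] E →L[ℝ] ℝ).comp X).flip :=
      (ContinuousLinearMap.flipₗᵢ ℝ E E ℝ).continuous.comp (continuous_const.clm_comp continuous_id)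
    exact continuous_const.clm_comp h2
  have hadj1 : adj 1 = 1 := by
    ext x
    refine hext _ _ fun y => ?_
    rw [hadjA]
    exact hA₀symm y x
  have hadjsq : ∀ X, adj X * adj X = adj (X * X) := by
    intro X
    ext x
    refine hext _ _ fun y => ?_
    rw [mul_apply_eq_comp, hadjA, hadjA, hA₀symm, hadjA]
    rfl
  have hadjT : ∀ q, adj (T q) = T q := by
    intro q
    ext x
    refine hext _ _ fun y => ?_
    rw [hadjA, hTA, hTA, hAsymm]
  obtain ⟨e, he, he1, hes⟩ := exists_local_sqrt (E →L[ℝ] E)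
  have hee1 : e 1 = 1 := by rw [he, one_mul]
  have hesymm1 : e.symm 1 = 1 := by
    have := e.left_inv he1
    rwa [hee1] at this
  have ht1 : (1 : E →L[ℝ] E) ∈ e.target := by
    have := e.map_source he1
    rwa [hee1] at this
  have hT_tendsto : Tendsto T (𝓝 0) (𝓝 1) := by
    rw [← hT0]
    exact hTs.continuous.tendsto 0
  set B : E → E →L[ℝ] E := fun q => e.symm (T q) with hB
  have hB0 : B 0 = 1 := by rw [hB]; simp only [hT0, hesymm1]
  have hBs : ∀ᶠ q in 𝓝 (0 : E), ContDiffAt ℝ ∞ B q := by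
    have := hT_tendsto.eventually (hes.eventually (by simp))
    filter_upwards [this] with q hq
    exact (hq.of_le le_top).comp q hTs.contDiffAt
  have hBt : Tendsto B (𝓝 0) (𝓝 1) := by
    have := hBs.self_of_nhds.continuousAt.tendsto
    rwa [hB0] at this
  have hsq : ∀ᶠ q in 𝓝 (0 : E), B q * B q = T q := by
    filter_upwards [hT_tendsto.eventually (e.open_target.mem_nhds ht1)] with q hq
    rw [← he]
    exact e.right_inv hq
  have hself : ∀ᶠ q in 𝓝 (0 : E), adj (B q) = B q := by
    have h3 : Tendsto (fun q => adj (B q)) (𝓝 0) (𝓝 1) := by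
      have := (hadjc.tendsto 1).comp hBt
      rwa [hadj1] at this
    filter_upwards [hsq, h3.eventually (e.open_source.mem_nhds he1),
      hBt.eventually (e.open_source.mem_nhds he1)] with q hq hq2 hq3
    refine e.injOn hq2 hq3 ?_
    rw [he, he, hadjsq, hq, hadjT]
  set f₀ : E → E := fun q => B q q with hf₀
  have hf₀s : ∀ᶠ q in 𝓝 (0 : E), ContDiffAt ℝ ∞ f₀ q := by
    filter_upwards [hBs] with q hq
    exact hq.clm_apply contDiffAt_id
  have hf₀d : HasFDerivAt f₀ ((ContinuousLinearEquiv.refl ℝ E : E ≃L[ℝ] E) : E →L[ℝ] E) 0 := by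
    have h3 := (hBs.self_of_nhds.differentiableAt (by simp)).hasFDerivAt
    refine (h3.clm_apply (hasFDerivAt_id 0)).congr_fderiv ?_
    ext x
    simp [hB0]
  have hV2 : ∀ᶠ q in 𝓝 (0 : E), V q = 1 / 2 * fderiv ℝ (fderiv ℝ V) 0 (f₀ q) (f₀ q) := by
    filter_upwards [hsq, hself] with q hq hq2
    have h3 : 1 / 2 * fderiv ℝ (fderiv ℝ V) 0 (f₀ q) (f₀ q) = A₀ (f₀ q) (f₀ q) := by
      rw [hA₀, hA0]
      simp
    rw [h3, hAV, ← hTA, ← hq]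
    change A₀ (B q (B q q)) q = A₀ (B q q) (B q q)
    rw [← hadjA, hq2, hA₀symm]
  have hinv : ∀ᶠ q in 𝓝 (0 : E), ∃ L : E ≃L[ℝ] E, HasFDerivAt f₀ (L : E →L[ℝ] E) q := by
    have h3 : ContinuousAt (fderiv ℝ f₀) 0 :=
      (hf₀s.self_of_nhds.fderiv_right (m := 0) (by simp)).continuousAt
    have h4 := h3.tendsto.eventually
      (by rw [hf₀d.fderiv]; exact ContinuousLinearEquiv.nhds _)
    filter_upwards [h4, hf₀s] with q hq hq2
    obtain ⟨L, hL⟩ := hq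
    refine ⟨L, ?_⟩
    rw [hL]
    exact (hq2.differentiableAt (by simp)).hasFDerivAt
  obtain ⟨U, hU, hUo, hU0⟩ := mem_nhds_iff.1 (hf₀s.and (hV2.and hinv))
  set F := hf₀s.self_of_nhds.toOpenPartialHomeomorph f₀ hf₀d (by simp) with hF
  have hF0 : (0 : E) ∈ F.source :=
    hf₀s.self_of_nhds.mem_toOpenPartialHomeomorph_source hf₀d (by simp)
  have hsrc : (F.restrOpen U hUo).source ⊆ U := fun q hq => by
    rw [OpenPartialHomeomorph.restrOpen_source] at hq
    exact hq.2
  refine ⟨F.restrOpen U hUo, ?_, ?_, hf₀d.fderiv, fun q hq => (hU (hsrc hq)).1,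
    fun q hq => (hU (hsrc hq)).2.2, fun q hq => (hU (hsrc hq)).2.1⟩
  · rw [OpenPartialHomeomorph.restrOpen_source]
    exact ⟨hF0, hU0⟩
  · change B 0 0 = 0
    simp

/-! ### Change of variables in weak densities -/

lemma contDiff_det {n : WithTop ℕ∞} : ContDiff ℝ n fun f : E →L[ℝ] E => f.det := by
  classical
  let b := Module.finBasis ℝ E
  have h : (fun f : E →L[ℝ] E => f.det) = fun f => ∑ σ : Equiv.Perm (Fin (Module.finrank ℝ E)),
      (Equiv.Perm.sign σ : ℝ) * ∏ i, b.coord (σ i) (f (b i)) := by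
    ext f
    rw [ContinuousLinearMap.det, ← LinearMap.det_toMatrix b, Matrix.det_apply']
    simp [LinearMap.toMatrix_apply]
  rw [h]
  refine ContDiff.sum fun σ _ => contDiff_const.mul (contDiff_prod fun i _ => ?_)
  exact (LinearMap.toContinuousLinearMap (b.coord (σ i))).contDiff.comp
    (contDiff_id.clm_apply contDiff_const)

/-- A weight supported in the domain of a smooth chart is transported by the chart. -/
theorem exists_transported_weight [MeasureSpace E] [BorelSpace E]
    [(volume : Measure E).IsAddHaarMeasure] (f : OpenPartialHomeomorph E E)
    (hf : ∀ q ∈ f.source, ContDiffAt ℝ ∞ f q)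
    (hf' : ∀ q ∈ f.source, ∃ L : E ≃L[ℝ] E, HasFDerivAt f (L : E →L[ℝ] E) q) {V Q : E → ℝ}
    (hVQ : ∀ q ∈ f.source, V q = Q (f q)) {w : E → ℝ} (hw : ContDiff ℝ ∞ w)
    (hwc : HasCompactSupport w) (hws : tsupport w ⊆ f.source) :
    ∃ a : E → ℝ, ContDiff ℝ ∞ a ∧ HasCompactSupport a ∧
      (∀ q ∈ f.source, a (f q) = w q / |(fderiv ℝ f q).det|) ∧
      ∀ g : ℝ → ℝ, ∫ q, w q * g (V q) = ∫ x, a x * g (Q x) := by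
  classical
  have hdet : ∀ q ∈ f.source, (fderiv ℝ f q).det ≠ 0 := by
    intro q hq
    obtain ⟨L, hL⟩ := hf' q hq
    rw [hL.fderiv]
    exact (LinearEquiv.isUnit_det' L.toLinearEquiv).ne_zero
  set a : E → ℝ := fun y =>
    if y ∈ f.target then w (f.symm y) / |(fderiv ℝ f (f.symm y)).det| else 0 with ha
  have haf : ∀ q ∈ f.source, a (f q) = w q / |(fderiv ℝ f q).det| := fun q hq => by
    simp [ha, f.map_source hq, f.left_inv hq]
  have hK : IsCompact (f '' tsupport w) :=
    hwc.isCompact.image_of_continuousOn (f.continuousOn.mono hws)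
  have ha0 : ∀ y ∉ f '' tsupport w, a y = 0 := by
    intro y hy
    by_cases hyt : y ∈ f.target
    · have : f.symm y ∉ tsupport w := fun h => hy ⟨_, h, f.right_inv hyt⟩
      simp [ha, image_eq_zero_of_notMem_tsupport this]
    · simp [ha, hyt]
  refine ⟨a, ?_, HasCompactSupport.intro hK ha0, haf, fun g => ?_⟩
  · rw [contDiff_iff_contDiffAt]
    intro y
    by_cases hy : y ∈ f '' tsupport w
    · obtain ⟨q, hq, rfl⟩ := hy
      have hq' := hws hq
      obtain ⟨L, hL⟩ := hf' q hq'
      have hsymm : ContDiffAt ℝ ∞ f.symm (f q) := by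
        refine f.contDiffAt_symm (f₀' := L) (f.map_source hq') ?_ ?_
        · rwa [f.left_inv hq']
        · rw [f.left_inv hq']
          exact hf q hq'
      have hfd : ContDiffAt ℝ ∞ (fun y => fderiv ℝ f (f.symm y)) (f q) := by
        refine ContDiffAt.comp (f q) (g := fderiv ℝ f) ?_ hsymm
        rw [f.left_inv hq']
        exact (hf q hq').fderiv_right (by simp)
      have hdet' : (fderiv ℝ f (f.symm (f q))).det ≠ 0 := by
        rw [f.left_inv hq']
        exact hdet q hq'
      have habs : ContDiffAt ℝ ∞ (fun y => |(fderiv ℝ f (f.symm y)).det|) (f q) :=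
        ContDiffAt.abs (contDiff_det.contDiffAt.comp (f q) hfd) hdet'
      refine ((hw.contDiffAt.comp (f q) hsymm).div habs (abs_ne_zero.2 hdet')).congr_of_eventuallyEq
        ?_
      filter_upwards [f.open_target.mem_nhds (f.map_source hq')] with y hy
      simp [ha, hy]
    · refine (contDiffAt_const (c := (0 : ℝ))).congr_of_eventuallyEq ?_
      filter_upwards [hK.isClosed.isOpen_compl.mem_nhds hy] with y hy
      exact ha0 y hy
  · have h1 := integral_image_eq_integral_abs_det_fderiv_smul volume f.open_source.measurableSet
      (fun q hq => ((hf q hq).differentiableAt (by simp)).hasFDerivAt.hasFDerivWithinAt) f.injOn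
      (fun y => a y * g (Q y))
    rw [setIntegral_eq_integral_of_forall_compl_eq_zero] at h1
    · rw [h1, ← setIntegral_eq_integral_of_forall_compl_eq_zero (s := f.source)]
      · refine setIntegral_congr_fun f.open_source.measurableSet fun q hq => ?_
        have := abs_ne_zero.2 (hdet q hq)
        simp only [haf q hq, hVQ q hq, smul_eq_mul]
        field_simp
      · intro q hq
        rw [image_eq_zero_of_notMem_tsupport fun h => hq (hws h), zero_mul]
    · intro y hy
      rw [ha0 y fun h => hy (Set.image_mono hws h), zero_mul]

end

/-! ### Diagonalizing the Hessian -/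

section

open Matrix

variable {N : ℕ} {H : Matrix (Fin N) (Fin N) ℝ}

lemma toQuadraticForm'_apply (H : Matrix (Fin N) (Fin N) ℝ) (x : Fin N → ℝ) :
    H.toQuadraticForm' x = x ⬝ᵥ H *ᵥ x := by
  simp [toQuadraticForm', toLinearMap₂'_apply']

lemma associated_toQuadraticForm' (hH : H.IsSymm) :
    QuadraticMap.associated (R := ℝ) H.toQuadraticForm' = toLinearMap₂' ℝ H := by
  refine QuadraticMap.associated_left_inverse ℝ fun x y => ?_
  rw [toLinearMap₂'_apply', toLinearMap₂'_apply', dotProduct_mulVec, dotProduct_comm,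
    ← mulVec_transpose, hH.eq]

lemma toMatrix'_toQuadraticForm' (hH : H.IsSymm) : H.toQuadraticForm'.toMatrix' = H := by
  rw [QuadraticForm.toMatrix', associated_toQuadraticForm' hH]
  exact (LinearMap.toMatrix₂' ℝ).apply_symm_apply H

lemma sigNeg_toQuadraticForm'_le (H : Matrix (Fin N) (Fin N) ℝ) :
    sigNeg H.toQuadraticForm' ≤ N := by
  rw [← sigPos_neg]
  simpa using sigPos_le_finrank (-H.toQuadraticForm')

/-- Two diagonal forms with weights `±1` and equally many negative weights agree up to a
permutation of the coordinates. -/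
lemma exists_perm_of_ncard_eq {ι : Type*} [Finite ι] {σ w : ι → ℝ} (hσ : ∀ i, σ i = 1 ∨ σ i = -1)
    (hw : ∀ i, w i = -1 ∨ w i = 1) (h : {i | w i < 0}.ncard = {i | σ i < 0}.ncard) :
    ∃ π : Equiv.Perm ι, ∀ i, σ (π i) = w i := by
  classical
  have := Fintype.ofFinite ι
  have hcard : Fintype.card {i // w i < 0} = Fintype.card {i // σ i < 0} := by
    rw [← Nat.card_eq_fintype_card, ← Nat.card_eq_fintype_card]
    exact h
  let e := Fintype.equivOfCardEq hcard
  refine ⟨e.extendSubtype, fun i => ?_⟩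
  have hiff : w i < 0 ↔ σ (e.extendSubtype i) < 0 :=
    ⟨e.extendSubtype_mem i, not_imp_not.1 (e.extendSubtype_not_mem i)⟩
  rcases hσ (e.extendSubtype i) with h2 | h2 <;> rcases hw i with h3 | h3 <;>
    rw [h2, h3] at hiff <;> first | (rw [h2, h3]; done) | norm_num at hiff

/-- **Sylvester's law of inertia** with a prescribed diagonal form; the determinant of the change
of coordinates is determined by that of the matrix. -/
theorem exists_linearEquiv_diagonalizing (hH : H.IsSymm) (hdet : H.det ≠ 0) {σ : Fin N → ℝ}
    (hσ : ∀ i, σ i = 1 ∨ σ i = -1)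
    (hk : (∑ i, if σ i < 0 then 1 else 0) = sigNeg H.toQuadraticForm') :
    ∃ e : (Fin N → ℝ) ≃ₗ[ℝ] (Fin N → ℝ),
      (∀ x, x ⬝ᵥ H *ᵥ x = ∑ i, σ i * e x i ^ 2) ∧
        |LinearMap.det (e : (Fin N → ℝ) →ₗ[ℝ] (Fin N → ℝ))| = √|H.det| := by
  set Q := H.toQuadraticForm' with hQ
  have hsep : (QuadraticMap.associated (R := ℝ) Q).SeparatingLeft := by
    rw [associated_toQuadraticForm' hH]
    exact LinearMap.separatingLeft_toLinearMap₂'_of_det_ne_zero' hdet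
  obtain ⟨w, hw, hQw⟩ := QuadraticForm.equivalent_one_neg_one_weighted_sum_squared Q hsep
  have hsig := QuadraticForm.sigNeg_of_equiv_weightedSumSquares hQw
  have hfin : Module.finrank ℝ (Fin N → ℝ) = N := by simp
  generalize Module.finrank ℝ (Fin N → ℝ) = M at w hw hQw hsig hfin
  subst hfin
  obtain ⟨e₀⟩ := hQw
  obtain ⟨π, hπ⟩ := exists_perm_of_ncard_eq hσ hw (by
    rw [← hsig, ← hk, ← Finset.card_filter, ← Set.ncard_coe_finset]
    simp)
  let e := e₀.toLinearEquiv.trans (LinearEquiv.funCongrLeft ℝ ℝ π.symm)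
  have he : ∀ x, x ⬝ᵥ H *ᵥ x = ∑ i, σ i * e x i ^ 2 := by
    intro x
    rw [← toQuadraticForm'_apply, ← hQ, ← e₀.map_app x, QuadraticMap.weightedSumSquares_apply,
      ← Equiv.sum_comp π (fun i => σ i * e x i ^ 2)]
    refine Finset.sum_congr rfl fun i _ => ?_
    rw [hπ, smul_eq_mul, pow_two]
    simp [e, LinearEquiv.funCongrLeft]
  refine ⟨e, he, ?_⟩
  have hσsymm : (diagonal σ).IsSymm := isSymm_diagonal σ
  have hcomp : Q = (diagonal σ).toQuadraticForm'.comp (e : (Fin M → ℝ) →ₗ[ℝ] (Fin M → ℝ)) := by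
    ext x
    rw [hQ, toQuadraticForm'_apply, he, QuadraticMap.comp_apply, toQuadraticForm'_apply]
    simp only [dotProduct, mulVec_diagonal]
    exact Finset.sum_congr rfl fun i _ => by simp; ring
  have hd : H.det = LinearMap.det (e : (Fin M → ℝ) →ₗ[ℝ] (Fin M → ℝ)) ^ 2 * ∏ i, σ i := by
    conv_lhs => rw [← toMatrix'_toQuadraticForm' hH, ← hQ, hcomp, QuadraticForm.toMatrix'_comp,
      toMatrix'_toQuadraticForm' hσsymm]
    rw [det_mul, det_mul, det_transpose, det_diagonal, LinearMap.det_toMatrix']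
    ring
  have habs : |∏ i, σ i| = 1 := by
    rw [Finset.abs_prod]
    exact Finset.prod_eq_one fun i _ => by rcases hσ i with h | h <;> simp [h]
  rw [hd, abs_mul, habs, mul_one, abs_pow, Real.sqrt_sq (abs_nonneg _)]

end

section

variable {N : ℕ}

local notation "ℰ" => EuclideanSpace ℝ (Fin N)

lemma fderiv_fderiv_apply_eq (V : ℰ → ℝ) (q x : ℰ) :
    fderiv ℝ (fderiv ℝ V) q x x = x.ofLp ⬝ᵥ (hessian V q).mulVec x.ofLp := by
  have hx : x = ∑ i, x i • EuclideanSpace.single i (1 : ℝ) := by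
    ext j
    simp [Finset.sum_apply, Pi.single_apply]
  conv_lhs => rw [hx]
  simp only [map_sum, map_smul, _root_.sum_apply, _root_.smul_apply, hessian,
    dotProduct, Matrix.mulVec, Matrix.of_apply, smul_eq_mul, Finset.mul_sum]
  rw [Finset.sum_comm]
  exact Finset.sum_congr rfl fun i _ => Finset.sum_congr rfl fun j _ => by ring

lemma isSymm_hessian {V : ℰ → ℝ} {q : ℰ} (hV : ContDiffAt ℝ ∞ V q) : (hessian V q).IsSymm := by
  ext i j
  exact (hV.isSymmSndFDerivAt
    (by simpa using WithTop.coe_le_coe.2 (le_top : (2 : ℕ∞) ≤ ⊤))).eq _ _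

lemma eq_zero_of_fderiv_fderiv_eq_zero {V : ℰ → ℝ} {q : ℰ} (hdet : (hessian V q).det ≠ 0)
    {x : ℰ} (hx : fderiv ℝ (fderiv ℝ V) q x = 0) : x = 0 := by
  have h : Matrix.vecMul x.ofLp (hessian V q) = 0 := by
    ext j
    have hx' : x = ∑ i, x i • EuclideanSpace.single i (1 : ℝ) := by
      ext j
      simp [Finset.sum_apply, Pi.single_apply]
    have := congrArg (fun T => T (EuclideanSpace.single j 1)) hx
    rw [hx'] at this
    simpa [Matrix.vecMul, dotProduct, hessian, map_sum, _root_.sum_apply] using this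
  have := Matrix.eq_zero_of_vecMul_eq_zero hdet h
  ext i
  exact congrFun this i

/-- Linear coordinates in which the Hessian form is diagonal with the prescribed signs. -/
theorem exists_continuousLinearEquiv_diagForm {V : ℰ → ℝ} {q : ℰ} (hV : ContDiffAt ℝ ∞ V q)
    (hdet : (hessian V q).det ≠ 0) {σ : Fin N → ℝ} (hσ : ∀ i, σ i = 1 ∨ σ i = -1)
    (hk : (∑ i, if σ i < 0 then 1 else 0) = morseIndex V q) :
    ∃ L : ℰ ≃L[ℝ] ℰ, (∀ x, 1 / 2 * fderiv ℝ (fderiv ℝ V) q x x = diagForm σ (L x)) ∧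
      |(L : ℰ →L[ℝ] ℰ).det| = √|(hessian V q).det| := by
  obtain ⟨e, he, hed⟩ := exists_linearEquiv_diagonalizing (isSymm_hessian hV) hdet hσ hk
  let c := WithLp.linearEquiv 2 ℝ (Fin N → ℝ)
  let e' : ℰ ≃ₗ[ℝ] ℰ := (c.trans e).trans c.symm
  refine ⟨e'.toContinuousLinearEquiv, fun x => ?_, ?_⟩
  · rw [fderiv_fderiv_apply_eq, he, diagForm]
    simp [e', c]
    ring
  · rw [← hed]
    congr 1
    exact LinearMap.det_conj (e : (Fin N → ℝ) →ₗ[ℝ] (Fin N → ℝ)) c.symm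

end

/-! ### The density near a stationary point -/

section

variable {N k : ℕ}

local notation "ℰ" => EuclideanSpace ℝ (Fin N)

lemma HasDens.of_integral_eq {E F : Type*} [MeasureSpace E] [MeasureSpace F] {w V : E → ℝ}
    {a Q : F → ℝ} {ρ : ℝ → ℝ} (h : HasDens a Q ρ)
    (he : ∀ g : ℝ → ℝ, ∫ q, w q * g (V q) = ∫ x, a x * g (Q x)) : HasDens w V ρ :=
  ⟨h.integrable, h.bounded_support, fun g hg => (he g).trans (h.integral_eq g hg)⟩

/-- All smooth weights have densities with respect to some diagonal form of index `k`, and the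
singular term is proportional to the value of the weight at the origin. -/
theorem exists_diagForm_densities (hN : 0 < N) (hk : k ≤ N) :
    ∃ σ : Fin N → ℝ, (∀ i, σ i = 1 ∨ σ i = -1) ∧ (∑ i, if σ i < 0 then 1 else 0) = k ∧
      ∀ w : ℰ → ℝ, ContDiff ℝ ∞ w → HasCompactSupport w → ∃ ρ, HasDens w (diagForm σ) ρ ∧
        ContNear ρ ∧ PolyMod ((N : ℝ) / 2) fun x => ρ x - w 0 * modelTerm N k x := by
  obtain ⟨σ, hσ, hσk, χ, hχ, hχc, hχ0, ρ₀, hρ₀, hρ₀c, hρ₀s⟩ := hasModelWeight hN hk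
  refine ⟨σ, hσ, hσk, fun w hw hwc => ?_⟩
  let L := EuclideanSpace.equiv (Fin N) ℝ
  have hN' : (0 : ℝ) < N := by exact_mod_cast hN
  have hd : HasDens (χ ∘ L) (diagForm σ) ρ₀ := hρ₀.of_integral_eq fun g =>
    (PiLp.volume_preserving_ofLp (Fin N)).integral_comp
      (MeasurableEquiv.toLp 2 (Fin N → ℝ)).symm.measurableEmbedding
      (fun y => χ y * g ((∑ i, σ i * y i ^ 2) / 2))
  have hprim : PolyMod ((N : ℝ) / 2) fun x => ∫ y in Set.Iic x, ρ₀ y := by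
    have h1 : PolyMod ((N : ℝ) / 2 - 1) ρ₀ :=
      ((hρ₀s.mono (by linarith)).add (polyMod_modelTerm hN k)).congr
        (Eventually.of_forall fun x => by ring)
    simpa using h1.integral_Iic (by linarith) hρ₀.integrable
  obtain ⟨ρ, hρ, hρc, hρs⟩ := exists_hasDens_diagForm hσ (hχ.comp L.contDiff)
    (hχc.comp_homeomorph L.toHomeomorph) (by simpa [L] using hχ0) hd hρ₀c (by positivity) hprim
    hw hwc
  refine ⟨ρ, hρ, hρc, (hρs.add (hρ₀s.const_mul (w 0))).congr (Eventually.of_forall fun x => ?_)⟩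
  ring

lemma exists_hasDens_near_zero (hN : 0 < N) {V : ℰ → ℝ} (hV : ContDiff ℝ ∞ V) (h0 : V 0 = 0)
    (h1 : fderiv ℝ V 0 = 0) (hdet : (hessian V 0).det ≠ 0) :
    ∃ U : Set ℰ, IsOpen U ∧ 0 ∈ U ∧ ∀ w : ℰ → ℝ, ContDiff ℝ ∞ w → HasCompactSupport w →
      tsupport w ⊆ U → ∃ ρ, HasDens w V ρ ∧ ContNear ρ ∧ PolyMod ((N : ℝ) / 2) fun x =>
        ρ x - w 0 / √|(hessian V 0).det| * modelTerm N (morseIndex V 0) x := by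
  obtain ⟨σ, hσ, hσk, hσd⟩ := exists_diagForm_densities hN
    (sigNeg_toQuadraticForm'_le (hessian V 0))
  obtain ⟨L, hL, hLd⟩ := exists_continuousLinearEquiv_diagForm hV.contDiffAt hdet hσ hσk
  obtain ⟨f, hf0, hf0', hfd, hfs, hfL, hfV⟩ := exists_morse_chart hV h0 h1
    fun x => eq_zero_of_fderiv_fderiv_eq_zero hdet
  refine ⟨f.source, f.open_source, hf0, fun w hw hwc hws => ?_⟩
  obtain ⟨a, ha, hac, haw, hai⟩ := exists_transported_weight f hfs hfL
    (Q := fun x => 1 / 2 * fderiv ℝ (fderiv ℝ V) 0 x x) hfV hw hwc hws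
  obtain ⟨a', ha', hac', haw', hai'⟩ := exists_transported_weight
    L.toHomeomorph.toOpenPartialHomeomorph (fun q _ => L.contDiff.contDiffAt)
    (fun q _ => ⟨L, L.hasFDerivAt⟩) (Q := diagForm σ) (fun q _ => hL q) ha hac
    (Set.subset_univ _)
  have hw0 : a' 0 = w 0 / √|(hessian V 0).det| := by
    have e1 := haw 0 hf0
    rw [hf0', hfd] at e1
    have e2 : a' (L 0) = a 0 / |(fderiv ℝ L 0).det| := haw' 0 (Set.mem_univ _)
    rw [map_zero, L.fderiv, hLd, e1] at e2
    have e3 : (ContinuousLinearMap.id ℝ ℰ).det = 1 := LinearMap.det_id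
    rw [e2, e3, abs_one, div_one]
  obtain ⟨ρ, hρ, hρc, hρs⟩ := hσd a' ha' hac'
  rw [hw0] at hρs
  exact ⟨ρ, hρ.of_integral_eq fun g => (hai g).trans (hai' g), hρc, hρs⟩

/-- Near a nondegenerate stationary point of value `0`, the density of a weight has the singular
term of the Hessian form, divided by the Jacobian of the diagonalizing coordinates. -/
theorem exists_hasDens_near_stationary (hN : 0 < N) {V : ℰ → ℝ} (hV : ContDiff ℝ ∞ V) {p : ℰ}
    (h0 : V p = 0) (h1 : fderiv ℝ V p = 0) (hdet : (hessian V p).det ≠ 0) :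
    ∃ U : Set ℰ, IsOpen U ∧ p ∈ U ∧ ∀ w : ℰ → ℝ, ContDiff ℝ ∞ w → HasCompactSupport w →
      tsupport w ⊆ U → ∃ ρ, HasDens w V ρ ∧ ContNear ρ ∧ PolyMod ((N : ℝ) / 2) fun x =>
        ρ x - w p / √|(hessian V p).det| * modelTerm N (morseIndex V p) x := by
  have hd : ∀ {F : Type} [NormedAddCommGroup F] [NormedSpace ℝ F] (f : ℰ → F),
      fderiv ℝ (fun x => f (x + p)) = fun x => fderiv ℝ f (x + p) :=
    fun f => funext fun x => fderiv_comp_add_right p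
  have hH : hessian (fun x => V (x + p)) 0 = hessian V p := by
    ext i j
    simp only [hessian, Matrix.of_apply]
    rw [hd V, hd (fderiv ℝ V)]
    simp only [zero_add]
  have hI : morseIndex (fun x => V (x + p)) 0 = morseIndex V p := by
    rw [morseIndex, hH, morseIndex]
  have hs : ContDiff ℝ ∞ fun x : ℰ => x + p := contDiff_id.add contDiff_const
  obtain ⟨U, hU, hU0, h⟩ := exists_hasDens_near_zero hN (V := fun x => V (x + p)) (hV.comp hs)
    (by simpa using h0) (by rw [hd V]; simpa using h1) (by rwa [hH])
  refine ⟨(fun x => x - p) ⁻¹' U, hU.preimage (by fun_prop), by simpa using hU0,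
    fun w hw hwc hws => ?_⟩
  have hts : tsupport (fun x => w (x + p)) = (fun x => x + p) ⁻¹' tsupport w :=
    tsupport_comp_eq_preimage w (Homeomorph.addRight p)
  obtain ⟨ρ, hρ, hρc, hρs⟩ := h (fun x => w (x + p)) (hw.comp hs)
    (hwc.comp_homeomorph (Homeomorph.addRight p)) (by
      rw [hts]
      intro x hx
      simpa using hws hx)
  refine ⟨ρ, hρ.of_integral_eq fun g => ?_, hρc, ?_⟩
  · exact (integral_add_right_eq_self (fun q => w q * g (V q)) p).symm
  · rw [hI, hH] at hρs
    simpa using hρs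

/-- The density of a weight whose support contains a single stationary point, of value `0`. -/
theorem exists_hasDens_of_unique_stationary (hN : 0 < N) {V : ℰ → ℝ} (hV : ContDiff ℝ ∞ V) {p : ℰ}
    (h0 : V p = 0) (h1 : fderiv ℝ V p = 0) (hdet : (hessian V p).det ≠ 0) {w : ℰ → ℝ}
    (hw : ContDiff ℝ ∞ w) (hwc : HasCompactSupport w)
    (hstat : ∀ q ∈ tsupport w, fderiv ℝ V q = 0 → q = p) :
    ∃ ρ, HasDens w V ρ ∧ ContNear ρ ∧ PolyMod ((N : ℝ) / 2) fun x =>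
      ρ x - w p / √|(hessian V p).det| * modelTerm N (morseIndex V p) x := by
  obtain ⟨U, hU, hpU, h⟩ := exists_hasDens_near_stationary hN hV h0 h1 hdet
  obtain ⟨χ, hχ, hχc, hχU, hχ1⟩ := exists_smooth_cutoff isCompact_singleton hU
    (Set.singleton_subset_iff.2 hpU)
  have hχp := hχ1 p rfl
  obtain ⟨ρ₁, hρ₁, hρ₁c, hρ₁s⟩ := h (fun q => w q * χ q) (hw.mul hχ) hχc.mul_left
    ((tsupport_mul_subset_right).trans hχU)
  have hw2 : ContDiff ℝ ∞ fun q => w q * (1 - χ q) := hw.mul (contDiff_const.sub hχ)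
  have hw2c : HasCompactSupport fun q => w q * (1 - χ q) := hwc.mul_right
  obtain ⟨ρ₂, hρ₂, hρ₂c, hρ₂s⟩ := exists_hasDens_of_fderiv_ne_zero hV hw2 hw2c (by
    intro q hq hq0
    obtain rfl := hstat q (tsupport_mul_subset_left hq) hq0
    refine (notMem_tsupport_iff_eventuallyEq.2 ?_) hq
    filter_upwards [hχp] with y hy
    simp [hy]) (S := (N : ℝ) / 2) (by positivity)
  refine ⟨fun x => ρ₁ x + ρ₂ x, ?_, hρ₁c.add hρ₂c, ?_⟩
  · have hint : ∀ {u : ℰ → ℝ}, ContDiff ℝ ∞ u → HasCompactSupport u → ∀ g : ℝ → ℝ, Continuous g →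
        Integrable fun q => u q * g (V q) := fun hu huc g hg =>
      (hu.continuous.mul (hg.comp hV.continuous)).integrable_of_hasCompactSupport huc.mul_right
    have := hρ₁.add hρ₂ (hint (hw.mul hχ) hχc.mul_left) (hint hw2 hw2c)
    convert this using 2 with q
    ring
  · refine (hρ₁s.add hρ₂s).congr (Eventually.of_forall fun x => ?_)
    simp only [hχp.self_of_nhds]
    ring

end

/-! ### From the energy to the energy per degree of freedom -/

lemma tendsto_const_mul_nhdsNE_zero {c : ℝ} (hc : c ≠ 0) :
    Tendsto (fun v : ℝ => c * v) (𝓝[≠] 0) (𝓝[≠] 0) := by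
  refine tendsto_nhdsWithin_iff.2 ⟨?_, ?_⟩
  · refine Tendsto.mono_left ?_ nhdsWithin_le_nhds
    simpa using (continuous_const_mul c).tendsto 0
  · filter_upwards [self_mem_nhdsWithin] with v hv
    exact mul_ne_zero hc hv

lemma PolyMod.comp_const_mul {s : ℝ} {r : ℝ → ℝ} (h : PolyMod s r) {c : ℝ} (hc : c ≠ 0) :
    PolyMod s fun v => r (c * v) := by
  obtain ⟨P, hP⟩ := h
  refine ⟨P.comp (Polynomial.C c * Polynomial.X), fun t ht => ?_⟩
  have h1 := (hP t ht).comp_tendsto (tendsto_const_mul_nhdsNE_zero hc)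
  refine (h1.trans (IsBigO.of_bound (|c| ^ t) (Eventually.of_forall fun v => ?_))).congr_left
    fun v => ?_
  · simp only [Function.comp_apply, abs_mul]
    rw [Real.mul_rpow (abs_nonneg _) (abs_nonneg _), norm_mul, Real.norm_of_nonneg
      (Real.rpow_nonneg (abs_nonneg c) t)]
  · simp

/-- In the case with a logarithm, the change of variables `x = N v` adds a multiple of
`v ^ ((N - 2) / 2)`. -/
lemma polyMod_modelTerm_sub_hTerm {N : ℕ} (hN : 0 < N) (k : ℕ) (s : ℝ) :
    PolyMod s fun v => modelTerm N k (N * v) - hTerm N k v := by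
  have hN' : (0 : ℝ) < N := by exact_mod_cast hN
  have hpos : ∀ p x : ℝ, (N * x) ^ p * heavisideStep (N * x) =
      (N : ℝ) ^ p * (x ^ p * heavisideStep x) := by
    intro p x
    rcases le_or_gt x 0 with hx | hx
    · have h1 : ¬ 0 < N * x := not_lt.2 (mul_nonpos_of_nonneg_of_nonpos hN'.le hx)
      simp [heavisideStep, h1, not_lt.2 hx]
    · have h1 : 0 < N * x := mul_pos hN' hx
      simp [heavisideStep, h1, hx, Real.mul_rpow hN'.le hx.le]
  by_cases hk : Even k
  · refine (polyMod_const s 0).congr (Eventually.of_forall fun v => ?_)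
    simp only [modelTerm, hTerm, hk, if_true, hpos]
    ring
  by_cases hNe : Even N
  · obtain ⟨m, hm⟩ : ∃ m, N = 2 * m + 2 := by
      obtain ⟨m, hm⟩ := hNe
      exact ⟨m - 1, by omega⟩
    have hpow : (N : ℝ) ^ (((N : ℝ) - 2) / 2) = (N : ℝ) ^ ((N - 2) / 2) := by
      rw [← Real.rpow_natCast]
      congr 1
      have : (N - 2) / 2 = m := by omega
      rw [this, hm]
      push_cast
      ring
    refine ((polyMod_pow s ((N - 2) / 2)).const_mul ((2 * Real.pi) ^ ((N : ℝ) / 2) /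
      Real.Gamma ((N : ℝ) / 2) * ((-1) ^ ((k + 1) / 2) * Real.pi⁻¹ * ((N : ℝ) ^ ((N - 2) / 2) *
        Real.log N)))).congr ?_
    filter_upwards [self_mem_nhdsWithin] with v (hv : v ≠ 0)
    simp only [modelTerm, hTerm, hk, hNe, if_true, if_false, hpow, mul_pow, Real.log_abs,
      Real.log_mul hN'.ne' hv]
    ring
  · refine (polyMod_const s 0).congr (Eventually.of_forall fun v => ?_)
    simp only [modelTerm, hTerm, hk, hNe, if_false, ← mul_neg, hpos]
    ring

lemma PolyMod.hasSingularExpansion {N k : ℕ} (hN : 0 < N) {d : ℝ} {ρ : ℝ → ℝ}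
    (h : PolyMod ((N : ℝ) / 2) fun x => ρ x - 1 / √|d| * modelTerm N k x) :
    HasSingularExpansion N k d fun v => ρ (N * v) := by
  have hN' : (N : ℝ) ≠ 0 := by exact_mod_cast hN.ne'
  have h1 : PolyMod ((N : ℝ) / 2) fun v => ρ (N * v) - hTerm N k v / √|d| :=
    ((h.comp_const_mul hN').add ((polyMod_modelTerm_sub_hTerm hN k _).const_mul (1 / √|d|))).congr
      (Eventually.of_forall fun v => by ring)
  obtain ⟨P, hP, hO⟩ := h1.exists_natDegree_lt hN
  refine ⟨P, hP, fun ε hε => ?_⟩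
  have h2 := hO ((N : ℝ) / 2 - ε / 2) (by linarith)
  have h3 : (fun v : ℝ => |v| ^ ((N : ℝ) / 2 - ε / 2)) =o[𝓝[≠] 0]
      fun v => |v| ^ ((N : ℝ) / 2 - ε) := by
    have h4 : Tendsto (fun v : ℝ => |v| ^ (ε / 2)) (𝓝[≠] 0) (𝓝 0) := by
      have : ContinuousAt (fun v : ℝ => |v| ^ (ε / 2)) 0 :=
        continuous_abs.continuousAt.rpow_const (Or.inr (by positivity))
      have := this.tendsto.mono_left (nhdsWithin_le_nhds (s := {0}ᶜ))
      rwa [abs_zero, Real.zero_rpow (by positivity)] at this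
    refine isLittleO_of_tendsto' ?_ (h4.congr' ?_)
    · filter_upwards [self_mem_nhdsWithin] with v (hv : v ≠ 0) h0
      exact absurd h0 (Real.rpow_pos_of_pos (abs_pos.2 hv) _).ne'
    · filter_upwards [self_mem_nhdsWithin] with v (hv : v ≠ 0)
      rw [← Real.rpow_sub (abs_pos.2 hv)]
      congr 1
      ring
  exact (h2.trans_isLittleO h3).congr_left fun v => by ring

/-! ### Delta integrals on an open set -/

section

variable {N : ℕ}

local notation "ℰ" => EuclideanSpace ℝ (Fin N)

lemma contDiff_mul_of_tsupport_subset {G : Set ℰ} (hG : IsOpen G) {V θ : ℰ → ℝ}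
    (hV : ContDiffOn ℝ ∞ V G) (hθ : ContDiff ℝ ∞ θ) (hθG : tsupport θ ⊆ G) :
    ContDiff ℝ ∞ fun q => θ q * V q := by
  rw [contDiff_iff_contDiffAt]
  intro q
  by_cases hq : q ∈ tsupport θ
  · exact hθ.contDiffAt.mul (hV.contDiffAt (hG.mem_nhds (hθG hq)))
  · refine (contDiffAt_const (c := (0 : ℝ))).congr_of_eventuallyEq ?_
    filter_upwards [notMem_tsupport_iff_eventuallyEq.1 hq] with y hy
    simp [hy]

lemma IsDeltaIntegral.congr {G : Set ℰ} {w V w' V' : ℰ → ℝ} {e I : ℝ}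
    (hG : MeasurableSet G)
    (h : IsDeltaIntegral G w V e I)
    (he : ∀ ψ : ℝ → ℝ, IsDeltaProfile ψ → ∀ᶠ η in 𝓝[>] (0 : ℝ), ∀ q ∈ G,
      w q * (η⁻¹ * ψ ((V q - e) / η)) = w' q * (η⁻¹ * ψ ((V' q - e) / η))) :
    IsDeltaIntegral G w' V' e I := by
  intro ψ hψ
  obtain ⟨h1, h2⟩ := h ψ hψ
  refine ⟨?_, h2.congr' ?_⟩
  · filter_upwards [h1, he ψ hψ] with η hη hη'
    exact hη.congr_fun hη' hG
  · filter_upwards [he ψ hψ] with η hη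
    exact setIntegral_congr_fun hG hη

/-- The contribution of the stationary point. -/
theorem exists_expansion_of_cutoff {k : ℕ} (hN : 0 < N) {G : Set ℰ} (hG : IsOpen G) {V : ℰ → ℝ}
    (hV : IsMorseOn V G) {p : ℰ} (hp : p ∈ G) (hstat : ∀ q ∈ G, fderiv ℝ V q = 0 ↔ q = p)
    (hindex : morseIndex V p = k) (hzero : V p = 0) {φ : ℰ → ℝ} (hφ : ContDiff ℝ ∞ φ)
    (hφc : HasCompactSupport φ) (hφG : tsupport φ ⊆ G) (hφp : φ p = 1) :
    ∃ Ω : ℝ → ℝ, (∀ᶠ v in 𝓝[≠] (0 : ℝ), IsDeltaIntegral G φ V (N * v) (Ω v)) ∧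
      HasSingularExpansion N k (hessian V p).det Ω := by
  obtain ⟨θ, hθ, hθc, hθG, hθ1⟩ := exists_smooth_cutoff hφc.isCompact hG hφG
  -- `θ V` extends `V` smoothly from the support of `φ` to the whole space
  have hW := contDiff_mul_of_tsupport_subset hG hV.1 hθ hθG
  set W : ℰ → ℝ := fun q => θ q * V q with hWdef
  have hWV : ∀ q ∈ tsupport φ, W =ᶠ[𝓝 q] V := fun q hq => by
    filter_upwards [hθ1 q hq] with y hy
    simp [hWdef, hy]
  have hpφ : p ∈ tsupport φ := subset_tsupport _ (by simp [hφp])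
  have hfd : ∀ q ∈ tsupport φ, fderiv ℝ W q = fderiv ℝ V q := fun q hq => (hWV q hq).fderiv_eq
  have hH : hessian W p = hessian V p := by
    ext i j
    simp only [hessian, Matrix.of_apply]
    rw [(hWV p hpφ).fderiv.fderiv_eq]
  have hI : morseIndex W p = k := by rw [morseIndex, hH, ← hindex, morseIndex]
  have h1 : fderiv ℝ V p = 0 := (hstat p hp).2 rfl
  obtain ⟨ρ, hρ, hρc, hρs⟩ := exists_hasDens_of_unique_stationary hN hW (p := p)
    (by rw [(hWV p hpφ).self_of_nhds, hzero]) (by rw [hfd p hpφ, h1])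
    (by rw [hH]; exact hV.2 p hp h1) hφ hφc (fun q hq hq0 => (hstat q (hφG hq)).1 (by rw [← hfd q hq, hq0]))
  rw [hH, hI, hφp] at hρs
  have hN' : (N : ℝ) ≠ 0 := by exact_mod_cast hN.ne'
  refine ⟨fun v => ρ (N * v), ?_, hρs.hasSingularExpansion hN⟩
  filter_upwards [(tendsto_const_mul_nhdsNE_zero hN').eventually hρc] with v hv
  refine (hρ.isDeltaIntegral hφ.continuous hφc hφG hW.continuous hv).congr hG.measurableSet
    fun ψ _ => Eventually.of_forall fun η q _ => ?_
  by_cases hq : q ∈ tsupport φ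
  · rw [(hWV q hq).self_of_nhds]
  · simp [image_eq_zero_of_notMem_tsupport hq]

/-- Only levels close to `e` contribute to the delta integral at `e`. -/
lemma IsDeltaIntegral.congr_weight {G : Set ℰ} (hG : MeasurableSet G) {w w' V : ℰ → ℝ} {e I b : ℝ}
    (hw : ∀ q ∈ G, |V q| ≤ b → w q = w' q) (he : |e| < b) (h : IsDeltaIntegral G w V e I) :
    IsDeltaIntegral G w' V e I := by
  refine h.congr hG fun ψ hψ => ?_
  obtain ⟨R, hR⟩ := hψ.hasCompactSupport.isCompact.isBounded.subset_closedBall 0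
  have hsmall : ∀ᶠ η in 𝓝[>] (0 : ℝ), η * R < b - |e| := by
    apply eventually_nhdsWithin_of_eventually_nhds
    have : Tendsto (fun η : ℝ => η * R) (𝓝 0) (𝓝 (0 * R)) := tendsto_id.mul_const R
    exact this.eventually_lt_const (by linarith)
  filter_upwards [hsmall, self_mem_nhdsWithin] with η hη (hη0 : 0 < η) q hq
  by_cases hψ0 : ψ ((V q - e) / η) = 0
  · simp [hψ0]
  · have h1 : |(V q - e) / η| ≤ R := by
      simpa only [mem_closedBall_zero_iff, Real.norm_eq_abs] using hR (subset_tsupport _ hψ0)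
    rw [abs_div, abs_of_pos hη0, div_le_iff₀ hη0] at h1
    rw [hw q hq]
    have := abs_sub_abs_le_abs_sub (V q) e
    linarith

end

end

theorem theorem1 (N k : ℕ) (hN : 0 < N)
    (G : Set (EuclideanSpace ℝ (Fin N))) (hG : IsOpen G)
    (V : EuclideanSpace ℝ (Fin N) → ℝ) (hV : IsMorseOn V G)
    (qs : EuclideanSpace ℝ (Fin N)) (hqs : qs ∈ G)
    (hstat : ∀ q ∈ G, fderiv ℝ V q = 0 ↔ q = qs)
    (hindex : morseIndex V qs = k) (hzero : V qs = 0) :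
    -- the density of states of `V` on `G`, when no level close to `0` reaches the boundary of `G`
    -- or infinity
    ((∃ b : ℝ, 0 < b ∧ IsCompact {q ∈ G | |V q| ≤ b}) →
      ∃ Ω : ℝ → ℝ, (∀ᶠ v in 𝓝[≠] (0 : ℝ), IsDeltaIntegral G (fun _ => 1) V (N * v) (Ω v)) ∧
        HasSingularExpansion N k (hessian V qs).det Ω) ∧
    -- without any condition at the boundary: the contribution of a neighbourhood of `qs`, cut out
    -- by an arbitrary smooth cutoff function
    (∀ φ : EuclideanSpace ℝ (Fin N) → ℝ, ContDiff ℝ ∞ φ → HasCompactSupport φ → tsupport φ ⊆ G →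
      (∀ᶠ q in 𝓝 qs, φ q = 1) →
      ∃ Ω : ℝ → ℝ, (∀ᶠ v in 𝓝[≠] (0 : ℝ), IsDeltaIntegral G φ V (N * v) (Ω v)) ∧
        HasSingularExpansion N k (hessian V qs).det Ω) := by
  refine ⟨?_, fun φ hφ hφc hφG hφ1 =>
    exists_expansion_of_cutoff hN hG hV hqs hstat hindex hzero hφ hφc hφG hφ1.self_of_nhds⟩
  rintro ⟨b, hb, hK⟩
  obtain ⟨κ, hκ, hκc, hκG, hκ1⟩ := exists_smooth_cutoff hK hG fun q hq => hq.1
  obtain ⟨Ω, hΩ, hΩs⟩ := exists_expansion_of_cutoff hN hG hV hqs hstat hindex hzero hκ hκc hκG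
    (hκ1 qs ⟨hqs, by simp [hzero, hb.le]⟩).self_of_nhds
  refine ⟨Ω, ?_, hΩs⟩
  have hsmall : ∀ᶠ v : ℝ in 𝓝[≠] 0, |(N : ℝ) * v| < b := by
    have hN' : (N : ℝ) ≠ 0 := by exact_mod_cast hN.ne'
    exact (tendsto_const_mul_nhdsNE_zero hN').eventually (eventually_abs_lt hb)
  filter_upwards [hΩ, hsmall] with v hv hvb
  exact hv.congr_weight hG.measurableSet (fun q hq hqb => (hκ1 q ⟨hq, hqb⟩).self_of_nhds) hvb
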